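/- **Looped diagrams.** A commutative Sullivan diagram $\Gamma$ with $p$ white vertices $v_1,\dots,v_p$ and $N$ labeled leaves consists of: degrees $|v_i|\ge 0$, so that $v_i$ has $|v_i|+1$ cyclically ordered half-edges, the first of which is called the start half-edge; and a partition of the set of all ends (half-edges at white vertices and labeled leaves) into arc components, each with a genus (first Betti number) in $\mathbb N$, together with finitely many components without ends, each with a genus. (These are the equivalence classes of black and white graphs with trivalent black vertices under the sliding relation and reordering of half-edges at black vertices.) A half-edge at a white vertex that is alone in an arc component of genus $0$ is an unlabeled leaf. The half-edges at $v_i$ cut the circle around $v_i$ into oriented segments $s^i_1,\dots,s^i_{|v_i|+1}$, where $s^i_t$ runs from the $t$-th half-edge to the next one. A loop from a leaf to itself is a (possibly empty, then called constant) sequence of segments with signs $\pm s$ that starts and ends at the arc component of the leaf, such that each one starts at the arc component at which the preceding one ends, and no $s$ is directly followed by $-s$ or vice versa. A looped diagram in $l\mathcal D(\binom{n_1}{m_1},\binom{n_2}{m_2})$ is a commutative Sullivan diagram with $n_2$ white vertices and $n_1+m_1+m_2$ leaves, together with a loop $\gamma_i$ from the $i$-th leaf to itself for each $i\le n_1$.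 $l\mathcal D(\binom{n_1}{m_1},\binom{n_2}{m_2})$ is the free abelian group on these diagrams modulo those in which a non-start half-edge at a white vertex is an unlabeled leaf. $l\mathcal D_+$ is spanned by the diagrams in which every connected component contains a white vertex or one of the last $m_2$ leaves. *Differential.* For $|v_i|\ge 1$ the blow-up of $\Gamma$ at $s^i_t$ joins the two half-edges bounding $s^i_t$ to one half-edge (merging two arc components and adding their genera, or raising the genus of one by $1$) and removes $s^i_t$ from all loops. The differential $d$ is the sum of all blow-ups at all $s^i_t$ with sign $(-1)^{t+\sum_{j<i}|v_j|}$. *Composition.* For diagrams $x\in l\mathcal D(\binom{n_1}{m_1},\binom{n_2}{m_2})$ and $y\in l\mathcal D(\binom{n_2}{m_2},\binom{n_3}{m_3})$, $y\circ x$ is the signed sum over all ways to glue: remove the white vertices of $x$, glue the start half-edge of its $i$-th white vertex to the $i$-th leaf of $y$, glue the last $m_2$ leaves of $x$ to the leaves $n_2+1,\dots,n_2+m_2$ of $y$, and attach the remaining half-edges of the $i$-th white vertex of $x$ in their order to the white vertices of $y$ along the $i$-th loop of $y$; the segments of $x$ thereby become pieces of the loops of $y$, and the loops of $x$ become loops of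 the result. The sign is that of the permutation that moves the non-start half-edges of $x$, placed in order before those of $y$, to their final positions. Write $(\Gamma,\langle\gamma_1\rangle,\dots,\langle\gamma_n\rangle)=\sum_{T\subseteq\{1,\dots,n\}}(-1)^{|T|}\,(\Gamma$ with the loops $\gamma_j$, $j\in T$, made constant$)$. **Elements.** $\Delta\in l\mathcal D_+(\binom10,\binom20)$ is the diagram with two white vertices with one half-edge each, these half-edges and the leaf forming one arc component of genus $0$, with loop $(s^1_1,s^2_1)$. $\mu=(\Gamma_\mu,\langle s^1_1\rangle,\langle s^1_2\rangle)\in l\mathcal D_+(\binom20,\binom10)$, where $\Gamma_\mu$ has one white vertex with two half-edges which together with the two leaves form one arc component of genus $0$. Let $D=(\Gamma_2,\langle s^1_2\rangle)-(\Gamma_1,\langle s^1_1,s^1_2,s^1_3\rangle)\in l\mathcal D(\binom10,\binom10)$, where both diagrams have one white vertex with three half-edges; in $\Gamma_1$ these and the leaf form one arc component of genus $0$; in $\Gamma_2$ the start half-edge is an unlabeled leaf, and the other two half-edges and the leaf form one arc component of genus $1$. **Operations.** Let $cFr_+$ be the PROP with morphisms $cFr_+(a,b)=l\mathcal D_+(\binom0a,\binom0b)$,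 and let $\Phi$ be a dg-functor from $cFr_+$ to chain complexes over a commutative ring; a commutative cocommutative open Frobenius dg-algebra $A$ is the same as a strict symmetric monoidal functor of this kind, $\Phi(a)=A^{\otimes a}$. The Hochschild complex of $\Phi$ is $\bigoplus_{k\ge0}\Phi(k+1)[k]$ with the sum of the differential of $\Phi$ and the Hochschild differential, reduced by the images of the degeneracies inserting units; for $\Phi=A^{\otimes -}$ it is the reduced Hochschild complex of $A$, with homology $HH_*(A,A)$. An element $G\in l\mathcal D_+(\binom10,\binom10)$ acts on $\Phi(k+1)$ by the combination of diagrams $G\circ l_{k+1}$, where $l_{k+1}$ is one white vertex with $k+1$ labeled leaves in order and the half-edges at the white vertex of a diagram in $G\circ l_{k+1}$ are read as outputs. **Proposition.** The element $D$ lies in $l\mathcal D_+(\binom10,\binom10)\subseteq l\mathcal D(\binom10,\binom10)$ and $$\mu\circ\Delta=d(D)\quad\text{in } l\mathcal D(\tbinom10,\tbinom10).$$ For every dg-functor $\Phi$ from $cFr_+$ to chain complexes over a commutative ring, $\mu\circ\Delta$ acts as zero on the homology of the reduced Hochschild complex of $\Phi$; in particular it acts trivially on the Hochschild homology of every commutative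 cocommutative open Frobenius dg-algebra. -/

import Mathlib

open CategoryTheory

/-! ## Arc systems

An arc component of a black and white graph is a connected graph of (trivalent) black vertices
with some ends; the ends are half-edges at white vertices and labeled leaves. The sliding relation
together with reordering the half-edges at black vertices identifies two connected arc components
exactly if they have the same ends and the same first Betti number. So the part of a
commutative Sullivan diagram outside the white vertices is recorded by the partition of the set of
ends into arc components and the genus (first Betti number) of each of them. -/

/-- Arc components with set of ends `X`: `rel x y` says that the ends `x` and `y` lie on the same
arc component, `genus x` is the genus of the arc component of `x`, and `closed` lists the genera
of the components without ends. -/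
@[ext] structure ArcSystem (X : Type) where
  rel : Setoid X
  genus : X → ℕ
  genus_congr : ∀ x y, rel x y → genus x = genus y
  closed : Multiset ℕ

namespace ArcSystem

variable {X Y : Type}

/-- The genus of an arc component. -/
def genusOf (A : ArcSystem X) : Quotient A.rel → ℕ :=
  Quotient.lift A.genus A.genus_congr

open Classical in
/-- Add an edge between the ends `a` and `b`. If they lie on the same component, its genus
increases by one, otherwise the two components are merged and their genera are added. -/
noncomputable def join (A : ArcSystem X) (a b : X) : ArcSystem X where
  rel := Setoid.ker fun x => if A.rel x b then Quotient.mk A.rel a else Quotient.mk A.rel x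
  genus x :=
    if A.rel a b then (if A.rel x a then A.genus x + 1 else A.genus x)
    else if A.rel x a ∨ A.rel x b then A.genus a + A.genus b else A.genus x
  genus_congr x y h := by
    have e : ∀ u v, Quotient.mk A.rel u = Quotient.mk A.rel v ↔ A.rel u v :=
      fun u v => Quotient.eq
    have s : ∀ u v, A.rel u v → A.rel v u := fun _ _ => A.rel.symm
    have t : ∀ u v w, A.rel u v → A.rel v w → A.rel u w := fun _ _ _ => A.rel.trans
    have g := A.genus_congr
    rw [Setoid.ker_def] at h
    grind
  closed := A.closed

/-- Add an edge for each pair of a list of pairs of ends. -/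
noncomputable def joinList (A : ArcSystem X) (l : List (X × X)) : ArcSystem X :=
  l.foldl (fun B e => B.join e.1 e.2) A

open Classical in
/-- Keep only the ends in the image of `f`; components which lose all their ends become closed. -/
noncomputable def comap [Fintype X] (A : ArcSystem X) (f : Y → X) : ArcSystem Y where
  rel := A.rel.comap f
  genus y := A.genus (f y)
  genus_congr x y h := A.genus_congr (f x) (f y) h
  closed := A.closed + ((Finset.univ : Finset (Quotient A.rel)).filter
    (fun c => ∀ y, Quotient.mk A.rel (f y) ≠ c)).val.map A.genusOf

/-- Disjoint union. -/
def sum (A : ArcSystem X) (B : ArcSystem Y) : ArcSystem (X ⊕ Y) where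
  rel := Setoid.ker (Sum.map (Quotient.mk A.rel) (Quotient.mk B.rel))
  genus := Sum.elim A.genus B.genus
  genus_congr x y h := by
    rw [Setoid.ker_def] at h
    rcases x with x | x <;> rcases y with y | y <;> simp only [Sum.map_inl, Sum.map_inr,
      Sum.inl.injEq, Sum.inr.injEq, reduceCtorEq, Quotient.eq] at h
    · exact A.genus_congr _ _ h
    · exact B.genus_congr _ _ h
  closed := A.closed + B.closed

/-- The arc components are the fibres of `f`, all of genus zero. -/
def ofLabel {L : Type} (f : X → L) : ArcSystem X where
  rel := Setoid.ker f
  genus _ := 0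
  genus_congr _ _ _ := rfl
  closed := 0

/-- A single arc component of genus `g` containing all ends. -/
def single (X : Type) (g : ℕ) : ArcSystem X where
  rel := ⊤
  genus _ := g
  genus_congr _ _ _ := rfl
  closed := 0

end ArcSystem

/-! ## Looped diagrams -/

/-- The half-edges at `p` white vertices of degrees `deg v` (so of valence `deg v + 1`), in their
cyclic order; the half-edge `⟨v, 0⟩` is the start half-edge of the `v`-th white vertex.
The segment of the circle around `v` from the half-edge `t` to the cyclically next half-edge
`t + 1` is denoted by `⟨v, t⟩` as well. -/
abbrev HalfEdge {p : ℕ} (deg : Fin p → ℕ) : Type := Σ v : Fin p, Fin (deg v + 1)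

/-- The half-edges at white vertices which are not start half-edges. -/
abbrev FreeHalfEdge {p : ℕ} (deg : Fin p → ℕ) : Type := Σ v : Fin p, Fin (deg v)

/-- Segments with an orientation, `true` being the positive one. -/
abbrev OrSegment {p : ℕ} (deg : Fin p → ℕ) : Type := HalfEdge deg × Bool

namespace OrSegment

variable {p : ℕ} {deg : Fin p → ℕ}

/-- The half-edge at which an oriented segment starts. -/
def source (s : OrSegment deg) : HalfEdge deg := if s.2 then s.1 else ⟨s.1.1, s.1.2 + 1⟩

/-- The half-edge at which an oriented segment ends. -/
def target (s : OrSegment deg) : HalfEdge deg := if s.2 then ⟨s.1.1, s.1.2 + 1⟩ else s.1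

/-- The segment with the opposite orientation. -/
def neg (s : OrSegment deg) : OrSegment deg := (s.1, !s.2)

end OrSegment

/-- Data of a looped diagram with `p` white vertices, `n + m` labeled leaves and `n` loops:
a commutative Sullivan diagram together with `n` lists of oriented segments. That the `i`-th list
is a loop from the `i`-th leaf to itself is `LoopedDiagram.IsLooped`. -/
structure LoopedDiagram (p m n : ℕ) where
  deg : Fin p → ℕ
  arcs : ArcSystem (HalfEdge deg ⊕ Fin (n + m))
  loop : Fin n → List (OrSegment deg)

/-- Formal linear combinations of (data of) looped diagrams. -/
abbrev Chains (p m n : ℕ) : Type := LoopedDiagram p m n →₀ ℤ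

namespace LoopedDiagram

variable {p m n : ℕ}

/-- The list `γ` is a loop from the arc component of the end `a` to itself. -/
def IsLoop (Γ : LoopedDiagram p m n) (a : HalfEdge Γ.deg ⊕ Fin (n + m))
    (γ : List (OrSegment Γ.deg)) : Prop :=
  (∀ s ∈ γ.head?, Γ.arcs.rel a (Sum.inl s.source)) ∧
  (∀ s ∈ γ.getLast?, Γ.arcs.rel (Sum.inl s.target) a) ∧
  γ.IsChain fun s t => Γ.arcs.rel (Sum.inl s.target) (Sum.inl t.source) ∧ s ≠ t.neg

/-- The `i`-th loop is a loop from the `i`-th leaf to itself. -/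
def IsLooped (Γ : LoopedDiagram p m n) : Prop :=
  ∀ i : Fin n, Γ.IsLoop (Sum.inr (Fin.castAdd m i)) (Γ.loop i)

/-- The end `x` is an unlabeled leaf when it is a half-edge at a white vertex: its arc component
has genus zero and no other end. -/
def IsUnit (Γ : LoopedDiagram p m n) (x : HalfEdge Γ.deg ⊕ Fin (n + m)) : Prop :=
  (∀ y, Γ.arcs.rel x y → y = x) ∧ Γ.arcs.genus x = 0

/-- Unlabeled leaves at white vertices occur only as start half-edges. -/
def Nondegenerate (Γ : LoopedDiagram p m n) : Prop :=
  ∀ h : HalfEdge Γ.deg, h.2 ≠ 0 → ¬ Γ.IsUnit (Sum.inl h)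

open Classical in
/-- The class of a diagram in the reduced complex: degenerate diagrams are zero. -/
noncomputable def gen (Γ : LoopedDiagram p m n) : Chains p m n :=
  if Γ.Nondegenerate then Finsupp.single Γ 1 else 0

/-! ### The differential -/

/-- Degrees after a blow up at `v`. -/
def blowDeg (deg : Fin p → ℕ) (v : Fin p) : Fin p → ℕ := fun u => if u = v then deg u - 1 else deg u

/-- The half-edges after blowing up the half-edges `i` and `i + 1` at `v`, viewed as half-edges
before the blow up. -/
def blowHalfEdge (deg : Fin p → ℕ) (v : Fin p) (i : Fin (deg v + 1)) (hv : deg v ≠ 0)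
    (h : HalfEdge (blowDeg deg v)) : HalfEdge deg :=
  ⟨h.1, if h.1 = v ∧ i.val < h.2.val then h.2.val + 1 else h.2.val, by
    obtain ⟨u, t, ht⟩ := h
    unfold blowDeg at ht
    by_cases hu : u = v
    · subst hu
      simp only [if_true] at ht
      simp only [true_and]
      split_ifs <;> omega
    · simp only [hu, if_false, false_and] at ht ⊢
      exact ht⟩

/-- Forget the segment `⟨v, i⟩` and relabel the other ones. -/
def blowSegment (deg : Fin p → ℕ) (v : Fin p) (i : Fin (deg v + 1)) (s : OrSegment deg) :
    Option (OrSegment (blowDeg deg v)) :=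
  if h : s.1.1 = v ∧ s.1.2.val = i.val then none
  else some (⟨s.1.1, if s.1.1 = v ∧ i.val < s.1.2.val then s.1.2.val - 1 else s.1.2.val, by
    obtain ⟨⟨u, t, ht⟩, ε⟩ := s
    obtain ⟨i, hi⟩ := i
    unfold blowDeg
    by_cases hu : u = v
    · subst hu
      simp only [true_and, if_true] at h ⊢
      split_ifs <;> omega
    · simp only [hu, if_false, false_and]
      exact ht⟩, s.2)

/-- The blow up of the neighboring half-edges `i` and `i + 1` at the white vertex `v`. -/
noncomputable def blowUp (Γ : LoopedDiagram p m n) (v : Fin p) (i : Fin (Γ.deg v + 1))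
    (hv : Γ.deg v ≠ 0) : LoopedDiagram p m n where
  deg := blowDeg Γ.deg v
  arcs := (Γ.arcs.join (Sum.inl ⟨v, i⟩) (Sum.inl ⟨v, i + 1⟩)).comap
    (Sum.map (blowHalfEdge Γ.deg v i hv) id)
  loop l := (Γ.loop l).filterMap (blowSegment Γ.deg v i)

/-- The differential of a diagram: at each white vertex `v` the sum of all blow ups with
alternating signs starting with `(-1) ^ (1 + ∑ u < v, deg u)`. -/
noncomputable def boundary (Γ : LoopedDiagram p m n) : Chains p m n :=
  ∑ v : Fin p, ∑ i : Fin (Γ.deg v + 1),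
    if hv : Γ.deg v = 0 then 0
    else ((-1 : ℤ) ^ (1 + ∑ u ∈ Finset.Iio v, Γ.deg u + i.val)) • (Γ.blowUp v i hv).gen

/-! ### The composition -/

section Composition

variable {n₁ m₁ n₂ m₂ n₃ m₃ : ℕ}
  (y : LoopedDiagram n₃ (m₂ + m₃) n₂) (x : LoopedDiagram n₂ (m₁ + m₂) n₁)

/-- For each free half-edge of the `i`-th white vertex of `x`, the place in the `i`-th loop of `y`
at which it is attached. -/
abbrev Passage : Type := ∀ i : Fin n₂, Fin (x.deg i) → Fin (y.loop i).length

variable {y x}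

/-- The oriented segment of `y` along which the half-edge `e` is attached. -/
def Passage.seg (w : Passage y x) (e : FreeHalfEdge x.deg) : OrSegment y.deg :=
  (y.loop e.1).get (w e.1 e.2)

/-- The degrees of the white vertices after gluing. -/
def Passage.deg (w : Passage y x) (u : Fin n₃) : ℕ :=
  y.deg u + (Finset.univ.filter fun e : FreeHalfEdge x.deg => (w.seg e).1.1 = u).card

/-- Positions of all free half-edges of `x` and `y` at the white vertices after gluing. The
position `k : Fin (w.deg u)` is the half-edge `k + 1` at `u`. -/
abbrev Position (w : Passage y x) : Type :=
  FreeHalfEdge x.deg ⊕ FreeHalfEdge y.deg ≃ FreeHalfEdge w.deg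

variable {w : Passage y x}

/-- The number of free half-edges of `y` at the vertex `u` among the first `r` positions. This is
the segment of `y` at `u` in which the position `r` (and the new segment `r`) lies. -/
def Position.segOf (π : Position w) (u : Fin n₃) (r : ℕ) : ℕ :=
  (Finset.univ.filter fun t : Fin (y.deg u) => (π (Sum.inr ⟨u, t⟩)).2.val < r).card

/-- `w` and `π` are a way of attaching the free half-edges of `x` along the loops of `y`
following their cyclic order. -/
def IsGluing (w : Passage y x) (π : Position w) : Prop :=
  (∀ i, Monotone (w i)) ∧
  (∀ u (t : Fin (y.deg u)), (π (Sum.inr ⟨u, t⟩)).1 = u) ∧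
  (∀ u (t t' : Fin (y.deg u)), t < t' →
    (π (Sum.inr ⟨u, t⟩)).2.val < (π (Sum.inr ⟨u, t'⟩)).2.val) ∧
  (∀ e : FreeHalfEdge x.deg, (π (Sum.inl e)).1 = (w.seg e).1.1 ∧
    π.segOf (w.seg e).1.1 (π (Sum.inl e)).2.val = (w.seg e).1.2.val) ∧
  (∀ i (a b : Fin (x.deg i)), a < b → w i a = w i b →
    if (w.seg ⟨i, a⟩).2 then (π (Sum.inl ⟨i, a⟩)).2.val < (π (Sum.inl ⟨i, b⟩)).2.val
    else (π (Sum.inl ⟨i, b⟩)).2.val < (π (Sum.inl ⟨i, a⟩)).2.val)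

/-- The order on free half-edges by vertices, and at each vertex by the cyclic order beginning at
the start half-edge. -/
abbrev freeLt {p : ℕ} (deg : Fin p → ℕ) : FreeHalfEdge deg → FreeHalfEdge deg → Prop :=
  Sigma.Lex (· < ·) fun _ => (· < ·)

open Classical in
/-- The sign of a gluing: the free half-edges of `x` are put in their order before all free
half-edges of `y` and then moved to their final positions. -/
noncomputable def Position.sign (π : Position w) : ℤ :=
  (-1) ^ (Finset.univ.filter fun q : (FreeHalfEdge x.deg ⊕ FreeHalfEdge y.deg) ×
      (FreeHalfEdge x.deg ⊕ FreeHalfEdge y.deg) =>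
    Sum.Lex (freeLt x.deg) (freeLt y.deg) q.1 q.2 ∧ freeLt w.deg (π q.2) (π q.1)).card

/-- The half-edges at white vertices after gluing as half-edges of `x` or `y`. -/
def Position.halfEdge (π : Position w) (h : HalfEdge w.deg) :
    HalfEdge x.deg ⊕ HalfEdge y.deg :=
  Fin.cases (motive := fun _ => HalfEdge x.deg ⊕ HalfEdge y.deg) (Sum.inr ⟨h.1, 0⟩)
    (fun k => Sum.map (fun e => ⟨e.1, e.2.succ⟩) (fun e => ⟨e.1, e.2.succ⟩) (π.symm ⟨h.1, k⟩)) h.2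

/-- The ends after gluing as ends of `x` or `y`. The first `n₁ + m₁` leaves come from `x` and the
last `m₃` leaves come from `y`. -/
def Position.endOf (π : Position w) : HalfEdge w.deg ⊕ Fin (n₁ + (m₁ + m₃)) →
    (HalfEdge x.deg ⊕ Fin (n₁ + (m₁ + m₂))) ⊕ (HalfEdge y.deg ⊕ Fin (n₂ + (m₂ + m₃))) :=
  Sum.elim (fun h => Sum.map Sum.inl Sum.inl (π.halfEdge h))
    (Fin.addCases (fun j => Sum.inl (Sum.inr (Fin.castAdd _ j)))
      (Fin.addCases (fun j => Sum.inl (Sum.inr (Fin.natAdd _ (Fin.castAdd _ j))))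
        (fun j => Sum.inr (Sum.inr (Fin.natAdd _ (Fin.natAdd _ j))))))

/-- The pairs of ends which are glued together: the start half-edge of the `i`-th white vertex of
`x` with the `i`-th leaf of `y`, and the last `m₂` leaves of `x` with the leaves
`n₂ + 1, …, n₂ + m₂` of `y`. -/
def gluedPairs (y : LoopedDiagram n₃ (m₂ + m₃) n₂) (x : LoopedDiagram n₂ (m₁ + m₂) n₁) :
    List (((HalfEdge x.deg ⊕ Fin (n₁ + (m₁ + m₂))) ⊕ (HalfEdge y.deg ⊕ Fin (n₂ + (m₂ + m₃)))) ×
      ((HalfEdge x.deg ⊕ Fin (n₁ + (m₁ + m₂))) ⊕ (HalfEdge y.deg ⊕ Fin (n₂ + (m₂ + m₃))))) :=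
  (List.finRange n₂).map (fun i =>
    (Sum.inl (Sum.inl ⟨i, 0⟩), Sum.inr (Sum.inr (Fin.castAdd _ i)))) ++
  (List.finRange m₂).map (fun a =>
    (Sum.inl (Sum.inr (Fin.natAdd _ (Fin.natAdd _ a))),
      Sum.inr (Sum.inr (Fin.natAdd _ (Fin.castAdd _ a)))))

/-- When the new segment `r` is traversed at the place `q` of the `i`-th loop of `y`, the number of
free half-edges of the `i`-th white vertex of `x` which have been passed before. -/
def Position.passed (π : Position w) (i : Fin n₂) (q : Fin (y.loop i).length) (r : ℕ) : ℕ :=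
  (Finset.univ.filter fun b : Fin (x.deg i) => w i b < q ∨ (w i b = q ∧
    if ((y.loop i).get q).2 then (π (Sum.inl ⟨i, b⟩)).2.val < r
    else r ≤ (π (Sum.inl ⟨i, b⟩)).2.val)).card

/-- The part of the `i`-th loop of `y`, after gluing, which corresponds to the segment `a` of the
`i`-th white vertex of `x`, that is, the part between the half-edges `a` and `a + 1`. -/
def Position.path (π : Position w) (i : Fin n₂) (a : ℕ) : List (OrSegment w.deg) :=
  (List.finRange (y.loop i).length).flatMap fun q =>
    let s := (y.loop i).get q
    let l := (List.finRange (w.deg s.1.1 + 1)).filter fun r =>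
      π.segOf s.1.1 r.val = s.1.2.val ∧ π.passed i q r.val = a
    if s.2 then l.map fun r => (⟨s.1.1, r⟩, true) else l.reverse.map fun r => (⟨s.1.1, r⟩, false)

/-- The path in the glued diagram corresponding to an oriented segment of `x`. -/
def Position.image (π : Position w) (s : OrSegment x.deg) : List (OrSegment w.deg) :=
  if s.2 then π.path s.1.1 s.1.2.val else ((π.path s.1.1 s.1.2.val).map OrSegment.neg).reverse

/-- The diagram obtained by a gluing. -/
noncomputable def Position.glue (π : Position w) : LoopedDiagram n₃ (m₁ + m₃) n₁ where
  deg := w.deg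
  arcs := ((x.arcs.sum y.arcs).joinList (gluedPairs y x)).comap π.endOf
  loop j := (x.loop j).flatMap π.image

open Classical in
/-- The composition `y ∘ x` of two diagrams: the signed sum over all gluings. -/
noncomputable def compose (y : LoopedDiagram n₃ (m₂ + m₃) n₂)
    (x : LoopedDiagram n₂ (m₁ + m₂) n₁) : Chains n₃ (m₁ + m₃) n₁ :=
  ∑ w : Passage y x, ∑ π : Position w, if IsGluing w π then π.sign • π.glue.gen else 0

end Composition

/-- Make the loops with index in `T` constant. -/
def makeConst (Γ : LoopedDiagram p m n) (T : Finset (Fin n)) : LoopedDiagram p m n where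
  deg := Γ.deg
  arcs := Γ.arcs
  loop j := if j ∈ T then [] else Γ.loop j

/-- The element `(Γ, ⟨γ₁⟩, …, ⟨γₙ⟩)` of the complex of non-constant diagrams. -/
noncomputable def nonconst (Γ : LoopedDiagram p m n) : Chains p m n :=
  ∑ T : Finset (Fin n), ((-1 : ℤ) ^ T.card) • (Γ.makeConst T).gen

/-- Every connected component contains a white vertex or one of the last `m₂` leaves. -/
def IsPositive {n₁ m₁ n₂ m₂ : ℕ} (Γ : LoopedDiagram n₂ (m₁ + m₂) n₁) : Prop :=
  Γ.arcs.closed = 0 ∧ ∀ x, (∃ h, Γ.arcs.rel x (Sum.inl h)) ∨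
    ∃ j : Fin m₂, Γ.arcs.rel x (Sum.inr (Fin.natAdd n₁ (Fin.natAdd m₁ j)))

/-- The diagram without white vertices and loops in which the `i`-th of `a` inputs is connected to
the `f i`-th of `b` outputs. -/
def ofFun {a b : ℕ} (f : Fin a → Fin b) : LoopedDiagram 0 (a + b) 0 where
  deg := fun _ => 0
  arcs := ArcSystem.ofLabel
    (Sum.elim (fun h => h.1.elim0) (Fin.addCases (fun i => i.elim0) (Fin.addCases f id)))
  loop := fun i => i.elim0

/-- The graph `l_{k+1}`: one white vertex with `k + 1` labeled leaves, labeled in their order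
beginning with the start half-edge. -/
def corolla (k : ℕ) : LoopedDiagram 1 ((k + 1) + 0) 0 where
  deg := fun _ => k
  arcs := ArcSystem.ofLabel (L := Fin (k + 1))
    (Sum.elim (fun h => h.2)
      (Fin.addCases (fun i => i.elim0) (Fin.addCases id (fun i => i.elim0))))
  loop := fun i => i.elim0

/-- Remove the white vertex; its half-edges become outputs. -/
noncomputable def cut {k : ℕ} (Γ : LoopedDiagram 1 (k + 0) 0) :
    LoopedDiagram 0 (k + (Γ.deg 0 + 1)) 0 where
  deg := fun _ => 0
  arcs := Γ.arcs.comap (Sum.elim (fun h => h.1.elim0)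
    (Fin.addCases (fun i => i.elim0)
      (Fin.addCases (fun i => Sum.inr (Fin.natAdd 0 (Fin.castAdd 0 i)))
        (fun t => Sum.inl ⟨0, t⟩))))
  loop := fun i => i.elim0

end LoopedDiagram

/-! ## The complexes of looped diagrams -/

/-- The abelian group underlying the complex of looped diagrams
`lD((n₁, m₁), (n₂, m₂))`. -/
noncomputable def lD (n₁ m₁ n₂ m₂ : ℕ) : Submodule ℤ (Chains n₂ (m₁ + m₂) n₁) :=
  Submodule.span ℤ {c | ∃ Γ : LoopedDiagram n₂ (m₁ + m₂) n₁,
    Γ.IsLooped ∧ Γ.Nondegenerate ∧ c = Finsupp.single Γ 1}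

/-- Looped diagrams with positive boundary condition. -/
noncomputable def lDPlus (n₁ m₁ n₂ m₂ : ℕ) : Submodule ℤ (Chains n₂ (m₁ + m₂) n₁) :=
  Submodule.span ℤ {c | ∃ Γ : LoopedDiagram n₂ (m₁ + m₂) n₁,
    Γ.IsLooped ∧ Γ.Nondegenerate ∧ Γ.IsPositive ∧ c = Finsupp.single Γ 1}

/-- The differential. -/
noncomputable def lD.d {p m n : ℕ} : Chains p m n →ₗ[ℤ] Chains p m n :=
  Finsupp.linearCombination ℤ LoopedDiagram.boundary

/-- The composition `y ∘ x`. -/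
noncomputable def lD.comp {n₁ m₁ n₂ m₂ n₃ m₃ : ℕ}
    (y : Chains n₃ (m₂ + m₃) n₂) (x : Chains n₂ (m₁ + m₂) n₁) : Chains n₃ (m₁ + m₃) n₁ :=
  y.sum fun Γ' b => x.sum fun Γ a => (b * a) • Γ'.compose Γ

theorem LoopedDiagram.single_ofFun_mem {a b : ℕ} (f : Fin a → Fin b) :
    Finsupp.single (LoopedDiagram.ofFun f) 1 ∈ lDPlus 0 a 0 b := by
  refine Submodule.subset_span ⟨_, fun i => i.elim0, fun h => h.1.elim0, ⟨rfl, ?_⟩, rfl⟩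
  rintro (h | x)
  · exact h.1.elim0
  · refine Or.inr ⟨Fin.addCases (motive := fun _ => Fin b) (fun i => i.elim0)
      (Fin.addCases f id) x, ?_⟩
    change Fin.addCases (motive := fun _ => Fin b) _ _ x =
      Fin.addCases (motive := fun _ => Fin b) _ _ (Fin.natAdd 0 (Fin.natAdd a _))
    rw [Fin.addCases_right, Fin.addCases_right]
    rfl

/-! ## The product, the coproduct and the bounding element -/

/-- One white vertex with two half-edges, which together with the leaves 1 and 2 form one arc
component of genus zero; the loops are the first and the second segment. -/
def muDiagram : LoopedDiagram 1 (0 + 0) 2 where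
  deg := fun _ => 1
  arcs := ArcSystem.single _ 0
  loop := ![[(⟨0, (0 : Fin 2)⟩, true)], [(⟨0, (1 : Fin 2)⟩, true)]]

/-- The product `μ`. -/
noncomputable def muProd : Chains 1 (0 + 0) 2 := muDiagram.nonconst

/-- Two white vertices with one half-edge each, which together with the leaf 1 form one arc
component of genus zero; the loop goes around the first and then around the second vertex. -/
def deltaDiagram : LoopedDiagram 2 (0 + 0) 1 where
  deg := fun _ => 0
  arcs := ArcSystem.single _ 0
  loop := ![[(⟨0, (0 : Fin 1)⟩, true), (⟨1, (0 : Fin 1)⟩, true)]]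

/-- The coproduct `Δ`. -/
noncomputable def deltaCoprod : Chains 2 (0 + 0) 1 := deltaDiagram.gen

/-- One white vertex with three half-edges, which together with the leaf form one arc component of
genus zero; the loop goes once around the vertex. -/
def threeDiagram : LoopedDiagram 1 (0 + 0) 1 where
  deg := fun _ => 2
  arcs := ArcSystem.single _ 0
  loop := ![[(⟨0, (0 : Fin 3)⟩, true), (⟨0, (1 : Fin 3)⟩, true), (⟨0, (2 : Fin 3)⟩, true)]]

open Classical in
/-- One white vertex with three half-edges: the start half-edge is an unlabeled leaf, the two
other half-edges and the labeled leaf form one arc component of genus one; the loop is the second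
segment. -/
noncomputable def unitDiagram : LoopedDiagram 1 (0 + 0) 1 where
  deg := fun _ => 2
  arcs :=
    { rel := Setoid.ker fun x => x = Sum.inl ⟨0, (0 : Fin 3)⟩
      genus := fun x => if x = Sum.inl ⟨0, (0 : Fin 3)⟩ then 0 else 1
      genus_congr := fun x y h => by
        rw [Setoid.ker_def] at h
        simp only [h]
      closed := 0 }
  loop := ![[(⟨0, (1 : Fin 3)⟩, true)]]

/-- The element `D` whose boundary is `μ ∘ Δ`. -/
noncomputable def boundingElement : Chains 1 (0 + 0) 1 :=
  unitDiagram.nonconst - threeDiagram.nonconst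

/-! ## Hochschild homology -/

universe u v

/-- A dg-functor from the PROP `cFr₊` with morphisms `cFr₊(a, b) = lD₊((0, a), (0, b))` to chain
complexes over `R`. A commutative cocommutative open Frobenius dg-algebra `A` is a strict symmetric
monoidal functor of this kind, with `a ↦ A^{⊗ a}`. The complexes `cFr₊(a, b)` are concentrated in
degree zero, so the structure maps are additive maps to the group of chain maps. -/
structure CFrPlusFunctor (R : Type u) [CommRing R] where
  obj : ℕ → ChainComplex (ModuleCat.{v} R) ℤ
  map : ∀ {a b : ℕ}, lDPlus 0 a 0 b →+ (obj a ⟶ obj b)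
  map_id : ∀ a, map ⟨_, LoopedDiagram.single_ofFun_mem (id : Fin a → Fin a)⟩ = 𝟙 (obj a)
  map_comp : ∀ {a b c : ℕ} (y : lDPlus 0 b 0 c) (x : lDPlus 0 a 0 b) (z : lDPlus 0 a 0 c),
    (z : Chains 0 (a + c) 0) = lD.comp (y : Chains 0 (b + c) 0) (x : Chains 0 (a + b) 0) →
    map z = map x ≫ map y

namespace CFrPlusFunctor

variable {R : Type u} [CommRing R] (Φ : CFrPlusFunctor.{u, v} R)

/-- The Hochschild chains `⨁ₖ Φ(k + 1)[k]` of `Φ` (direct sum over all degrees): the summand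
`(k, q)` is the degree `q` part of `Φ(k + 1)` and has total degree `k + q`. -/
abbrev HochschildChains : Type v :=
  DirectSum (ℕ × ℤ) fun kq => ((Φ.obj (kq.1 + 1)).X kq.2 : Type v)

/-- The inclusion of a summand. -/
noncomputable abbrev incl (k : ℕ) (q : ℤ) :
    ((Φ.obj (k + 1)).X q : Type v) →ₗ[R] Φ.HochschildChains :=
  DirectSum.lof R (ℕ × ℤ) (fun kq => ((Φ.obj (kq.1 + 1)).X kq.2 : Type v)) (k, q)

/-- Multiply the inputs `i` and `i + 1` (counted from 0), for `i = k + 1` the last input with the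
first one. -/
def faceFun (k : ℕ) (i : Fin (k + 2)) (x : Fin (k + 2)) : Fin (k + 1) :=
  ⟨if i.val = k + 1 then (if x.val = k + 1 then 0 else x.val)
    else if x.val ≤ i.val then x.val else x.val - 1, by
    have := x.isLt; have := i.isLt; split_ifs <;> omega⟩

/-- The face `dᵢ`. -/
noncomputable def face (k : ℕ) (i : Fin (k + 2)) : Φ.obj (k + 2) ⟶ Φ.obj (k + 1) :=
  Φ.map ⟨_, LoopedDiagram.single_ofFun_mem (faceFun k i)⟩

/-- The degeneracy `sᵢ`, inserting a unit as the input `i + 1` (counted from 0). -/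
noncomputable def degen (k : ℕ) (i : Fin (k + 1)) : Φ.obj (k + 1) ⟶ Φ.obj (k + 2) :=
  Φ.map ⟨_, LoopedDiagram.single_ofFun_mem (Fin.succAbove i.succ)⟩

/-- The Hochschild part of the differential on the summand `(k, q)`. -/
noncomputable def simplicialD : ∀ (k : ℕ) (q : ℤ),
    ((Φ.obj (k + 1)).X q : Type v) →ₗ[R] Φ.HochschildChains
  | 0, _ => 0
  | k + 1, q => (q.negOnePow : ℤ) • ∑ i : Fin (k + 2),
      ((-1 : ℤ) ^ i.val) • (Φ.incl k q ∘ₗ ((Φ.face k i).f q).hom)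

/-- The differential of the Hochschild complex, the sum of the differential of `Φ` and the
Hochschild differential (with the sign convention in which the shift is a right factor). -/
noncomputable def hochschildD : Φ.HochschildChains →ₗ[R] Φ.HochschildChains :=
  DirectSum.toModule R (ℕ × ℤ) _ fun kq =>
    Φ.incl kq.1 (kq.2 - 1) ∘ₗ ((Φ.obj (kq.1 + 1)).d kq.2 (kq.2 - 1)).hom +
      Φ.simplicialD kq.1 kq.2

/-- The span of the images of the degeneracies. The reduced Hochschild complex is the quotient of
the Hochschild complex by it. -/
noncomputable def degenerate : Submodule R Φ.HochschildChains :=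
  ⨆ (k : ℕ) (q : ℤ) (i : Fin (k + 1)),
    LinearMap.range (Φ.incl (k + 1) q ∘ₗ ((Φ.degen k i).f q).hom)

/-- Hochschild chains representing cycles of the reduced Hochschild complex. -/
noncomputable def cycles : Submodule R Φ.HochschildChains := Φ.degenerate.comap Φ.hochschildD

/-- Hochschild chains representing boundaries of the reduced Hochschild complex. -/
noncomputable def boundaries : Submodule R Φ.HochschildChains :=
  LinearMap.range Φ.hochschildD ⊔ Φ.degenerate

/-- The Hochschild homology of `Φ` (the direct sum over all degrees), computed by the reduced
Hochschild complex. -/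
abbrev HochschildHomology : Type v := Φ.cycles ⧸ Φ.boundaries.submoduleOf Φ.cycles

/-- The endomorphism `f` of Hochschild chains maps cycles to cycles and acts on Hochschild
homology by `T`. -/
def ActsOnHomologyBy (f : Φ.HochschildChains →ₗ[R] Φ.HochschildChains)
    (T : Φ.HochschildHomology →ₗ[R] Φ.HochschildHomology) : Prop :=
  ∀ z : Φ.cycles, ∃ h : f z ∈ Φ.cycles,
    T (Submodule.Quotient.mk z) = Submodule.Quotient.mk ⟨f z, h⟩

open Classical in
/-- The operation `Φ(k + 1) → Φ(r + 1)` given by a diagram in `lD₊((0, k + 1), (1, 0))` whose white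
vertex has degree `r`. -/
noncomputable def diagramOp (k : ℕ) (q : ℤ) (Γ : LoopedDiagram 1 ((k + 1) + 0) 0) :
    ((Φ.obj (k + 1)).X q : Type v) →ₗ[R] Φ.HochschildChains :=
  if h : Finsupp.single Γ.cut 1 ∈ lDPlus 0 (k + 1) 0 (Γ.deg 0 + 1) then
    Φ.incl (Γ.deg 0) q ∘ₗ ((Φ.map ⟨_, h⟩).f q).hom
  else 0

/-- The operation on Hochschild chains given by `G ∈ lD₊((1, 0), (1, 0))`: on `Φ(k + 1)` it is
given by the diagrams in `G ∘ l_{k+1}`. -/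
noncomputable def operation (G : Chains 1 (0 + 0) 1) :
    Φ.HochschildChains →ₗ[R] Φ.HochschildChains :=
  DirectSum.toModule R (ℕ × ℤ) _ fun kq =>
    (lD.comp (m₁ := kq.1 + 1) (m₂ := 0) (m₃ := 0) G (LoopedDiagram.corolla kq.1).gen).sum
      fun Γ c => c • Φ.diagramOp kq.1 kq.2 Γ

end CFrPlusFunctor

/-! The identity `μ ∘ Δ = d(D)` is a count of a few diagrams. All that survive are `genusOne L`: one
white vertex with two half-edges, one arc component of genus one, and a loop L in the segments `seg
0`, `seg 1`. The vertices of `Δ` have no free half-edges, so each of the four terms of `μ` composes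
with `Δ` in exactly one way. Two edges between two components of genus zero give genus one, and the
loops of `μ` are concatenated. The result is the alternating sum over L = [seg 0, seg 1], [seg 0],
[seg 1], []. For `D`, the three blow-ups of `threeDiagram` agree and have signs -, +, -. In
`unitDiagram` the two blow-ups at the unit start half-edge leave `seg 0` and `seg 1`, while the
middle one erases the loop and so cancels against its constant version (`d_boundingElement`,
`comp_muProd_deltaCoprod`).

The statement on homology is proved by an explicit chain homotopy, whose formula is read off from
the gluings of `D` with a corolla; no general action of looped diagrams on Hochschild chains is
developed. Gluing `genusOne L` to a corolla amounts to choosing the place i where the second copy of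
a₀ is inserted among a₁, …, aₖ. L restricts i: any i for [seg 0, seg 1], i = k for [seg 0], i = 0
for [seg 1], and k = 0 for the empty loop (`operationHom_genusOne`). Hence `μ ∘ Δ` acts by
`muDeltaMap`, a signed sum of the `twoMap k i` with corrections at i = 0 and i = k.

The homotopy combines two operations. `threeSum` inserts two further copies of a₀ in all possible
ways. In its boundary, faces multiplying a copy with a neighbouring aᵢ cancel in pairs by
commutativity, and faces multiplying two copies raise the genus; two of the three families of the
latter cancel and the third leaves all `twoMap k i` with signs (`threeSum_hochMap`). `unitMap` puts
a unit in front and a copy at the end; its outer faces supply the corrections at i = 0 and i = k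
(`unitMap_hochMap`). Together they give `homotopyMap_hochMap`, and since the homotopy preserves
degenerate chains it descends to the reduced complex.

Relations between diagrams without white vertices reduce to one principle, `compose_eq_cospan`:
composition is a pushout of cospans of labels, with the genus determined by the Euler
characteristic. It yields the Frobenius relation, cocommutativity, and the rise in genus when two
copies are multiplied. -/

/-! ## Arc systems given by labels -/

namespace ArcSystem

variable {X Y C C' E : Type}

/-- The arc components are the fibres of `f`; the genus of the fibre over `c` is `γ c`. -/
def ofLabelGenus (f : X → C) (γ : C → ℕ) : ArcSystem X where
  rel := Setoid.ker f
  genus x := γ (f x)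
  genus_congr _ _ h := congrArg γ h
  closed := 0

theorem ofLabelGenus_rel (f : X → C) (γ : C → ℕ) (x y : X) :
    (ofLabelGenus f γ).rel x y ↔ f x = f y := Iff.rfl

theorem single_eq (X : Type) (g : ℕ) : single X g = ofLabelGenus (fun _ => ()) (fun _ => g) := by
  refine ArcSystem.ext ?_ rfl rfl
  exact Setoid.ext fun a b => ⟨fun _ => rfl, fun _ => trivial⟩

theorem ofLabelGenus_congr (f : X → C) (γ : C → ℕ) (f' : X → C') (γ' : C' → ℕ)
    (h : ∀ x y, f x = f y ↔ f' x = f' y) (hγ : ∀ x, γ (f x) = γ' (f' x)) :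
    ofLabelGenus f γ = ofLabelGenus f' γ' := by
  refine ArcSystem.ext (Setoid.ext h) (funext hγ) rfl

/-- The new edge renames the label of `b` to that of `a`. If the labels differ, `f b` keeps its old
value in the genus function, which is harmless because no end carries that label any more. -/
theorem join_ofLabelGenus [DecidableEq C] (f : X → C) (γ : C → ℕ) (a b : X) :
    (ofLabelGenus f γ).join a b =
      ofLabelGenus (fun x => if f x = f b then f a else f x)
        (Function.update γ (f a) (if f a = f b then γ (f a) + 1 else γ (f a) + γ (f b))) := by
  refine ArcSystem.ext (Setoid.ext fun x y => ?_) (funext fun x => ?_) rfl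
  · have e : ∀ u v, Quotient.mk (ofLabelGenus f γ).rel u = Quotient.mk (ofLabelGenus f γ).rel v ↔
      f u = f v := fun u v => Quotient.eq
    rw [ofLabelGenus_rel]
    unfold join
    rw [Setoid.ker_def]
    simp only [ofLabelGenus_rel]
    grind
  · simp only [join, ofLabelGenus_rel]
    simp only [ofLabelGenus, Function.update_apply]
    grind

theorem sum_ofLabelGenus (f : X → C) (γ : C → ℕ) (f' : Y → C') (γ' : C' → ℕ) :
    (ofLabelGenus f γ).sum (ofLabelGenus f' γ') =
      ofLabelGenus (Sum.map f f') (Sum.elim γ γ') := by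
  refine ArcSystem.ext (Setoid.ext fun x y => ?_) (funext fun x => ?_) rfl
  · rw [ofLabelGenus_rel, sum, Setoid.ker_def]
    rcases x with x | x <;> rcases y with y | y <;> simp [Quotient.eq, ofLabelGenus_rel]
  · rcases x with x | x <;> rfl

/-- Every component keeps an end by `hh`, so none turns into a closed component. -/
theorem comap_ofLabelGenus [Fintype X] (f : X → C) (γ : C → ℕ) (h : Y → X)
    (hh : ∀ x, ∃ y, f (h y) = f x) :
    (ofLabelGenus f γ).comap h = ofLabelGenus (f ∘ h) γ := by
  refine ArcSystem.ext rfl rfl ?_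
  classical
  have : ((Finset.univ : Finset (Quotient (ofLabelGenus f γ).rel)).filter
    (fun c => ∀ y, Quotient.mk (ofLabelGenus f γ).rel (h y) ≠ c)) = ∅ := by
    refine Finset.filter_eq_empty_iff.2 fun c _ => ?_
    induction c using Quotient.inductionOn with
    | h x =>
      obtain ⟨y, hy⟩ := hh x
      exact not_forall.2 ⟨y, not_not.2 (Quotient.sound hy)⟩
  change 0 + Multiset.map _ _ = 0
  rw [zero_add]
  refine (congrArg (fun s : Finset _ => s.val.map (ofLabelGenus f γ).genusOf) ?_).trans
    (show Multiset.map (ofLabelGenus f γ).genusOf (∅ : Finset _).val = 0 from rfl)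
  convert this

/-- Joining along a list of edges which respects a map `φ` on the set of labels: there is a
representative of the result for which the Euler characteristic over each value of `φ` drops by
the number of edges. -/
theorem exists_joinList_eq [DecidableEq C] [DecidableEq E] (φ : C → E) (l : List (X × X)) :
    ∀ (f : X → C) (γ : C → ℕ) (S : Finset C), (∀ x, f x ∈ S) → (∀ c ∈ S, ∃ x, f x = c) →
    (∀ e ∈ l, φ (f e.1) = φ (f e.2)) →
    ∃ (f' : X → C) (γ' : C → ℕ) (S' : Finset C),
      (ofLabelGenus f γ).joinList l = ofLabelGenus f' γ' ∧
      (∀ x, f' x ∈ S') ∧ (∀ c ∈ S', ∃ x, f' x = c) ∧ (∀ x, φ (f' x) = φ (f x)) ∧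
      (∀ x y, f x = f y → f' x = f' y) ∧ (∀ e ∈ l, f' e.1 = f' e.2) ∧
      ∀ e, ∑ c ∈ S' with φ c = e, ((γ' c : ℤ) - 1) = ∑ c ∈ S with φ c = e, ((γ c : ℤ) - 1) +
        (l.map fun p => if φ (f p.1) = e then 1 else 0).sum := by
  induction l with
  | nil =>
    intro f γ S h1 h2 _
    exact ⟨f, γ, S, rfl, h1, h2, fun _ => rfl, fun _ _ h => h, by simp, by simp⟩
  | cons p l ih =>
    intro f γ S h1 h2 h3
    obtain ⟨a, b⟩ := p
    have hab : φ (f a) = φ (f b) := h3 (a, b) (by simp)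
    set f₁ : X → C := fun x => if f x = f b then f a else f x with hf₁
    set γ₁ := Function.update γ (f a) (if f a = f b then γ (f a) + 1 else γ (f a) + γ (f b)) with hγ₁
    -- Only labels in use may enter the Euler characteristic, so the label of `b` is dropped once it
    -- has been absorbed.
    set S₁ := if f a = f b then S else S.erase (f b) with hS₁
    have hφ : ∀ x, φ (f₁ x) = φ (f x) := by
      intro x; simp only [hf₁]; split_ifs with h
      · rw [h, hab]
      · rfl
    obtain ⟨f', γ', S', e1, e2, e3, e4, e5, e6, e7⟩ := ih f₁ γ₁ S₁
      (by intro x; simp only [hf₁, hS₁]; have := h1 x; have := h1 a; split_ifs <;> grind)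
      (by
        intro c hc
        by_cases h : f a = f b
        · obtain ⟨x, rfl⟩ := h2 c (by simpa [hS₁, h] using hc)
          exact ⟨x, by simp only [hf₁]; grind⟩
        · simp only [hS₁, h, if_false, Finset.mem_erase] at hc
          obtain ⟨x, rfl⟩ := h2 c hc.2
          exact ⟨x, by simp only [hf₁]; grind⟩)
      (by intro e he; rw [hφ, hφ]; exact h3 e (by simp [he]))
    refine ⟨f', γ', S', ?_, e2, e3, fun x => (e4 x).trans (hφ x), fun x y h => e5 x y ?_, ?_, ?_⟩
    · rw [← e1, hf₁, hγ₁, ← join_ofLabelGenus]; rfl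
    · simp only [hf₁, h]
    · intro e he
      rcases List.mem_cons.1 he with rfl | he
      · exact e5 _ _ (by simp only [hf₁]; grind)
      · exact e6 e he
    · intro e
      rw [e7]
      simp only [hφ, List.map_cons, List.sum_cons, ← add_assoc]
      congr 1
      -- An edge inside a component raises its genus by one. An edge between two components replaces
      -- (γ a - 1) + (γ b - 1) by γ a + γ b - 1. Either way the sum of genus minus one grows by one.
      by_cases h : f a = f b
      · simp only [hS₁, h, if_true, hγ₁]
        by_cases he : φ (f b) = e
        · rw [Finset.sum_eq_sum_sdiff_singleton_add (i := f b) (by simp [h1, he]),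
            Finset.sum_eq_sum_sdiff_singleton_add (i := f b) (s := {c ∈ S | φ c = e})
              (by simp [h1, he])]
          rw [Finset.sum_congr rfl (g := fun c => (γ c : ℤ) - 1)]
          · simp [he]; ring
          · intro c hc; simp at hc; simp [hc]
        · rw [Finset.sum_congr rfl (g := fun c => (γ c : ℤ) - 1)]
          · simp [he]
          · intro c hc
            have : c ≠ f b := by rintro rfl; simp at hc; exact he hc.2
            simp [this]
      · simp only [hS₁, h, if_false, hγ₁]
        by_cases he : φ (f a) = e
        · have e0 : {c ∈ S.erase (f b) | φ c = e} = ({c ∈ S | φ c = e}).erase (f b) := by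
            ext c; simp; tauto
          rw [e0, ← Finset.add_sum_erase {c ∈ S | φ c = e} _
              (a := f b) (by simp [h1, ← he, hab]),
            ← Finset.add_sum_erase (({c ∈ S | φ c = e}).erase (f b)) _
              (a := f a) (by simp [h1, he, h]),
            ← Finset.add_sum_erase (({c ∈ S | φ c = e}).erase (f b)) _
              (a := f a) (by simp [h1, he, h])]
          rw [Finset.sum_congr rfl (g := fun c => (γ c : ℤ) - 1)]
          · simp [he]; ring
          · intro c hc; simp at hc; simp [hc]
        · have e0 : {c ∈ S.erase (f b) | φ c = e} = {c ∈ S | φ c = e} := by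
            ext c; simp; rintro h' _ rfl; exact he (hab.trans h')
          rw [e0, Finset.sum_congr rfl (g := fun c => (γ c : ℤ) - 1)]
          · simp [he]
          · intro c hc
            have : c ≠ f a := by rintro rfl; simp at hc; exact he hc.2
            simp [this]

/-- Joining along a list of edges which generates the fibres of `φ`. -/
theorem joinList_ofLabelGenus [DecidableEq C] [Fintype C] [DecidableEq E] (φ : C → E)
    (l : List (X × X)) (f : X → C) (γ : C → ℕ) (δ : E → ℕ) (hf : Function.Surjective f)
    (hl : ∀ e ∈ l, φ (f e.1) = φ (f e.2))
    (hconn : ∀ r : Setoid C, (∀ e ∈ l, r (f e.1) (f e.2)) → ∀ u v, φ u = φ v → r u v)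
    (hδ : ∀ e, (δ e : ℤ) - 1 = ∑ c with φ c = e, ((γ c : ℤ) - 1) +
        (l.map fun p => if φ (f p.1) = e then 1 else 0).sum) :
    (ofLabelGenus f γ).joinList l = ofLabelGenus (φ ∘ f) δ := by
  obtain ⟨f', γ', S', e1, e2, e3, e4, e5, e6, e7⟩ := exists_joinList_eq φ l f γ Finset.univ
    (by simp) (fun c _ => hf c) hl
  rw [e1]
  choose g hg using hf
  have hfg : ∀ x, f' (g (f x)) = f' x := fun x => e5 _ _ (hg _)
  -- Connectedness is applied to the kernel of `f' ∘ g`, where `g` is a section of `f`: it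
  -- identifies the labels which have been merged.
  have hinj : ∀ x y, φ (f x) = φ (f y) → f' x = f' y := by
    intro x y h
    have := hconn (Setoid.ker (f' ∘ g)) (fun e he => by
      simp only [Setoid.ker_def, Function.comp, hfg]; exact e6 e he) _ _ h
    simpa only [Setoid.ker_def, Function.comp, hfg] using this
  refine ofLabelGenus_congr _ _ _ _ (fun x y => ⟨fun h => ?_, fun h => hinj x y h⟩) fun x => ?_
  · simp only [Function.comp, ← e4, h]
  · have h1 := e7 (φ (f x))
    have h2 : {c ∈ S' | φ c = φ (f x)} = {f' x} := by
      ext c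
      simp only [Finset.mem_filter, Finset.mem_singleton]
      constructor
      · rintro ⟨hc, h⟩
        obtain ⟨y, rfl⟩ := e3 c hc
        exact hinj _ _ (by rw [← e4, h])
      · rintro rfl; exact ⟨e2 x, e4 x⟩
    rw [h2, Finset.sum_singleton, ← hδ] at h1
    simp only [Function.comp]; omega

end ArcSystem

/-! ## Diagrams without white vertices -/

namespace LoopedDiagram

/-- The label of an end of a diagram without white vertices. -/
def endLabel {a b : ℕ} {C : Type} {deg : Fin 0 → ℕ} (f : Fin a → C) (g : Fin b → C) :
    HalfEdge deg ⊕ Fin (0 + (a + b)) → C :=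
  Sum.elim (fun h => h.1.elim0) (Fin.addCases (fun i => i.elim0) (Fin.addCases f g))

section

variable {a b : ℕ} {C : Type} {deg : Fin 0 → ℕ} (f : Fin a → C) (g : Fin b → C)

theorem endLabel_input (i : Fin a) :
    endLabel (deg := deg) f g (Sum.inr (Fin.natAdd 0 (Fin.castAdd b i))) = f i := by
  simp only [endLabel, Sum.elim_inr, Fin.addCases_right, Fin.addCases_left]

theorem endLabel_output (i : Fin b) :
    endLabel (deg := deg) f g (Sum.inr (Fin.natAdd 0 (Fin.natAdd a i))) = g i := by
  simp only [endLabel, Sum.elim_inr, Fin.addCases_right]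

theorem end_cases (x : HalfEdge deg ⊕ Fin (0 + (a + b))) :
    (∃ i : Fin a, x = Sum.inr (Fin.natAdd 0 (Fin.castAdd b i))) ∨
      ∃ i : Fin b, x = Sum.inr (Fin.natAdd 0 (Fin.natAdd a i)) := by
  rcases x with x | x
  · exact x.1.elim0
  · induction x using Fin.addCases with
    | left i => exact i.elim0
    | right i =>
      induction i using Fin.addCases with
      | left i => exact Or.inl ⟨i, rfl⟩
      | right i => exact Or.inr ⟨i, rfl⟩

end

/-- The diagram without white vertices whose arc components are labeled by `C`, the `i`-th input
lying on `f i` and the `j`-th output on `g j`; the component `c` has genus `γ c`. -/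
def cospan {a b : ℕ} {C : Type} (f : Fin a → C) (g : Fin b → C) (γ : C → ℕ) :
    LoopedDiagram 0 (a + b) 0 where
  deg := fun _ => 0
  arcs := ArcSystem.ofLabelGenus (endLabel f g) γ
  loop := fun i => i.elim0

theorem eq_cospan {a b : ℕ} {C C' : Type} {f : Fin a → C} {g : Fin b → C} {γ : C → ℕ}
    (Γ : LoopedDiagram 0 (a + b) 0) (F : HalfEdge Γ.deg ⊕ Fin (0 + (a + b)) → C') (γ' : C' → ℕ)
    (hΓ : Γ.arcs = ArcSystem.ofLabelGenus F γ') (φ : C → C') (hφ : Function.Injective φ)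
    (hf : ∀ i, φ (f i) = F (Sum.inr (Fin.natAdd 0 (Fin.castAdd b i))))
    (hg : ∀ i, φ (g i) = F (Sum.inr (Fin.natAdd 0 (Fin.natAdd a i))))
    (hγ : ∀ c, γ c = γ' (φ c)) : Γ = cospan f g γ := by
  obtain ⟨deg, arcs, loop⟩ := Γ
  obtain rfl : deg = fun _ => 0 := Subsingleton.elim _ _
  obtain rfl : loop = fun i => i.elim0 := Subsingleton.elim _ _
  change HalfEdge (fun _ : Fin 0 => 0) ⊕ Fin (0 + (a + b)) → C' at F
  change arcs = ArcSystem.ofLabelGenus (X := HalfEdge (fun _ : Fin 0 => 0) ⊕ _) F γ' at hΓ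
  subst hΓ
  unfold cospan
  congr 1
  have key : ∀ x, φ (endLabel f g x) = F x := by
    intro x
    rcases end_cases x with ⟨i, rfl⟩ | ⟨i, rfl⟩
    · rw [endLabel_input, hf]
    · rw [endLabel_output, hg]
  refine ArcSystem.ofLabelGenus_congr _ _ _ _ (fun x y => ?_) fun x => ?_
  · rw [← key x, ← key y, hφ.eq_iff]
  · rw [← key x, hγ]

theorem cospan_mem {a b : ℕ} {C : Type} (f : Fin a → C) {g : Fin b → C} (γ : C → ℕ)
    (hg : Function.Surjective g) : Finsupp.single (cospan f g γ) 1 ∈ lDPlus 0 a 0 b := by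
  refine Submodule.subset_span ⟨_, fun i => i.elim0, fun h => h.1.elim0, ⟨rfl, ?_⟩, rfl⟩
  intro x
  refine Or.inr ?_
  obtain ⟨j, hj⟩ := hg (endLabel f g x)
  refine ⟨j, (ArcSystem.ofLabelGenus_rel _ _ _ _).2 (hj.symm.trans ?_)⟩
  exact (endLabel_output f g j).symm

/-- Without white vertices there is nothing to attach: passage and position are unique, and the sign
is an empty product. -/
theorem compose_eq_single_glue {a b c : ℕ} (y : LoopedDiagram 0 (b + c) 0)
    (x : LoopedDiagram 0 (a + b) 0) (z : LoopedDiagram 0 (a + c) 0)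
    (h : ∀ (w : Passage y x) (π : Position w), π.glue = z) :
    y.compose x = Finsupp.single z 1 := by
  classical
  let w₀ : Passage y x := fun i => i.elim0
  let π₀ : Position w₀ := Equiv.equivOfIsEmpty _ _
  unfold compose
  rw [Fintype.sum_eq_single w₀ (fun w hw => (hw (funext fun i => i.elim0)).elim),
    Fintype.sum_eq_single π₀ (fun π hπ => (hπ (Subsingleton.elim _ _)).elim),
    if_pos ⟨fun i => i.elim0, fun u => u.elim0, fun u => u.elim0, fun e => e.1.elim0,
      fun i => i.elim0⟩, h, gen, if_pos (show z.Nondegenerate from fun h => h.1.elim0),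
      Position.sign, Finset.card_eq_zero.2 (Finset.eq_empty_of_isEmpty _)]
  simp

section

variable {a b c n₁ n₂ n₃ : ℕ} {y : LoopedDiagram n₃ (b + c) n₂} {x : LoopedDiagram n₂ (a + b) n₁}
  {w : Passage y x} (π : Position w)

theorem Position.endOf_input (i : Fin a) :
    π.endOf (Sum.inr (Fin.natAdd n₁ (Fin.castAdd c i))) =
      Sum.inl (Sum.inr (Fin.natAdd n₁ (Fin.castAdd b i))) := by
  simp only [Position.endOf, Sum.elim_inr, Fin.addCases_right, Fin.addCases_left]

theorem Position.endOf_output (i : Fin c) :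
    π.endOf (Sum.inr (Fin.natAdd n₁ (Fin.natAdd a i))) =
      Sum.inr (Sum.inr (Fin.natAdd n₂ (Fin.natAdd b i))) := by
  simp only [Position.endOf, Sum.elim_inr, Fin.addCases_right]

end

/-- `hcomm` and `hconn` say that the edges generate exactly the fibres of `p` and `p'`, so that `E`
plays the role of the pushout; `hsurj` keeps an output on every component. `hδ` is the Euler
characteristic count, components against glued edges, written without subtraction. -/
theorem compose_eq_cospan {a b c : ℕ} {C C' E : Type} [Fintype C] [Fintype C'] [DecidableEq C]
    [DecidableEq C'] [DecidableEq E] (x : LoopedDiagram 0 (a + b) 0)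
    (y : LoopedDiagram 0 (b + c) 0) (f : Fin a → C) (g : Fin b → C) (γ : C → ℕ) (f' : Fin b → C')
    (g' : Fin c → C') (γ' : C' → ℕ) (p : C → E) (p' : C' → E) (δ : E → ℕ)
    (hx : x.arcs = ArcSystem.ofLabelGenus (endLabel f g) γ)
    (hy : y.arcs = ArcSystem.ofLabelGenus (endLabel f' g') γ')
    (hfg : ∀ u, (∃ i, f i = u) ∨ ∃ i, g i = u) (hfg' : ∀ u, (∃ i, f' i = u) ∨ ∃ i, g' i = u)
    (hcomm : ∀ i, p (g i) = p' (f' i))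
    (hconn : ∀ r : Setoid (C ⊕ C'), (∀ i, r (Sum.inl (g i)) (Sum.inr (f' i))) →
      ∀ u v, Sum.elim p p' u = Sum.elim p p' v → r u v)
    (hsurj : ∀ e, ∃ j, p' (g' j) = e)
    (hδ : ∀ e, δ e + ({u | p u = e} : Finset C).card + ({u | p' u = e} : Finset C').card =
      1 + ∑ u with p u = e, γ u + ∑ u with p' u = e, γ' u +
        ({i | p (g i) = e} : Finset (Fin b)).card) :
    y.compose x = Finsupp.single (cospan (fun i => p (f i)) (fun j => p' (g' j)) δ) 1 := by
  refine compose_eq_single_glue _ _ _ fun w π => ?_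
  have hpairs : gluedPairs y x = (List.finRange b).map (fun i =>
    (Sum.inl (Sum.inr (Fin.natAdd _ (Fin.natAdd _ i))),
      Sum.inr (Sum.inr (Fin.natAdd _ (Fin.castAdd _ i))))) := rfl
  have key : (x.arcs.sum y.arcs).joinList (gluedPairs y x) = ArcSystem.ofLabelGenus
        (Sum.elim p p' ∘ Sum.map (endLabel f g) (endLabel f' g')) δ := by
    rw [hpairs, hx, hy, ArcSystem.sum_ofLabelGenus]
    refine ArcSystem.joinList_ofLabelGenus (Sum.elim p p') _ _ _ δ ?_ ?_ ?_ ?_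
    · rw [Sum.map_surjective]
      constructor
      · intro u
        rcases hfg u with ⟨i, rfl⟩ | ⟨i, rfl⟩
        · exact ⟨_, endLabel_input _ _ i⟩
        · exact ⟨_, endLabel_output _ _ i⟩
      · intro u
        rcases hfg' u with ⟨i, rfl⟩ | ⟨i, rfl⟩
        · exact ⟨_, endLabel_input _ _ i⟩
        · exact ⟨_, endLabel_output _ _ i⟩
    · intro e he
      obtain ⟨i, -, rfl⟩ := List.mem_map.1 he
      simp only [Sum.map_inl, Sum.map_inr, Sum.elim_inl, Sum.elim_inr, endLabel_input,
        endLabel_output]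
      exact hcomm i
    · intro r hr
      refine hconn r fun i => ?_
      have := hr _ (List.mem_map_of_mem (List.mem_finRange i))
      simpa only [Sum.map_inl, Sum.map_inr, endLabel_input, endLabel_output] using this
    · intro e
      have h1 : (((List.finRange b).map fun i => if p (g i) = e then (1 : ℤ) else 0)).sum =
          (({i | p (g i) = e} : Finset (Fin b)).card : ℤ) := by
        rw [← Fin.sum_univ_def, Finset.card_filter]; push_cast; rfl
      have h2 : ∑ c : C ⊕ C' with Sum.elim p p' c = e, ((Sum.elim γ γ' c : ℕ) - 1 : ℤ) =
          ∑ u with p u = e, ((γ u : ℤ) - 1) + ∑ u with p' u = e, ((γ' u : ℤ) - 1) := by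
        rw [Finset.sum_filter, Fintype.sum_sum_type, Finset.sum_filter, Finset.sum_filter]
        rfl
      simp only [List.map_map, Function.comp_def, Sum.map_inl, Sum.elim_inl, endLabel_output]
      rw [h2, h1, Finset.sum_sub_distrib, Finset.sum_sub_distrib]
      have := hδ e
      simp only [Finset.sum_const, nsmul_eq_mul, mul_one]
      zify at this
      linarith
  refine eq_cospan _ ((Sum.elim p p' ∘ Sum.map (endLabel f g) (endLabel f' g')) ∘ π.endOf) δ ?_ id
    Function.injective_id (fun i => ?_) (fun i => ?_) (fun _ => rfl)
  · unfold Position.glue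
    rw [key]
    refine ArcSystem.comap_ofLabelGenus _ _ _ fun x => ?_
    obtain ⟨j, hj⟩ := hsurj ((Sum.elim p p' ∘ Sum.map (endLabel f g) (endLabel f' g')) x)
    refine ⟨Sum.inr (Fin.natAdd 0 (Fin.natAdd a j)), Eq.trans ?_ hj⟩
    rw [Position.endOf_output, Function.comp, Sum.map_inr, Sum.elim_inr, endLabel_output]
  · have := π.endOf_input (c := c) i
    refine Eq.trans ?_
      (congrArg (Sum.elim p p' ∘ Sum.map (endLabel f g) (endLabel f' g')) this).symm
    rw [Function.comp, Sum.map_inl, Sum.elim_inl, endLabel_input]; rfl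
  · have := π.endOf_output (a := a) i
    refine Eq.trans ?_
      (congrArg (Sum.elim p p' ∘ Sum.map (endLabel f g) (endLabel f' g')) this).symm
    rw [Function.comp, Sum.map_inr, Sum.elim_inr, endLabel_output]; rfl

theorem comp_single_single {n₁ m₁ n₂ m₂ n₃ m₃ : ℕ} (y : LoopedDiagram n₃ (m₂ + m₃) n₂)
    (x : LoopedDiagram n₂ (m₁ + m₂) n₁) :
    lD.comp (Finsupp.single y 1) (Finsupp.single x 1) = y.compose x := by
  simp [lD.comp]

end LoopedDiagram

/-! ## Splitting the first input -/

namespace LoopedDiagram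

/-- The map from the outputs to the inputs of `split r k g`. -/
def collapse (r k : ℕ) (x : Fin (k + 1 + r)) : Fin (k + 1) := ⟨x.val - r, by omega⟩

/-- The diagram with `k + 1` inputs which splits the input `0` into the outputs `0, …, r`, through
an arc component of genus `g`. The other inputs are connected to one output each, in order. -/
def split (r k g : ℕ) : LoopedDiagram 0 ((k + 1) + (k + 1 + r)) 0 :=
  cospan id (collapse r k) (fun e => if e = 0 then g else 0)

/-- The fibre of `collapse r k` over 0 has `r + 1` elements and every other fibre has one. -/
theorem sum_collapse {M : Type*} [AddCommMonoid M] (r k : ℕ) (G : Fin (k + 1) → M) :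
    ∑ i, G (collapse r k i) = ∑ u, G u + r • G 0 := by
  induction r with
  | zero => simp [collapse]
  | succ r ih =>
    rw [show ∑ i, G (collapse (r + 1) k i) = ∑ i : Fin (k + 1 + r + 1), G (collapse (r + 1) k i)
      from rfl, Fin.sum_univ_succ]
    have h0 : collapse (r + 1) k (0 : Fin (k + 1 + r + 1)) = 0 := by
      ext; simp [collapse]
    have h1 : ∀ i : Fin (k + 1 + r), collapse (r + 1) k i.succ = collapse r k i := by
      intro i; ext; simp [collapse]
    rw [h0]
    simp only [h1, ih, succ_nsmul]
    abel

theorem card_collapse (r k : ℕ) (p : Fin (k + 1) → Prop) [DecidablePred p] :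
    (Finset.univ.filter fun i => p (collapse r k i)).card =
      (Finset.univ.filter p).card + if p 0 then r else 0 := by
  rw [Finset.card_filter, Finset.card_filter, sum_collapse r k fun u => if p u then 1 else 0]
  simp

theorem collapse_surjective (r k : ℕ) : Function.Surjective (collapse r k) := fun u =>
  ⟨⟨u.val + r, by omega⟩, by ext; simp [collapse]⟩

theorem split_mem (r k g : ℕ) :
    Finsupp.single (split r k g) 1 ∈ lDPlus 0 (k + 1) 0 (k + 1 + r) :=
  cospan_mem _ _ (collapse_surjective r k)

theorem ofFun_compose_ofFun {a b c : ℕ} (f : Fin a → Fin b) (g : Fin b → Fin c) :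
    (ofFun g).compose (ofFun f) = Finsupp.single (ofFun (g ∘ f)) 1 := by
  refine compose_eq_cospan (ofFun f) (ofFun g) f id (fun _ => 0) g id (fun _ => 0) g id
    (fun _ => 0) rfl rfl (fun u => Or.inr ⟨u, rfl⟩) (fun u => Or.inr ⟨u, rfl⟩) (fun i => rfl)
    ?_ (fun e => ⟨e, rfl⟩) ?_
  · intro r hr
    have : ∀ u, r u (Sum.inr (Sum.elim g id u)) := by
      rintro (u | u)
      · exact hr u
      · exact r.refl _
    intro u v huv
    exact r.trans (this u) (huv ▸ r.symm (this v))
  · intro e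
    simp [Finset.filter_eq', add_comm]

theorem split_compose_ofFun (r k l g : ℕ) (f : Fin (k + 1) → Fin (l + 1)) :
    (split r l g).compose (ofFun f) =
      Finsupp.single (cospan f (collapse r l) (fun e => if e = 0 then g else 0)) 1 := by
  refine compose_eq_cospan (ofFun f) (split r l g) f id (fun _ => 0) id (collapse r l)
    (fun e => if e = 0 then g else 0) id id
    _ rfl rfl (fun u => Or.inr ⟨u, rfl⟩) (fun u => Or.inl ⟨u, rfl⟩) (fun i => rfl)
    ?_ (fun e => collapse_surjective r l e) ?_
  · intro s hr
    have : ∀ u, s u (Sum.inr (Sum.elim id id u)) := by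
      rintro (u | u)
      · exact hr u
      · exact s.refl _
    intro u v huv
    exact s.trans (this u) (huv ▸ s.symm (this v))
  · intro e
    simp [Finset.filter_eq']
    grind

/-- This is one side of the Frobenius relation; `split_compose_ofFun` reduces the other side to the
same cospan. The map `f'` must fix the `r + 1` copies of the first input, so that nothing is
identified among them and the genus does not change. -/
theorem ofFun_compose_split (r k l g : ℕ) (f : Fin (k + 1) → Fin (l + 1))
    (f' : Fin (k + 1 + r) → Fin (l + 1 + r)) (h0 : f 0 = 0)
    (h1 : ∀ x, x.val ≤ r → (f' x).val = x.val)
    (h2 : ∀ x, collapse r l (f' x) = f (collapse r k x)) :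
    (ofFun f').compose (split r k g) =
      Finsupp.single (cospan f (collapse r l) (fun e => if e = 0 then g else 0)) 1 := by
  refine compose_eq_cospan (split r k g) (ofFun f') id (collapse r k)
    (fun e => if e = 0 then g else 0) f' id (fun _ => 0) f
    (collapse r l) _ rfl rfl (fun u => Or.inl ⟨u, rfl⟩) (fun u => Or.inr ⟨u, rfl⟩)
    (fun i => (h2 i).symm) ?_ (fun e => collapse_surjective r l e) ?_
  · intro s hs
    -- Representatives of the components: the split vertex for label 0, and for any other label its
    -- unique output.
    let rep : Fin (l + 1) → Fin (k + 1) ⊕ Fin (l + 1 + r) := fun e =>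
      if e = 0 then Sum.inl 0 else Sum.inr ⟨e.val + r, by omega⟩
    have hr : ∀ v, s (Sum.inr v) (rep (collapse r l v)) := by
      intro v
      by_cases hv : v.val ≤ r
      · have e1 : collapse r l v = 0 := by ext; simp [collapse, hv]
        have e2 := hs ⟨v.val, by omega⟩
        have e3 : f' ⟨v.val, by omega⟩ = v := by ext; exact h1 _ hv
        have e4 : collapse r k ⟨v.val, by omega⟩ = 0 := by ext; simp [collapse, hv]
        rw [e3, e4] at e2
        simp only [rep, e1, if_true]
        exact s.symm e2
      · have e1 : collapse r l v ≠ 0 := by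
          intro h; have := congrArg Fin.val h; simp [collapse] at this; omega
        have e2 : (⟨(collapse r l v).val + r, by omega⟩ : Fin (l + 1 + r)) = v := by
          ext; simp only [collapse]; omega
        simp only [rep, e1, if_false, e2]
        exact s.refl _
    have : ∀ u, s u (rep (Sum.elim f (collapse r l) u)) := by
      rintro (u | u)
      · obtain ⟨i, rfl⟩ := collapse_surjective r k u
        refine s.trans (hs i) ?_
        rw [Sum.elim_inl, ← h2]
        exact hr _
      · exact hr u
    intro u v huv
    exact s.trans (this u) (huv ▸ s.symm (this v))
  · intro e
    rw [card_collapse r k fun u => f u = e, card_collapse r l fun u => u = e]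
    have e1 : ∑ u with f u = e, (if u = 0 then g else 0) = if e = 0 then g else 0 := by
      rw [Finset.sum_filter]
      simp only [← ite_and]
      by_cases he : e = 0
      · rw [Fintype.sum_eq_single 0]
        · simp [he, h0]
        · intro x hx; simp [hx]
      · rw [if_neg he]
        refine Finset.sum_eq_zero fun x _ => if_neg ?_
        rintro ⟨h, rfl⟩
        exact he (h.symm.trans h0)
    rw [e1, h0]
    simp [Finset.filter_eq']
    ring_nf

/-- The `r + 1` edges leaving the split component end at as many outputs as `lab` has over 0. Each
edge beyond one per output closes a cycle, and this is the rise in genus recorded by `hδ`. -/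
theorem ofFun_compose_split_of_surjective (r k b g : ℕ) (φ : Fin (k + 1 + r) → Fin b)
    (hφ : Function.Surjective φ) (lab : Fin b → Fin (k + 1)) (h : ∀ x, lab (φ x) = collapse r k x)
    (δ : Fin (k + 1) → ℕ)
    (hδ : ∀ e, δ e + (Finset.univ.filter fun j => lab j = e).card =
      1 + if e = 0 then g + r else 0) :
    (ofFun φ).compose (split r k g) = Finsupp.single (cospan id lab δ) 1 := by
  refine compose_eq_cospan (split r k g) (ofFun φ) id (collapse r k)
    (fun e => if e = 0 then g else 0) φ id (fun _ => 0) id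
    lab _ rfl rfl (fun u => Or.inl ⟨u, rfl⟩) (fun u => Or.inr ⟨u, rfl⟩)
    (fun i => (h i).symm) ?_ (fun e => ?_) ?_
  · intro s hs
    have : ∀ u, s u (Sum.inl (Sum.elim id lab u)) := by
      rintro (u | u)
      · exact s.refl _
      · obtain ⟨i, rfl⟩ := hφ u
        rw [Sum.elim_inr, h]
        exact s.symm (hs i)
    intro u v huv
    exact s.trans (this u) (huv ▸ s.symm (this v))
  · obtain ⟨i, hi⟩ := collapse_surjective r k e
    exact ⟨φ i, by rw [← hi, ← h]; rfl⟩
  · intro e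
    have := card_collapse r k fun u => u = e
    simp only [id]
    rw [this]
    have := hδ e
    simp [Finset.filter_eq', eq_comm (a := (0 : Fin (k + 1)))] at this ⊢
    split_ifs at this ⊢ <;> omega

/-- Multiplying two of the three copies of the first input raises the genus by one. -/
theorem ofFun_compose_split_two (k g : ℕ) (φ : Fin (k + 1 + 2) → Fin (k + 1 + 1))
    (h1 : ∀ x, x.val ≤ 2 → (φ x).val ≤ 1) (h2 : ∀ x, 2 < x.val → (φ x).val = x.val - 1)
    (h3 : ∃ x, x.val ≤ 2 ∧ (φ x).val = 0) (h4 : ∃ x, x.val ≤ 2 ∧ (φ x).val = 1) :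
    (ofFun φ).compose (split 2 k g) = Finsupp.single (split 1 k (g + 1)) 1 := by
  refine ofFun_compose_split_of_surjective 2 k _ g φ ?_ (collapse 1 k) ?_ _ ?_
  · intro y
    rcases Nat.lt_or_ge y.val 2 with hy | hy
    · obtain ⟨x, -, hx⟩ := h3
      obtain ⟨x', -, hx'⟩ := h4
      rcases (show y.val = 0 ∨ y.val = 1 by omega) with h | h
      · exact ⟨x, by ext; omega⟩
      · exact ⟨x', by ext; omega⟩
    · exact ⟨⟨y.val + 1, by omega⟩, by ext; rw [h2 _ (by simp; omega)]; simp⟩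
  · intro x
    ext
    simp only [collapse]
    rcases Nat.lt_or_ge 2 x.val with h | h
    · rw [h2 x h]; omega
    · have := h1 x h; omega
  · intro e
    rw [card_collapse 1 k fun u => u = e]
    simp [Finset.filter_eq', eq_comm (a := (0 : Fin (k + 1)))]
    split_ifs <;> omega

end LoopedDiagram

/-! ### Frobenius relations between the structure maps -/

namespace CFrPlusFunctor

open LoopedDiagram

variable {R : Type u} [CommRing R] (Φ : CFrPlusFunctor.{u, v} R)

theorem map_single_comp {a b c : ℕ} {x : LoopedDiagram 0 (a + b) 0}
    {y : LoopedDiagram 0 (b + c) 0} {z : LoopedDiagram 0 (a + c) 0}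
    (hx : Finsupp.single x 1 ∈ lDPlus 0 a 0 b) (hy : Finsupp.single y 1 ∈ lDPlus 0 b 0 c)
    (hz : Finsupp.single z 1 ∈ lDPlus 0 a 0 c) (h : y.compose x = Finsupp.single z 1) :
    Φ.map ⟨_, hx⟩ ≫ Φ.map ⟨_, hy⟩ = Φ.map ⟨_, hz⟩ :=
  (Φ.map_comp _ _ _ (by rw [comp_single_single, h])).symm

/-- The action of a map of finite sets. -/
noncomputable def funMap {a b : ℕ} (f : Fin a → Fin b) : Φ.obj a ⟶ Φ.obj b :=
  Φ.map ⟨_, single_ofFun_mem f⟩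

/-- The action of `split r k g`. -/
noncomputable def splitMap (r k g : ℕ) : Φ.obj (k + 1) ⟶ Φ.obj (k + 1 + r) :=
  Φ.map ⟨_, split_mem r k g⟩

theorem funMap_comp {a b c : ℕ} (f : Fin a → Fin b) (g : Fin b → Fin c) :
    Φ.funMap f ≫ Φ.funMap g = Φ.funMap (g ∘ f) :=
  Φ.map_single_comp _ _ _ (ofFun_compose_ofFun f g)

theorem funMap_splitMap (r k l g : ℕ) (f : Fin (k + 1) → Fin (l + 1))
    (f' : Fin (k + 1 + r) → Fin (l + 1 + r)) (h0 : f 0 = 0)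
    (h1 : ∀ x, x.val ≤ r → (f' x).val = x.val)
    (h2 : ∀ x, collapse r l (f' x) = f (collapse r k x)) :
    Φ.funMap f ≫ Φ.splitMap r l g = Φ.splitMap r k g ≫ Φ.funMap f' :=
  (Φ.map_single_comp _ _ (cospan_mem _ _ (collapse_surjective r l))
    (split_compose_ofFun r k l g f)).trans
    (Φ.map_single_comp _ _ _ (ofFun_compose_split r k l g f f' h0 h1 h2)).symm

theorem splitMap_two_funMap (k g : ℕ) (φ : Fin (k + 1 + 2) → Fin (k + 1 + 1))
    (h1 : ∀ x, x.val ≤ 2 → (φ x).val ≤ 1) (h2 : ∀ x, 2 < x.val → (φ x).val = x.val - 1)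
    (h3 : ∃ x, x.val ≤ 2 ∧ (φ x).val = 0) (h4 : ∃ x, x.val ≤ 2 ∧ (φ x).val = 1) :
    Φ.splitMap 2 k g ≫ Φ.funMap φ = Φ.splitMap 1 k (g + 1) :=
  Φ.map_single_comp _ _ _ (ofFun_compose_split_two k g φ h1 h2 h3 h4)

end CFrPlusFunctor

/-! ## Rearranging sums -/

section Sums

variable {G : Type*} [AddCommGroup G]

/-- The terms (l, m) with m < l are paired with the terms (m, l - 1), as in the simplicial proof
that the square of the differential vanishes. -/
theorem sum_faces_comp_eq_zero (n : ℕ) (c : ℕ → ℕ → G)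
    (h : ∀ l m, m < l → l ≤ n → c l m = -c m (l - 1)) :
    ∑ l ∈ Finset.range (n + 1), ∑ m ∈ Finset.range n, c l m = 0 := by
  rw [← Finset.sum_product']
  rw [← Finset.sum_filter_add_sum_filter_not _ (fun p : ℕ × ℕ => p.2 < p.1), add_eq_zero_iff_eq_neg,
    ← Finset.sum_neg_distrib]
  refine Finset.sum_nbij' (fun p => (p.2, p.1 - 1)) (fun p => (p.2 + 1, p.1)) ?_ ?_ ?_ ?_ ?_
  · rintro ⟨l, m⟩ hp; simp at hp ⊢; omega
  · rintro ⟨l, m⟩ hp; simp at hp ⊢; omega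
  · rintro ⟨l, m⟩ hp; simp at hp ⊢; omega
  · rintro ⟨l, m⟩ hp; simp at hp ⊢
  · rintro ⟨l, m⟩ hp; simp at hp ⊢; exact h l m (by omega) (by omega)

/-- This isolates the faces at the second copy, at position i + 1, and at the third copy, at
position j + 2. For i = j the two copies are adjacent and share a face, which is the case treated in
`sum_range_eq_of_eq`. -/
theorem sum_range_eq_of_le (f : ℕ → G) {i j k : ℕ} (hij : i < j) (hjk : j ≤ k) :
    ∑ m ∈ Finset.range (k + 3), f m = ∑ m ∈ Finset.range i, f m + (f i + f (i + 1)) +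
      ∑ m ∈ Finset.Ico (i + 2) (j + 1), f m + (f (j + 1) + f (j + 2)) +
        ∑ m ∈ Finset.Ico (j + 3) (k + 3), f m := by
  rw [Finset.range_eq_Ico, ← Finset.sum_Ico_consecutive f (Nat.zero_le (j + 3)) (by omega),
    Finset.sum_Ico_succ_top (by omega), Finset.sum_Ico_succ_top (by omega),
    ← Finset.sum_Ico_consecutive f (Nat.zero_le (i + 2)) (by omega),
    Finset.sum_Ico_succ_top (by omega), Finset.sum_Ico_succ_top (by omega), Finset.range_eq_Ico]
  abel

theorem sum_range_eq_of_eq (f : ℕ → G) {i k : ℕ} (hik : i ≤ k) :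
    ∑ m ∈ Finset.range (k + 3), f m = ∑ m ∈ Finset.range i, f m + (f i + f (i + 1)) + f (i + 2) +
        ∑ m ∈ Finset.Ico (i + 3) (k + 3), f m := by
  rw [Finset.range_eq_Ico, ← Finset.sum_Ico_consecutive f (Nat.zero_le (i + 3)) (by omega),
    Finset.sum_Ico_succ_top (by omega), Finset.sum_Ico_succ_top (by omega),
    Finset.sum_Ico_succ_top (by omega), Finset.range_eq_Ico]
  abel

/-- The cancellation between the faces `t i j m` of a sum over shuffles and the sums `r i j m`
over shuffles of the faces. -/
theorem sum_shuffle_faces (k : ℕ) (t r : ℕ → ℕ → ℕ → G) (s : ℕ → G)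
    (h1 : ∀ i j, i < j → j ≤ k → t (i + 1) j (i + 1) = -t i j (i + 1))
    (h2 : ∀ i j, i ≤ j → j < k → t i (j + 1) (j + 2) = -t i j (j + 2))
    (h3 : ∀ i j m, m ≤ i → i ≤ j → j < k → t (i + 1) (j + 1) m = r i j m)
    (h4 : ∀ i j m, i < m → m ≤ j → j < k → t i (j + 1) (m + 1) = r i j m)
    (h5 : ∀ i j m, i ≤ j → j < m → m ≤ k → t i j (m + 2) = r i j m)
    (h6 : ∀ j, j ≤ k → t 0 j 0 = s j) (h7 : ∀ j, j ≤ k → t j j (j + 1) = -s j)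
    (h8 : ∀ i, i ≤ k → t i k (k + 2) = s i) :
    ∑ j ∈ Finset.range (k + 1), ∑ i ∈ Finset.range (j + 1), ∑ m ∈ Finset.range (k + 3), t i j m =
      ∑ j ∈ Finset.range k, ∑ i ∈ Finset.range (j + 1), ∑ m ∈ Finset.range (k + 1), r i j m +
        ∑ i ∈ Finset.range (k + 1), s i := by
  have key : ∀ j ∈ Finset.range (k + 1),
      ∑ i ∈ Finset.range (j + 1), ∑ m ∈ Finset.range (k + 3), t i j m =
      ∑ i ∈ Finset.range (j + 1), ∑ m ∈ Finset.range i, t i j m +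
      ∑ i ∈ Finset.range j, ∑ m ∈ Finset.Ico (i + 2) (j + 1), t i j m +
      ∑ i ∈ Finset.range (j + 1), ∑ m ∈ Finset.Ico (j + 3) (k + 3), t i j m +
      (∑ i ∈ Finset.range (j + 1), t i j (j + 2) + ∑ i ∈ Finset.range j, t i j (j + 1)) := by
    intro j hj
    have hj : j ≤ k := by simpa [Nat.lt_succ_iff] using hj
    -- For fixed `j` the faces at the second copy telescope in `i`. The ends of the telescope, where
    -- this copy meets the first copy (`h6`) or the third one (`h7`), are `s j` and `-s j`.
    have e1 : ∑ i ∈ Finset.range j, (t i j i + t i j (i + 1)) + (t j j j + t j j (j + 1)) = 0 := by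
      rw [Finset.sum_congr rfl (g := fun i => t i j i - t (i + 1) j (i + 1)),
        Finset.sum_range_sub' (fun i => t i j i), h6 j hj, h7 j hj]
      · abel
      · intro i hi
        rw [h1 i j (by simpa using hi) hj, sub_neg_eq_add]
    rw [Finset.sum_range_succ, sum_range_eq_of_eq _ hj,
      Finset.sum_congr rfl fun i hi => sum_range_eq_of_le _ (Finset.mem_range.1 hi) hj]
    simp only [Finset.sum_add_distrib, Finset.sum_range_succ _ j] at e1 ⊢
    rw [← sub_eq_zero] at e1 ⊢
    rw [← e1]
    abel
  rw [Finset.sum_congr rfl key]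
  simp only [Finset.sum_add_distrib]
  -- The faces away from the second and third copies correspond to faces taken before splitting. The
  -- ranges of `m` in `a1`, `a2`, `a3` (left of, between and right of the two copies) are disjoint
  -- and together exhaust the faces before splitting.
  have a1 : ∑ j ∈ Finset.range (k + 1), ∑ i ∈ Finset.range (j + 1), ∑ m ∈ Finset.range i, t i j m =
      ∑ j ∈ Finset.range k, ∑ i ∈ Finset.range (j + 1), ∑ m ∈ Finset.range (i + 1), r i j m := by
    rw [Finset.sum_range_succ']
    simp only [Finset.range_one, Finset.sum_singleton, Finset.range_zero, Finset.sum_empty,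
      add_zero, zero_add]
    refine Finset.sum_congr rfl fun j hj => ?_
    rw [Finset.sum_range_succ']
    simp only [Finset.range_zero, Finset.sum_empty, add_zero]
    refine Finset.sum_congr rfl fun i hi => Finset.sum_congr rfl fun m hm => ?_
    simp only [Finset.mem_range] at hj hi hm
    exact h3 i j m (by omega) (by omega) hj
  have a2 : ∑ j ∈ Finset.range (k + 1), ∑ i ∈ Finset.range j,
        ∑ m ∈ Finset.Ico (i + 2) (j + 1), t i j m =
      ∑ j ∈ Finset.range k, ∑ i ∈ Finset.range (j + 1),
        ∑ m ∈ Finset.Ico (i + 1) (j + 1), r i j m := by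
    rw [Finset.sum_range_succ']
    simp only [Finset.range_zero, Finset.sum_empty, add_zero]
    refine Finset.sum_congr rfl fun j hj => Finset.sum_congr rfl fun i hi => ?_
    rw [← Finset.sum_Ico_add' _ (i + 1) (j + 1) 1]
    refine Finset.sum_congr rfl fun m hm => ?_
    simp only [Finset.mem_range, Finset.mem_Ico] at hj hi hm
    exact h4 i j m (by omega) (by omega) hj
  have a3 : ∑ j ∈ Finset.range (k + 1), ∑ i ∈ Finset.range (j + 1),
        ∑ m ∈ Finset.Ico (j + 3) (k + 3), t i j m =
      ∑ j ∈ Finset.range k, ∑ i ∈ Finset.range (j + 1),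
        ∑ m ∈ Finset.Ico (j + 1) (k + 1), r i j m := by
    rw [Finset.sum_range_succ]
    simp only [Finset.Ico_self, Finset.sum_empty, Finset.sum_const_zero, add_zero]
    refine Finset.sum_congr rfl fun j hj => Finset.sum_congr rfl fun i hi => ?_
    rw [← Finset.sum_Ico_add' _ (j + 1) (k + 1) 2]
    refine Finset.sum_congr rfl fun m hm => ?_
    simp only [Finset.mem_range, Finset.mem_Ico] at hj hi hm
    exact h5 i j m (by omega) (by omega) (by omega)
  -- The faces at the third copy telescope in `j`. What survives is `j = k`, where this copy meets
  -- the first one cyclically.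
  have a4 : ∑ j ∈ Finset.range (k + 1), ∑ i ∈ Finset.range (j + 1), t i j (j + 2) +
      ∑ j ∈ Finset.range (k + 1), ∑ i ∈ Finset.range j, t i j (j + 1) =
      ∑ i ∈ Finset.range (k + 1), s i := by
    rw [Finset.sum_range_succ, Finset.sum_range_succ' (fun j => ∑ i ∈ Finset.range j, t i j (j + 1))]
    simp only [Finset.range_zero, Finset.sum_empty, add_zero]
    rw [add_right_comm, ← Finset.sum_add_distrib, Finset.sum_eq_zero, zero_add]
    · exact Finset.sum_congr rfl fun i hi => h8 i (by simpa [Nat.lt_succ_iff] using hi)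
    · intro j hj
      rw [← Finset.sum_add_distrib]
      refine Finset.sum_eq_zero fun i hi => ?_
      simp only [Finset.mem_range] at hj hi
      rw [h2 i j (by omega) hj, add_neg_cancel]
  rw [a1, a2, a3, a4]
  congr 1
  simp only [← Finset.sum_add_distrib]
  refine Finset.sum_congr rfl fun j hj => Finset.sum_congr rfl fun i hi => ?_
  simp only [Finset.mem_range] at hj hi
  rw [Finset.range_eq_Ico, Finset.sum_Ico_consecutive _ (by omega) (by omega),
    Finset.sum_Ico_consecutive _ (by omega) (by omega), ← Finset.range_eq_Ico]

end Sums

/-! ## Maps of finite sets -/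

namespace LoopedDiagram

/-- The map between finite sets given by a map of natural numbers. -/
def clamp {a b : ℕ} (F : ℕ → ℕ) (x : Fin a) : Fin (b + 1) := ⟨min (F x) b, by omega⟩

theorem clamp_congr {a b : ℕ} {F F' : ℕ → ℕ} (h : ∀ x < a, F x = F' x) :
    (clamp F : Fin a → Fin (b + 1)) = clamp F' := by
  funext x; simp only [clamp, h x x.isLt]

theorem clamp_comp {a b c : ℕ} {F F' : ℕ → ℕ} (h : ∀ x < a, F x ≤ b) :
    (clamp F' : Fin (b + 1) → Fin (c + 1)) ∘ (clamp F : Fin a → Fin (b + 1)) =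
      clamp fun x => F' (F x) := by
  funext x; simp only [clamp, Function.comp, min_eq_left (h x x.isLt)]

/-- The face `m` on natural numbers. -/
def faceNat (k m x : ℕ) : ℕ :=
  if m = k + 1 then (if x = k + 1 then 0 else x) else if x ≤ m then x else x - 1

/-- The degeneracy `i` on natural numbers. -/
def degenNat (i x : ℕ) : ℕ := if x ≤ i then x else x + 1

/-- The positions of `a₀', a₀'', a₀''', a₁, …, aₖ` in the sequence
`a₀', a₁, …, aᵢ, a₀'', aᵢ₊₁, …, aⱼ, a₀''', aⱼ₊₁, …, aₖ`. -/
def threeNat (i j x : ℕ) : ℕ :=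
  if x = 0 then 0 else if x = 1 then i + 1 else if x = 2 then j + 2
  else if x ≤ i + 2 then x - 2 else if x ≤ j + 2 then x - 1 else x

/-- The positions of `a₀', a₀'', a₁, …, aₖ` in the sequence
`a₀', a₁, …, aᵢ, a₀'', aᵢ₊₁, …, aₖ`. -/
def twoNat (i x : ℕ) : ℕ :=
  if x = 0 then 0 else if x = 1 then i + 1 else if x ≤ i + 1 then x - 1 else x

/-- The positions of `a₀', a₀'', a₁, …, aₖ` in the sequence `1, a₀', a₁, …, aₖ, a₀''`. -/
def unitNat (k x : ℕ) : ℕ := if x = 0 then 1 else if x = 1 then k + 2 else x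

/-- The face `m` on `a₀', a₀'', a₀''', a₁, …, aₖ₊₁`. -/
def faceThreeNat (k m x : ℕ) : ℕ :=
  if x ≤ 2 then x else if m = k + 1 ∧ x = k + 3 then 0 else if m = 0 ∧ x = 3 then 0
  else if x ≤ m + 2 then x else x - 1

/-- The face `m` on `a₀', a₀'', a₁, …, aₖ₊₁`. -/
def faceTwoNat (k m x : ℕ) : ℕ :=
  if x ≤ 1 then x else if m = k + 1 ∧ x = k + 2 then 1 else if m = 0 ∧ x = 2 then 0
  else if x ≤ m + 1 then x else x - 1

section

variable {k i j m x : ℕ}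

theorem collapse_faceThreeNat (hm : m ≤ k + 1) (hx : x < k + 4) :
    min (faceThreeNat k m x) (k + 2) - 2 = min (faceNat k m (x - 2)) k := by
  simp only [faceNat, faceThreeNat]
  grind (splits := 30)

theorem collapse_faceTwoNat (hm : m ≤ k + 1) (hx : x < k + 3) :
    min (faceTwoNat k m x) (k + 1) - 1 = min (faceNat k m (x - 1)) k := by
  simp only [faceNat, faceTwoNat]
  grind (splits := 30)

/-- Commutativity: moving a₀'' past aᵢ₊₁ does not change their product. -/
theorem faceNat_threeNat_succ_left (hij : i < j) (hj : j ≤ k) :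
    faceNat (k + 1) (i + 1) (threeNat (i + 1) j x) = faceNat (k + 1) (i + 1) (threeNat i j x) := by
  simp only [faceNat, threeNat]
  grind (splits := 30)

theorem faceNat_threeNat_succ_right (hij : i ≤ j) (hj : j < k) :
    faceNat (k + 1) (j + 2) (threeNat i (j + 1) x) = faceNat (k + 1) (j + 2) (threeNat i j x) := by
  simp only [faceNat, threeNat]
  grind (splits := 30)

/-- The face 0 is included: since `i + 1 > 0`, the neighbour of a₀' is a₁, and multiplying a₁ into
the first copy alone is multiplication before splitting. -/
theorem faceNat_threeNat_left (hm : m ≤ i) (hij : i ≤ j) (hj : j ≤ k) (hx : x < k + 4) :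
    faceNat (k + 2) m (threeNat (i + 1) (j + 1) x) = threeNat i j (faceThreeNat k m x) := by
  simp only [faceNat, threeNat, faceThreeNat]
  grind (splits := 30)

theorem faceNat_threeNat_middle (hm : i < m) (hmj : m ≤ j) (hj : j ≤ k) (hx : x < k + 4) :
    faceNat (k + 2) (m + 1) (threeNat i (j + 1) x) = threeNat i j (faceThreeNat k m x) := by
  simp only [faceNat, threeNat, faceThreeNat]
  grind (splits := 30)

theorem faceNat_threeNat_right (hij : i ≤ j) (hjm : j < m) (hm : m ≤ k + 1) (hx : x < k + 4) :
    faceNat (k + 2) (m + 2) (threeNat i j x) = threeNat i j (faceThreeNat k m x) := by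
  simp only [faceNat, threeNat, faceThreeNat]
  grind (splits := 30)

/-- The copies a₀' and a₀'' meet; `x - 1` identifies the first two of the three copies. The next two
lemmas do the same for the other pairs of copies. -/
theorem faceNat_threeNat_zero :
    faceNat (k + 1) 0 (threeNat 0 j x) = twoNat j (x - 1) := by
  simp only [faceNat, threeNat, twoNat]
  grind (splits := 30)

theorem faceNat_threeNat_self (hj : j ≤ k) :
    faceNat (k + 1) (j + 1) (threeNat j j x) = twoNat j (if x ≤ 1 then x else x - 1) := by
  simp only [faceNat, threeNat, twoNat]
  grind (splits := 30)

theorem faceNat_threeNat_last (hi : i ≤ k) (hx : x < k + 3) :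
    faceNat (k + 1) (k + 2) (threeNat i k x) =
      twoNat i (if x ≤ 1 then x else if x = 2 then 0 else x - 1) := by
  simp only [faceNat, threeNat, twoNat]
  grind (splits := 30)

end

end LoopedDiagram

namespace CFrPlusFunctor

open LoopedDiagram

variable {R : Type u} [CommRing R] (Φ : CFrPlusFunctor.{u, v} R)

/-! ## The homotopy on each summand -/

/-- The face `m`, indexed by a natural number. -/
noncomputable def faceMap (k m : ℕ) : Φ.obj (k + 2) ⟶ Φ.obj (k + 1) :=
  Φ.funMap (clamp (faceNat k m))

/-- The operation `(a₀, …, aₖ) ↦ (a₀', a₁, …, aᵢ, a₀'', aᵢ₊₁, …, aⱼ, a₀''', aⱼ₊₁, …, aₖ)`. -/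
noncomputable def threeMap (k i j : ℕ) : Φ.obj (k + 1) ⟶ Φ.obj (k + 3) :=
  Φ.splitMap 2 k 0 ≫ Φ.funMap (clamp (threeNat i j))

/-- The operation `(a₀, …, aₖ) ↦ (a₀', a₁, …, aᵢ, a₀'', aᵢ₊₁, …, aₖ)` with an arc component of
genus one. -/
noncomputable def twoMap (k i : ℕ) : Φ.obj (k + 1) ⟶ Φ.obj (k + 2) :=
  Φ.splitMap 1 k 1 ≫ Φ.funMap (clamp (twoNat i))

/-- The operation `(a₀, …, aₖ) ↦ (1, a₀', a₁, …, aₖ, a₀'')` with an arc component of genus one. -/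
noncomputable def unitMap (k : ℕ) : Φ.obj (k + 1) ⟶ Φ.obj (k + 3) :=
  Φ.splitMap 1 k 1 ≫ Φ.funMap (clamp (unitNat k))

theorem face_eq_faceMap (k : ℕ) (i : Fin (k + 2)) : Φ.face k i = Φ.faceMap k i := by
  have : faceFun k i = clamp (faceNat k i) := by
    funext x
    ext
    simp only [faceFun, clamp, faceNat]
    split_ifs <;> omega
  unfold faceMap
  rw [← this]
  rfl

theorem degen_eq_funMap (k : ℕ) (i : Fin (k + 1)) :
    Φ.degen k i = Φ.funMap (clamp (degenNat i)) := by
  have : Fin.succAbove i.succ = clamp (degenNat i) := by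
    funext x
    ext
    simp only [Fin.succAbove, clamp, degenNat, Fin.lt_def, Fin.val_castSucc, Fin.val_succ]
    split_ifs <;> simp <;> omega
  unfold degen
  rw [← this]
  rfl

theorem faceMap_faceMap (k l m : ℕ) (hl : l ≤ k + 2) :
    Φ.faceMap (k + 1) l ≫ Φ.faceMap k m =
      Φ.funMap (clamp fun x => faceNat k m (faceNat (k + 1) l x)) := by
  unfold faceMap
  rw [funMap_comp, clamp_comp]
  intro x hx
  simp only [faceNat]
  split_ifs <;> omega

theorem threeMap_faceMap (k i j m : ℕ) (hij : i ≤ j) (hj : j ≤ k) :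
    Φ.threeMap k i j ≫ Φ.faceMap (k + 1) m =
      Φ.splitMap 2 k 0 ≫ Φ.funMap (clamp fun x => faceNat (k + 1) m (threeNat i j x)) := by
  unfold threeMap faceMap
  rw [Category.assoc, funMap_comp, clamp_comp]
  intro x hx
  simp only [threeNat]
  split_ifs <;> omega

theorem unitMap_faceMap (k m : ℕ) :
    Φ.unitMap k ≫ Φ.faceMap (k + 1) m =
      Φ.splitMap 1 k 1 ≫ Φ.funMap (clamp fun x => faceNat (k + 1) m (unitNat k x)) := by
  unfold unitMap faceMap
  rw [Category.assoc, funMap_comp, clamp_comp]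
  intro x hx
  simp only [unitNat]
  split_ifs <;> omega

theorem faceMap_splitMap_two (k m g : ℕ) (hm : m ≤ k + 1) :
    Φ.faceMap k m ≫ Φ.splitMap 2 k g =
      Φ.splitMap 2 (k + 1) g ≫ Φ.funMap (clamp (b := k + 2) (faceThreeNat k m)) := by
  refine Φ.funMap_splitMap 2 (k + 1) k g _ (clamp (faceThreeNat k m)) ?_ ?_ ?_
  · ext; simp [clamp, faceNat]
  · intro x hx
    simp only [clamp, faceThreeNat]
    split_ifs
    omega
  · intro x
    ext
    exact collapse_faceThreeNat hm x.isLt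

/-- By the Frobenius relation the factor may be multiplied into either copy of a₀. For the cyclic
face the second copy is chosen, since in `unitMap` it is the one that stands after the last input;
`faceMap_splitMap_two` uses the first copy instead. -/
theorem faceMap_splitMap_one (k m g : ℕ) (hm : m ≤ k + 1) :
    Φ.faceMap k m ≫ Φ.splitMap 1 k g =
      Φ.splitMap 1 (k + 1) g ≫ Φ.funMap (clamp (b := k + 1) (faceTwoNat k m)) := by
  refine Φ.funMap_splitMap 1 (k + 1) k g _ (clamp (faceTwoNat k m)) ?_ ?_ ?_
  · ext; simp [clamp, faceNat]
  · intro x hx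
    simp only [clamp, faceTwoNat]
    split_ifs
    omega
  · intro x
    ext
    exact collapse_faceTwoNat hm x.isLt

theorem faceMap_threeMap (k i j m : ℕ) (hm : m ≤ k + 1) :
    Φ.faceMap k m ≫ Φ.threeMap k i j =
      Φ.splitMap 2 (k + 1) 0 ≫
        Φ.funMap (clamp (b := k + 2) fun x => threeNat i j (faceThreeNat k m x)) := by
  unfold threeMap
  rw [← Category.assoc, faceMap_splitMap_two _ _ _ _ hm, Category.assoc, funMap_comp, clamp_comp]
  intro x hx
  simp only [faceThreeNat]
  split_ifs <;> omega

theorem faceMap_unitMap (k m : ℕ) (hm : m ≤ k + 1) :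
    Φ.faceMap k m ≫ Φ.unitMap k =
      Φ.splitMap 1 (k + 1) 1 ≫
        Φ.funMap (clamp (b := k + 2) fun x => unitNat k (faceTwoNat k m x)) := by
  unfold unitMap
  rw [← Category.assoc, faceMap_splitMap_one _ _ _ _ hm, Category.assoc, funMap_comp, clamp_comp]
  intro x hx
  simp only [faceTwoNat]
  split_ifs <;> omega

/-- The Hochschild differential on `Φ(k + 2)`. -/
noncomputable def hochMap (k : ℕ) : Φ.obj (k + 2) ⟶ Φ.obj (k + 1) :=
  ∑ m ∈ Finset.range (k + 2), ((-1 : ℤ) ^ m) • Φ.faceMap k m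

theorem hochMap_hochMap (k : ℕ) : Φ.hochMap (k + 1) ≫ Φ.hochMap k = 0 := by
  have := sum_faces_comp_eq_zero (k + 2)
    (fun l m => ((-1 : ℤ) ^ (l + m)) • (Φ.faceMap (k + 1) l ≫ Φ.faceMap k m)) ?_
  · rw [← this]
    unfold hochMap
    rw [Preadditive.sum_comp]
    refine Finset.sum_congr rfl fun l _ => ?_
    rw [Preadditive.comp_sum]
    refine Finset.sum_congr rfl fun m _ => ?_
    rw [Preadditive.zsmul_comp, Preadditive.comp_zsmul, smul_smul, pow_add]
  · intro l m hml hl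
    rw [faceMap_faceMap _ _ _ _ hl, faceMap_faceMap _ _ _ _ (by omega), ← neg_smul]
    congr 1
    · obtain ⟨l, rfl⟩ : ∃ l', l = l' + 1 := ⟨l - 1, by omega⟩
      simp only [Nat.add_sub_cancel]
      ring
    · congr 1
      refine clamp_congr fun x hx => ?_
      simp only [faceNat]
      split_ifs <;> omega

/-- The map `φ` identifies two of the three copies of a₀ and keeps all other inputs apart. The cycle
created in this way is the genus of the component in `twoMap`. -/
theorem threeMap_faceMap_eq_twoMap (k i j m l : ℕ) (hij : i ≤ j) (hj : j ≤ k)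
    (φ : ℕ → ℕ) (h0 : ∀ x, x ≤ 2 → φ x ≤ 1) (h1 : ∀ x, 2 < x → φ x = x - 1)
    (h2 : ∃ x, x ≤ 2 ∧ φ x = 0) (h3 : ∃ x, x ≤ 2 ∧ φ x = 1)
    (h : ∀ x < k + 3, faceNat (k + 1) m (threeNat i j x) = twoNat l (φ x)) :
    Φ.threeMap k i j ≫ Φ.faceMap (k + 1) m = Φ.twoMap k l := by
  have hφ : ∀ x, x < k + 3 → φ x ≤ k + 1 := by
    intro x hx
    rcases Nat.lt_or_ge 2 x with h | h
    · rw [h1 x h]; omega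
    · have := h0 x h; omega
  have hφ' : ∀ x : Fin (k + 1 + 2), (clamp φ x : Fin (k + 1 + 1)).val = φ x := by
    intro x; have := hφ x x.isLt; simp only [clamp]; omega
  rw [threeMap_faceMap _ _ _ _ _ hij hj]
  unfold twoMap
  rw [← Φ.splitMap_two_funMap k 0 (clamp φ), Category.assoc, funMap_comp, clamp_comp hφ]
  · congr 2
    exact clamp_congr h
  · intro x hx; rw [hφ']; exact h0 _ hx
  · intro x hx; rw [hφ']; exact h1 _ hx
  · obtain ⟨x, hx, e⟩ := h2
    exact ⟨⟨x, by omega⟩, hx, by rw [hφ']; exact e⟩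
  · obtain ⟨x, hx, e⟩ := h3
    exact ⟨⟨x, by omega⟩, hx, by rw [hφ']; exact e⟩

/-- The signed sum of the operations `threeMap`. -/
noncomputable def threeSum (k : ℕ) : Φ.obj (k + 1) ⟶ Φ.obj (k + 3) :=
  ∑ j ∈ Finset.range (k + 1), ∑ i ∈ Finset.range (j + 1), ((-1 : ℤ) ^ (i + j)) • Φ.threeMap k i j

/-- The eight hypotheses of `sum_shuffle_faces` are commutativity at the second and the third copy,
the three ranges of faces that commute with splitting, and the three ways in which two copies meet.
-/
theorem threeSum_hochMap (k : ℕ) :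
    Φ.threeSum (k + 1) ≫ Φ.hochMap (k + 2) = Φ.hochMap k ≫ Φ.threeSum k +
      ∑ i ∈ Finset.range (k + 2), ((-1 : ℤ) ^ i) • Φ.twoMap (k + 1) i := by
  have key := sum_shuffle_faces (k + 1)
    (fun i j m => ((-1 : ℤ) ^ (i + j + m)) • (Φ.threeMap (k + 1) i j ≫ Φ.faceMap (k + 2) m))
    (fun i j m => ((-1 : ℤ) ^ (i + j + m)) • (Φ.faceMap k m ≫ Φ.threeMap k i j))
    (fun i => ((-1 : ℤ) ^ i) • Φ.twoMap (k + 1) i) ?_ ?_ ?_ ?_ ?_ ?_ ?_ ?_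
  · refine Eq.trans ?_ (key.trans ?_)
    · unfold threeSum hochMap
      rw [Preadditive.sum_comp]
      refine Finset.sum_congr rfl fun j _ => ?_
      rw [Preadditive.sum_comp]
      refine Finset.sum_congr rfl fun i _ => ?_
      rw [Preadditive.zsmul_comp, Preadditive.comp_sum, Finset.smul_sum]
      refine Finset.sum_congr rfl fun m _ => ?_
      rw [Preadditive.comp_zsmul, smul_smul, ← pow_add]
    · congr 1
      unfold threeSum hochMap
      rw [Preadditive.comp_sum]
      refine Finset.sum_congr rfl fun j _ => ?_
      rw [Preadditive.comp_sum]
      refine Finset.sum_congr rfl fun i _ => ?_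
      rw [Preadditive.comp_zsmul, Preadditive.sum_comp, Finset.smul_sum]
      refine Finset.sum_congr rfl fun m _ => ?_
      rw [Preadditive.zsmul_comp, smul_smul, ← pow_add]
  · intro i j hij hj
    rw [threeMap_faceMap _ _ _ _ _ (by omega) (by omega),
      threeMap_faceMap _ _ _ _ _ (by omega) (by omega), ← neg_smul,
      clamp_congr fun x _ => faceNat_threeNat_succ_left hij hj]
    congr 1
    ring
  · intro i j hij hj
    rw [threeMap_faceMap _ _ _ _ _ (by omega) (by omega),
      threeMap_faceMap _ _ _ _ _ (by omega) (by omega), ← neg_smul,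
      clamp_congr fun x _ => faceNat_threeNat_succ_right hij hj]
    congr 1
    ring
  · intro i j m hm hij hj
    rw [threeMap_faceMap _ _ _ _ _ (by omega) (by omega), faceMap_threeMap _ _ _ _ _ (by omega),
      clamp_congr fun x hx => faceNat_threeNat_left hm hij (by omega) hx]
    congr 1
    ring
  · intro i j m hm hij hj
    rw [threeMap_faceMap _ _ _ _ _ (by omega) (by omega), faceMap_threeMap _ _ _ _ _ (by omega),
      clamp_congr fun x hx => faceNat_threeNat_middle hm hij (by omega) hx]
    congr 1
    ring
  · intro i j m hij hjm hm
    rw [threeMap_faceMap _ _ _ _ _ (by omega) (by omega), faceMap_threeMap _ _ _ _ _ (by omega),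
      clamp_congr fun x hx => faceNat_threeNat_right hij hjm hm hx]
    congr 1
    ring
  · intro j hj
    simp only [zero_add, add_zero]
    rw [Φ.threeMap_faceMap_eq_twoMap (k + 1) 0 j 0 j (by omega) hj (fun x => x - 1)
      (fun x hx => by omega) (fun x _ => rfl) ⟨0, by omega, by omega⟩ ⟨2, by omega, by omega⟩
      fun x _ => faceNat_threeNat_zero]
  · intro j hj
    rw [← neg_smul, Φ.threeMap_faceMap_eq_twoMap (k + 1) j j (j + 1) j (by omega) hj
      (fun x => if x ≤ 1 then x else x - 1)
      (fun x hx => by grind) (fun x _ => by grind) ⟨0, by omega, by simp⟩ ⟨1, by omega, by simp⟩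
      fun x _ => faceNat_threeNat_self hj]
    congr 1
    rw [show j + j + (j + 1) = 2 * j + j + 1 by ring]
    simp [pow_add, pow_mul]
  · intro i hi
    rw [Φ.threeMap_faceMap_eq_twoMap (k + 1) i (k + 1) (k + 1 + 2) i (by omega) le_rfl
      (fun x => if x ≤ 1 then x else if x = 2 then 0 else x - 1)
      (fun x hx => by grind) (fun x _ => by grind) ⟨0, by omega, by simp⟩ ⟨1, by omega, by simp⟩
      fun x hx => faceNat_threeNat_last hi hx]
    congr 1
    rw [show i + (k + 1) + (k + 1 + 2) = i + 2 * (k + 2) by ring]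
    simp [pow_add, pow_mul]

end CFrPlusFunctor

/-! ### Positions under insertion of units -/

namespace LoopedDiagram

section

variable {k i j m x y : ℕ}

theorem faceNat_unitNat (hm : m ≤ k + 1) (hx : x < k + 3) :
    faceNat (k + 2) (m + 1) (unitNat (k + 1) x) = unitNat k (faceTwoNat k m x) := by
  simp only [faceNat, unitNat, faceTwoNat]
  grind (splits := 30)

theorem faceNat_zero_unitNat (hx : x < k + 2) :
    faceNat (k + 1) 0 (unitNat k x) = twoNat k x := by
  simp only [faceNat, unitNat, twoNat]
  grind

/-- The last copy is multiplied with the unit and comes to stand first, so the two copies arrive in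
exchanged order: this is the swap `1 - x`. -/
theorem faceNat_last_unitNat (hx : x < k + 2) :
    faceNat (k + 1) (k + 2) (unitNat k x) = twoNat 0 (if x ≤ 1 then 1 - x else x) := by
  simp only [faceNat, unitNat, twoNat]
  grind

/-- The unit sits at position `i + 1`, so it is absorbed by the faces `i` and `i + 1` alike. In the
next two lemmas the unit survives, at position `i` or `i + 1`. -/
theorem faceNat_degenNat_self (hx : x < k + 1) :
    faceNat k i (degenNat i x) = faceNat k (i + 1) (degenNat i x) := by
  simp only [faceNat, degenNat]
  grind

theorem faceNat_degenNat_of_lt (hm : m < i) (hi : i ≤ k) : faceNat k m (degenNat i x) ≠ i := by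
  simp only [faceNat, degenNat]
  grind

theorem faceNat_degenNat_of_gt (hm : i + 1 < m) (hx : x < k + 1) :
    faceNat k m (degenNat i x) ≠ i + 1 := by
  simp only [faceNat, degenNat]
  grind

theorem threeNat_injective (hij : i ≤ j) (h : threeNat i j x = threeNat i j y) : x = y := by
  simp only [threeNat] at h
  split_ifs at h <;> omega

theorem unitNat_injOn (hx : x < k + 2) (hy : y < k + 2)
    (h : unitNat k x = unitNat k y) : x = y := by
  simp only [unitNat] at h
  split_ifs at h <;> omega

end

end LoopedDiagram

/-! ### The homotopy identity between chain maps -/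

namespace CFrPlusFunctor

open LoopedDiagram

variable {R : Type u} [CommRing R] (Φ : CFrPlusFunctor.{u, v} R)

/-- Cocommutativity: `σ` permutes the outputs within each component, so neither the labels nor the
genera change. -/
theorem splitMap_funMap_perm (r k g : ℕ) (σ : Fin (k + 1 + r) → Fin (k + 1 + r))
    (hσ : Function.Surjective σ) (h : ∀ x, collapse r k (σ x) = collapse r k x) :
    Φ.splitMap r k g ≫ Φ.funMap σ = Φ.splitMap r k g := by
  refine Φ.map_single_comp _ _ _ (ofFun_compose_split_of_surjective r k _ g σ hσ _ h _ fun e => ?_)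
  rw [card_collapse r k fun u => u = e]
  simp [Finset.filter_eq', eq_comm (a := (0 : Fin (k + 1)))]
  split_ifs <;> omega

theorem unitMap_faceMap_zero (k : ℕ) : Φ.unitMap k ≫ Φ.faceMap (k + 1) 0 = Φ.twoMap k k := by
  rw [unitMap_faceMap, clamp_congr fun x hx => faceNat_zero_unitNat hx]
  rfl

theorem unitMap_faceMap_last (k : ℕ) :
    Φ.unitMap k ≫ Φ.faceMap (k + 1) (k + 2) = Φ.twoMap k 0 := by
  rw [unitMap_faceMap, clamp_congr fun x hx => faceNat_last_unitNat hx, ← clamp_comp (b := k + 1),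
    ← funMap_comp, ← Category.assoc, splitMap_funMap_perm]
  · rfl
  · intro y
    refine ⟨clamp (fun x => if x ≤ 1 then 1 - x else x) y, ?_⟩
    ext
    simp only [clamp]
    grind
  · intro x
    ext
    simp only [clamp, collapse]
    grind
  · grind

/-- The first and the last face absorb the unit and place the second copy after all other inputs or
before them. The inner faces are the faces of the original chain shifted by one, hence the minus
sign. -/
theorem unitMap_hochMap (k : ℕ) :
    Φ.unitMap (k + 1) ≫ Φ.hochMap (k + 2) = Φ.twoMap (k + 1) (k + 1) +
      ((-1 : ℤ) ^ (k + 1)) • Φ.twoMap (k + 1) 0 - Φ.hochMap k ≫ Φ.unitMap k := by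
  have e1 : ∀ m ∈ Finset.range (k + 2), ((-1 : ℤ) ^ (m + 1)) •
      (Φ.unitMap (k + 1) ≫ Φ.faceMap (k + 2) (m + 1)) =
      -((-1 : ℤ) ^ m • (Φ.faceMap k m ≫ Φ.unitMap k)) := by
    intro m hm
    have hm : m ≤ k + 1 := by simpa [Nat.lt_succ_iff] using hm
    rw [unitMap_faceMap, faceMap_unitMap _ _ _ hm,
      clamp_congr fun x hx => faceNat_unitNat hm hx, ← neg_smul]
    congr 1
    ring
  have e2 : Φ.unitMap (k + 1) ≫ Φ.faceMap (k + 2) (k + 3) = Φ.twoMap (k + 1) 0 :=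
    Φ.unitMap_faceMap_last (k + 1)
  unfold hochMap
  rw [Preadditive.comp_sum, Finset.sum_range_succ, Finset.sum_range_succ',
    Preadditive.sum_comp]
  simp only [Preadditive.comp_zsmul, Preadditive.zsmul_comp]
  rw [Finset.sum_congr rfl e1, Finset.sum_neg_distrib, unitMap_faceMap_zero, e2]
  rw [show ((-1 : ℤ) ^ (k + 3)) = (-1) ^ (k + 1) by ring, pow_zero, one_smul]
  abel

/-- The homotopy on `Φ(k + 1)`. -/
noncomputable def homotopyMap : ∀ k : ℕ, Φ.obj (k + 1) ⟶ Φ.obj (k + 3)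
  | 0 => 0
  | k + 1 => ((-1 : ℤ) ^ (k + 1)) • Φ.unitMap (k + 1) - Φ.threeSum (k + 1)

/-- The operation given by `μ ∘ Δ` on `Φ(k + 1)`. -/
noncomputable def muDeltaMap (k : ℕ) : Φ.obj (k + 1) ⟶ Φ.obj (k + 2) :=
  ∑ i ∈ Finset.range (k + 1), ((-1 : ℤ) ^ (k + i)) • Φ.twoMap k i - Φ.twoMap k k -
    ((-1 : ℤ) ^ k) • Φ.twoMap k 0 + if k = 0 then Φ.twoMap k 0 else 0

theorem muDeltaMap_zero : Φ.muDeltaMap 0 = 0 := by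
  simp [muDeltaMap]

theorem hochMap_zero : Φ.hochMap 0 = 0 := by
  have : Φ.faceMap 0 0 = Φ.faceMap 0 1 := congrArg Φ.funMap (funext fun x => Fin.ext (by omega))
  simp [hochMap, Finset.sum_range_succ, this]

/-- The exceptional value 0 of `homotopyMap 0` is invisible here, because the two faces on two
inputs agree by commutativity. -/
theorem hochMap_homotopyMap (k : ℕ) : Φ.hochMap k ≫ Φ.homotopyMap k =
    Φ.hochMap k ≫ (((-1 : ℤ) ^ k) • Φ.unitMap k - Φ.threeSum k) := by
  rcases k with _ | k
  · simp [hochMap_zero]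
  · rfl

/-- The boundary of `threeSum` produces the terms `twoMap (k + 1) i`, and that of `unitMap` the
corrections at both ends. The factor `(-1) ^ (k + 1)` compares the signs `(-1) ^ i` with the gluing
signs `(-1) ^ (k + 1 + i)`. -/
theorem homotopyMap_hochMap (k : ℕ) :
    Φ.homotopyMap (k + 1) ≫ Φ.hochMap (k + 2) - Φ.hochMap k ≫ Φ.homotopyMap k =
      -(((-1 : ℤ) ^ (k + 1)) • Φ.muDeltaMap (k + 1)) := by
  rw [hochMap_homotopyMap]
  unfold homotopyMap
  rw [Preadditive.sub_comp, threeSum_hochMap, Preadditive.zsmul_comp, unitMap_hochMap]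
  have e : ∑ i ∈ Finset.range (k + 2), ((-1 : ℤ) ^ i) • Φ.twoMap (k + 1) i =
      ((-1 : ℤ) ^ (k + 1)) •
        ∑ i ∈ Finset.range (k + 2), ((-1 : ℤ) ^ (k + 1 + i)) • Φ.twoMap (k + 1) i := by
    rw [Finset.smul_sum]
    refine Finset.sum_congr rfl fun i _ => ?_
    rw [smul_smul, ← pow_add]
    congr 1
    rw [show k + 1 + (k + 1 + i) = 2 * (k + 1) + i by ring]
    simp [pow_add, pow_mul]
  have hs : ((-1 : ℤ) ^ (k + 1)) * ((-1 : ℤ) ^ (k + 1)) = 1 := by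
    rw [← mul_pow]; simp
  rw [e]
  unfold muDeltaMap
  rw [if_neg (Nat.succ_ne_zero k), Preadditive.comp_sub, Preadditive.comp_zsmul]
  simp only [smul_sub, smul_add, smul_smul, hs, one_smul, add_zero,
    show ((-1 : ℤ) ^ k) = -((-1) ^ (k + 1)) by ring, neg_smul]
  abel

/-! ## Degenerate maps -/

/-- All values of the chain map are degenerate Hochschild chains. -/
def IsDegenerate {a n : ℕ} (g : Φ.obj a ⟶ Φ.obj (n + 1)) : Prop :=
  ∀ q (x : (Φ.obj a).X q), Φ.incl n q ((g.f q).hom x) ∈ Φ.degenerate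

variable {Φ}

theorem IsDegenerate.zero {a n : ℕ} : Φ.IsDegenerate (0 : Φ.obj a ⟶ Φ.obj (n + 1)) := by
  intro q x
  simp

theorem IsDegenerate.add {a n : ℕ} {g g' : Φ.obj a ⟶ Φ.obj (n + 1)} (h : Φ.IsDegenerate g)
    (h' : Φ.IsDegenerate g') : Φ.IsDegenerate (g + g') := by
  intro q x
  simpa using add_mem (h q x) (h' q x)

theorem IsDegenerate.zsmul {a n : ℕ} {g : Φ.obj a ⟶ Φ.obj (n + 1)} (c : ℤ)
    (h : Φ.IsDegenerate g) : Φ.IsDegenerate (c • g) := by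
  intro q x
  simpa using zsmul_mem (h q x) c

theorem IsDegenerate.sub {a n : ℕ} {g g' : Φ.obj a ⟶ Φ.obj (n + 1)} (h : Φ.IsDegenerate g)
    (h' : Φ.IsDegenerate g') : Φ.IsDegenerate (g - g') := by
  intro q x
  simpa using sub_mem (h q x) (h' q x)

theorem IsDegenerate.sum {a n : ℕ} {ι : Type*} {s : Finset ι} {g : ι → (Φ.obj a ⟶ Φ.obj (n + 1))}
    (h : ∀ i ∈ s, Φ.IsDegenerate (g i)) : Φ.IsDegenerate (∑ i ∈ s, g i) :=
  Finset.sum_induction _ _ (fun _ _ => IsDegenerate.add) .zero h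

theorem IsDegenerate.comp {a b n : ℕ} {g : Φ.obj a ⟶ Φ.obj (n + 1)} (h : Φ.IsDegenerate g)
    (f : Φ.obj b ⟶ Φ.obj a) : Φ.IsDegenerate (f ≫ g) := by
  intro q x
  simpa using h q ((f.f q).hom x)

variable (Φ)

theorem isDegenerate_degen (k : ℕ) (i : Fin (k + 1)) : Φ.IsDegenerate (Φ.degen k i) := by
  intro q x
  have : LinearMap.range (Φ.incl (k + 1) q ∘ₗ ((Φ.degen k i).f q).hom) ≤ Φ.degenerate :=
    le_iSup_of_le k (le_iSup_of_le q (le_iSup_of_le i le_rfl))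
  exact this ⟨x, rfl⟩

/-- An output outside the image of `φ` receives a unit. If it is not the output 0, the map factors
through the degeneracy inserting a unit there. -/
theorem isDegenerate_funMap {a n : ℕ} (φ : Fin a → Fin (n + 1)) (p : ℕ) (hp : p ≠ 0) (hpn : p ≤ n)
    (h : ∀ x, (φ x).val ≠ p) : Φ.IsDegenerate (Φ.funMap φ) := by
  obtain ⟨n, rfl⟩ : ∃ n', n = n' + 1 := ⟨n - 1, by omega⟩
  let i : Fin (n + 1) := ⟨p - 1, by omega⟩
  have hi : ∀ x, ∃ z, Fin.succAbove i.succ z = φ x := fun x => Fin.exists_succAbove_eq (by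
    intro e
    apply h x
    rw [e]
    simp [i]
    omega)
  choose ψ hψ using hi
  have : Φ.funMap φ = Φ.funMap ψ ≫ Φ.degen n i := by
    rw [show Φ.degen n i = Φ.funMap (Fin.succAbove i.succ) from rfl, funMap_comp]
    exact congrArg Φ.funMap (funext fun x => (hψ x).symm)
  rw [this]
  exact (Φ.isDegenerate_degen n i).comp _

/-- The faces `i` and `i + 1` cancel, and in all others the unit survives at a position different
from 0. -/
theorem isDegenerate_degen_hochMap (k : ℕ) (i : Fin (k + 1)) :
    Φ.IsDegenerate (Φ.degen k i ≫ Φ.hochMap k) := by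
  have hi := i.isLt
  have e : ∀ m, Φ.degen k i ≫ Φ.faceMap k m =
      Φ.funMap (clamp fun x => faceNat k m (degenNat i x)) := by
    intro m
    rw [degen_eq_funMap, faceMap, funMap_comp, clamp_comp]
    intro x hx
    simp only [degenNat]
    split_ifs <;> omega
  unfold hochMap
  rw [Preadditive.comp_sum, ← Finset.add_sum_erase _ _ (a := (i : ℕ)) (by simp; omega),
    ← Finset.add_sum_erase _ _ (a := (i : ℕ) + 1) (by simp; omega)]
  simp only [Preadditive.comp_zsmul, e]
  rw [clamp_congr fun x hx => faceNat_degenNat_self hx, ← add_assoc, pow_succ, mul_neg_one,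
    neg_smul, add_neg_cancel, zero_add]
  refine IsDegenerate.sum fun m hm => IsDegenerate.zsmul _ ?_
  simp only [Finset.mem_erase, Finset.mem_range] at hm
  rcases Nat.lt_or_ge m i with h | h
  · refine Φ.isDegenerate_funMap _ i (by omega) (by omega) fun x => ?_
    have := @faceNat_degenNat_of_lt k i m x h (by omega)
    simp only [clamp]
    have := x.isLt
    have : faceNat k m (degenNat i x) ≤ k := by simp only [faceNat, degenNat]; grind
    omega
  · refine Φ.isDegenerate_funMap _ (i + 1) (by omega) (by omega) fun x => ?_
    have := @faceNat_degenNat_of_gt k i m x (by omega) x.isLt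
    simp only [clamp]
    have := x.isLt
    have : faceNat k m (degenNat i x) ≤ k := by simp only [faceNat, degenNat]; grind
    omega

theorem exists_degen_splitMap (r k g : ℕ) (i : Fin (k + 1)) :
    ∃ f : Fin (k + 1 + r) → Fin (k + 1 + 1 + r), (∀ x, (f x).val ≠ i + 1 + r) ∧
      Φ.degen k i ≫ Φ.splitMap r (k + 1) g = Φ.splitMap r k g ≫ Φ.funMap f := by
  have hi := i.isLt
  refine ⟨fun x => ⟨degenNat (i + r) x, ?_⟩, fun x => ?_, ?_⟩
  · simp only [degenNat]
    split_ifs <;> omega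
  · simp only [degenNat]
    split_ifs <;> omega
  · rw [degen_eq_funMap]
    refine Φ.funMap_splitMap r k (k + 1) g _ _ ?_ ?_ ?_
    · ext; simp [clamp, degenNat]
    · intro x hx
      simp only [degenNat]
      split_ifs <;> omega
    · intro x
      ext
      simp only [collapse, clamp, degenNat]
      grind

/-- After splitting, the unit is still a missed position, and the rearrangements `unitNat` and
`threeNat` are injective, so its image is missed as well. A degeneracy ends in at least two inputs,
hence the value at `k = 0` does not occur. -/
theorem isDegenerate_degen_homotopyMap (k : ℕ) (i : Fin (k + 1)) :
    Φ.IsDegenerate (Φ.degen k i ≫ Φ.homotopyMap (k + 1)) := by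
  have hi := i.isLt
  unfold homotopyMap threeSum
  rw [Preadditive.comp_sub, Preadditive.comp_zsmul, Preadditive.comp_sum]
  refine (IsDegenerate.zsmul _ ?_).sub (IsDegenerate.sum fun j hj => ?_)
  · obtain ⟨f, hf, e⟩ := Φ.exists_degen_splitMap 1 k 1 i
    unfold unitMap
    rw [← Category.assoc, e, Category.assoc, funMap_comp]
    refine IsDegenerate.comp (Φ.isDegenerate_funMap _ (unitNat (k + 1) (i + 1 + 1)) ?_ ?_ ?_) _
    · simp only [unitNat]; split_ifs <;> omega
    · simp only [unitNat]; split_ifs <;> omega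
    · intro x h
      refine hf x (unitNat_injOn (k := k + 1) (f x).isLt (by omega) ?_)
      have h2 : unitNat (k + 1) (f x) ≤ k + 1 + 2 := by
        have := (f x).isLt
        simp only [unitNat]; split_ifs <;> omega
      simpa [clamp, h2] using h
  · rw [Preadditive.comp_sum]
    refine IsDegenerate.sum fun l hl => ?_
    simp only [Finset.mem_range] at hj hl
    rw [Preadditive.comp_zsmul]
    refine IsDegenerate.zsmul _ ?_
    obtain ⟨f, hf, e⟩ := Φ.exists_degen_splitMap 2 k 0 i
    unfold threeMap
    rw [← Category.assoc, e, Category.assoc, funMap_comp]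
    refine IsDegenerate.comp (Φ.isDegenerate_funMap _ (threeNat l j (i + 1 + 2)) ?_ ?_ ?_) _
    · simp only [threeNat]; grind
    · simp only [threeNat]; grind
    · intro x h
      refine hf x (threeNat_injective (i := l) (j := j) (by omega) ?_)
      have h2 : threeNat l j (f x) ≤ k + 1 + 2 := by
        have := (f x).isLt
        simp only [threeNat]; split_ifs <;> omega
      simpa [clamp, h2] using h

/-! ## The homotopy on Hochschild chains -/

/-- The evaluation of chain maps at an element. -/
noncomputable def evalHom {a b : ℕ} (q : ℤ) (x : (Φ.obj a).X q) :
    (Φ.obj a ⟶ Φ.obj b) →+ (Φ.obj b).X q where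
  toFun f := (f.f q).hom x
  map_zero' := by simp
  map_add' f g := by simp

theorem evalHom_comp {a b c : ℕ} (q : ℤ) (x : (Φ.obj a).X q) (f : Φ.obj a ⟶ Φ.obj b)
    (g : Φ.obj b ⟶ Φ.obj c) :
    Φ.evalHom q x (f ≫ g) = (g.f q).hom ((f.f q).hom x) := by
  simp [evalHom]

theorem hochschildD_incl_zero (q : ℤ) (x : (Φ.obj (0 + 1)).X q) :
    Φ.hochschildD (Φ.incl 0 q x) = Φ.incl 0 (q - 1) (((Φ.obj (0 + 1)).d q (q - 1)).hom x) := by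
  simp [hochschildD, simplicialD]

theorem hochschildD_incl_succ (k : ℕ) (q : ℤ) (x : (Φ.obj (k + 1 + 1)).X q) :
    Φ.hochschildD (Φ.incl (k + 1) q x) =
      Φ.incl (k + 1) (q - 1) (((Φ.obj (k + 1 + 1)).d q (q - 1)).hom x) +
        (q.negOnePow : ℤ) • Φ.incl k q (((Φ.hochMap k).f q).hom x) := by
  have : ∑ i : Fin (k + 2), ((-1 : ℤ) ^ i.val) • (Φ.incl k q ∘ₗ ((Φ.face k i).f q).hom) =
      Φ.incl k q ∘ₗ ((Φ.hochMap k).f q).hom := by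
    refine LinearMap.ext fun x => ?_
    change _ = Φ.incl k q (Φ.evalHom q x (Φ.hochMap k))
    simp only [hochMap, ← Fin.sum_univ_eq_sum_range (fun m => ((-1 : ℤ) ^ m) • Φ.faceMap k m),
      map_sum, map_zsmul, LinearMap.sum_apply, LinearMap.smul_apply, face_eq_faceMap]
    rfl
  simp [hochschildD, simplicialD, this]

theorem hom_d_comm {a b : ℕ} (g : Φ.obj a ⟶ Φ.obj b) (q q' : ℤ) (x : (Φ.obj a).X q) :
    ((Φ.obj b).d q q').hom ((g.f q).hom x) = (g.f q').hom (((Φ.obj a).d q q').hom x) := by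
  exact LinearMap.congr_fun (ModuleCat.hom_ext_iff.1 (g.comm q q')) x

theorem hom_d_d {a : ℕ} (q q' q'' : ℤ) (x : (Φ.obj a).X q) :
    ((Φ.obj a).d q' q'').hom (((Φ.obj a).d q q').hom x) = 0 := by
  exact LinearMap.congr_fun (ModuleCat.hom_ext_iff.1 ((Φ.obj a).d_comp_d q q' q'')) x

theorem hochMap_hochMap_apply (k : ℕ) (q : ℤ) (x : (Φ.obj (k + 1 + 2)).X q) :
    ((Φ.hochMap k).f q).hom (((Φ.hochMap (k + 1)).f q).hom x) = 0 := by
  rw [← evalHom_comp, hochMap_hochMap, map_zero]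

theorem hochschildD_hochschildD (z : Φ.HochschildChains) :
    Φ.hochschildD (Φ.hochschildD z) = 0 := by
  suffices h : Φ.hochschildD ∘ₗ Φ.hochschildD = 0 from LinearMap.congr_fun h z
  refine DirectSum.linearMap_ext _ fun ⟨k, q⟩ => LinearMap.ext fun x => ?_
  change Φ.hochschildD (Φ.hochschildD (Φ.incl k q x)) = 0
  rcases k with _ | _ | k
  · rw [hochschildD_incl_zero, hochschildD_incl_zero, hom_d_d, map_zero]
  · rw [hochschildD_incl_succ, map_add, map_zsmul, hochschildD_incl_succ, hochschildD_incl_zero,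
      hom_d_d, map_zero, hom_d_comm, zero_add, ← add_smul, Int.negOnePow_sub]
    simp
  · rw [hochschildD_incl_succ, map_add, map_zsmul, hochschildD_incl_succ, hochschildD_incl_succ,
      hom_d_d, map_zero, hom_d_comm, zero_add, smul_add, hochMap_hochMap_apply, map_zero,
      smul_zero, smul_zero, add_zero, ← add_smul, Int.negOnePow_sub]
    simp

theorem hochschildD_mem_degenerate {z : Φ.HochschildChains} (hz : z ∈ Φ.degenerate) :
    Φ.hochschildD z ∈ Φ.degenerate := by
  suffices h : Φ.degenerate ≤ Φ.degenerate.comap Φ.hochschildD from h hz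
  refine iSup_le fun k => iSup_le fun q => iSup_le fun i => ?_
  rintro _ ⟨x, rfl⟩
  change Φ.hochschildD (Φ.incl (k + 1) q (((Φ.degen k i).f q).hom x)) ∈ Φ.degenerate
  rw [hochschildD_incl_succ, hom_d_comm]
  refine add_mem (Φ.isDegenerate_degen k i _ _) (zsmul_mem ?_ _)
  simpa using Φ.isDegenerate_degen_hochMap k i q x

/-- The homotopy. -/
noncomputable def homotopy : Φ.HochschildChains →ₗ[R] Φ.HochschildChains :=
  DirectSum.toModule R (ℕ × ℤ) _ fun kq =>
    ((-1 : ℤ) ^ kq.1 * (kq.2.negOnePow : ℤ)) •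
      (Φ.incl (kq.1 + 2) kq.2 ∘ₗ ((Φ.homotopyMap kq.1).f kq.2).hom)

/-- The operation given by `μ ∘ Δ`. -/
noncomputable def muDeltaOp : Φ.HochschildChains →ₗ[R] Φ.HochschildChains :=
  DirectSum.toModule R (ℕ × ℤ) _ fun kq =>
    Φ.incl (kq.1 + 1) kq.2 ∘ₗ ((Φ.muDeltaMap kq.1).f kq.2).hom

theorem homotopy_incl (k : ℕ) (q : ℤ) (x : (Φ.obj (k + 1)).X q) :
    Φ.homotopy (Φ.incl k q x) = ((-1 : ℤ) ^ k * (q.negOnePow : ℤ)) •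
      Φ.incl (k + 2) q (((Φ.homotopyMap k).f q).hom x) := by
  simp [homotopy]

theorem muDeltaOp_incl (k : ℕ) (q : ℤ) (x : (Φ.obj (k + 1)).X q) :
    Φ.muDeltaOp (Φ.incl k q x) = Φ.incl (k + 1) q (((Φ.muDeltaMap k).f q).hom x) := by
  simp [muDeltaOp]

theorem homotopy_mem_degenerate {z : Φ.HochschildChains} (hz : z ∈ Φ.degenerate) :
    Φ.homotopy z ∈ Φ.degenerate := by
  suffices h : Φ.degenerate ≤ Φ.degenerate.comap Φ.homotopy from h hz
  refine iSup_le fun k => iSup_le fun q => iSup_le fun i => ?_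
  rintro _ ⟨x, rfl⟩
  change Φ.homotopy (Φ.incl (k + 1) q (((Φ.degen k i).f q).hom x)) ∈ Φ.degenerate
  rw [homotopy_incl]
  refine zsmul_mem ?_ _
  simpa using Φ.isDegenerate_degen_homotopyMap k i q x

theorem homotopyMap_hochMap_apply (k : ℕ) (q : ℤ) (x : (Φ.obj (k + 1 + 1)).X q) :
    ((Φ.hochMap (k + 2)).f q).hom (((Φ.homotopyMap (k + 1)).f q).hom x) =
      ((Φ.homotopyMap k).f q).hom (((Φ.hochMap k).f q).hom x) -
        ((-1 : ℤ) ^ (k + 1)) • ((Φ.muDeltaMap (k + 1)).f q).hom x := by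
  have := congrArg (Φ.evalHom q x) (Φ.homotopyMap_hochMap k)
  rw [map_sub, evalHom_comp, evalHom_comp, map_neg, map_zsmul, sub_eq_iff_eq_add] at this
  rw [this]
  exact neg_add_eq_sub _ _

/-- The sign by total degree in `homotopy` cancels the internal differentials, with which all
structure maps commute, and turns the difference in `homotopyMap_hochMap` into a sum. -/
theorem muDeltaOp_eq (z : Φ.HochschildChains) :
    Φ.muDeltaOp z = -(Φ.hochschildD (Φ.homotopy z) + Φ.homotopy (Φ.hochschildD z)) := by
  suffices h : Φ.muDeltaOp = -(Φ.hochschildD ∘ₗ Φ.homotopy + Φ.homotopy ∘ₗ Φ.hochschildD) from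
    LinearMap.congr_fun h z
  refine DirectSum.linearMap_ext _ fun ⟨k, q⟩ => LinearMap.ext fun x => ?_
  change Φ.muDeltaOp (Φ.incl k q x) = -(Φ.hochschildD (Φ.homotopy (Φ.incl k q x)) +
    Φ.homotopy (Φ.hochschildD (Φ.incl k q x)))
  rcases k with _ | k
  · rw [muDeltaOp_incl, homotopy_incl, hochschildD_incl_zero, homotopy_incl, muDeltaMap_zero]
    simp [homotopyMap]
  · rw [muDeltaOp_incl, homotopy_incl, map_zsmul, hochschildD_incl_succ, hochschildD_incl_succ,
      map_add, map_zsmul, homotopy_incl, homotopy_incl, hom_d_comm, homotopyMap_hochMap_apply]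
    have hq : (q.negOnePow : ℤ) * q.negOnePow = 1 := by
      rw [← Units.val_mul, Int.units_mul_self, Units.val_one]
    have hk : ((-1 : ℤ) ^ k) * ((-1 : ℤ) ^ k) = 1 := by
      rw [← mul_pow]; simp
    have hq' : (((q - 1).negOnePow : ℤˣ) : ℤ) = -q.negOnePow := by
      rw [Int.negOnePow_sub]; simp
    rw [hq', map_sub, map_zsmul]
    simp only [smul_add, smul_sub, smul_smul]
    rw [show ((-1 : ℤ) ^ (k + 1) * q.negOnePow * (q.negOnePow * (-1) ^ (k + 1))) = 1 by
        linear_combination (-1 : ℤ) ^ (k + 1) * (-1) ^ (k + 1) * hq + hk,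
      show ((-1 : ℤ) ^ (k + 1) * -(q.negOnePow : ℤ)) = -((-1 : ℤ) ^ (k + 1) * q.negOnePow) by ring,
      show ((-1 : ℤ) ^ (k + 1) * q.negOnePow * q.negOnePow : ℤ) = -((-1) ^ k) by
        linear_combination (-1 : ℤ) ^ (k + 1) * hq,
      show ((q.negOnePow : ℤ) * ((-1 : ℤ) ^ k * q.negOnePow)) = ((-1) ^ k) by
        linear_combination (-1 : ℤ) ^ k * hq]
    simp only [neg_smul, one_smul]
    abel

/-- For a reduced cycle `z` the term `homotopy (hochschildD z)` is degenerate, so `muDeltaOp z` is a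
boundary up to degenerate chains. -/
theorem actsOnHomologyBy_muDeltaOp : Φ.ActsOnHomologyBy Φ.muDeltaOp 0 := by
  rintro ⟨z, hz⟩
  have hz' : Φ.homotopy (Φ.hochschildD z) ∈ Φ.degenerate := Φ.homotopy_mem_degenerate hz
  refine ⟨?_, ?_⟩
  · change Φ.hochschildD (Φ.muDeltaOp z) ∈ Φ.degenerate
    rw [muDeltaOp_eq, map_neg, map_add, hochschildD_hochschildD, zero_add]
    exact neg_mem (Φ.hochschildD_mem_degenerate hz')
  · rw [LinearMap.zero_apply, eq_comm, Submodule.Quotient.mk_eq_zero]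
    change Φ.muDeltaOp z ∈ Φ.boundaries
    rw [muDeltaOp_eq]
    exact neg_mem (Submodule.add_mem_sup ⟨_, rfl⟩ hz')

end CFrPlusFunctor

/-! ### Diagrams with one arc component, and positivity -/

namespace ArcSystem

variable {X Y : Type}

theorem ofLabelGenus_unit (f : X → Unit) (γ : Unit → ℕ) :
    ofLabelGenus f γ = single X (γ ()) := by
  rw [single_eq]

theorem join_eq_single (A : ArcSystem X) (a b : X) (h : ∀ x, A.rel x a ∨ A.rel x b)
    (hab : ¬ A.rel a b) (hA : A.closed = 0) : A.join a b = single X (A.genus a + A.genus b) := by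
  classical
  refine ArcSystem.ext (Setoid.ext fun x y => ⟨fun _ => trivial, fun _ => ?_⟩)
    (funext fun x => ?_) hA
  · have : ∀ z, (if A.rel z b then Quotient.mk A.rel a else Quotient.mk A.rel z) =
        Quotient.mk A.rel a := by
      intro z
      split_ifs with hz
      · rfl
      · exact Quotient.sound ((h z).resolve_right hz)
    change (if A.rel x b then Quotient.mk A.rel a else Quotient.mk A.rel x) =
      if A.rel y b then Quotient.mk A.rel a else Quotient.mk A.rel y
    rw [this, this]
  · simp only [join, if_neg hab, if_pos (h x), single]

theorem single_join (g : ℕ) (a b : X) : (single X g).join a b = single X (g + 1) := by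
  classical
  refine ArcSystem.ext (Setoid.ext fun x y => ⟨fun _ => trivial, fun _ => ?_⟩)
    (funext fun x => ?_) rfl
  · have : ∀ z, (single X g).rel z b := fun z => trivial
    change (if (single X g).rel x b then Quotient.mk (single X g).rel a
      else Quotient.mk (single X g).rel x) = if (single X g).rel y b
        then Quotient.mk (single X g).rel a else Quotient.mk (single X g).rel y
    rw [if_pos (this x), if_pos (this y)]
  · have h1 : (single X g).rel a b := trivial
    have h2 : (single X g).rel x a := trivial
    simp only [join, if_pos h1, if_pos h2]
    rfl

theorem single_comap [Fintype X] (g : ℕ) (f : Y → X) (y : Y) :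
    (single X g).comap f = single Y g := by
  rw [single_eq, comap_ofLabelGenus _ _ _ fun x => ⟨y, rfl⟩, ofLabelGenus_unit]

end ArcSystem

namespace LoopedDiagram

variable {p m n : ℕ}

/-- An oriented segment without the type of its index. -/
def segData {deg : Fin p → ℕ} (s : OrSegment deg) : Fin p × ℕ × Bool := (s.1.1, s.1.2.val, s.2)

theorem segData_injective {deg : Fin p → ℕ} :
    Function.Injective (segData : OrSegment deg → _) := by
  rintro ⟨⟨u, t⟩, ε⟩ ⟨⟨u', t'⟩, ε'⟩ h
  simp only [segData, Prod.mk.injEq] at h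
  obtain ⟨rfl, h, rfl⟩ := h
  rw [Fin.ext h]

/-- The degrees of the two diagrams need not agree definitionally, so loops are compared through
`segData`, whose type does not depend on the degrees. -/
theorem eq_of_single {Γ Γ' : LoopedDiagram p m n} (g : ℕ) (hdeg : ∀ u, Γ.deg u = Γ'.deg u)
    (h : Γ.arcs = ArcSystem.single _ g) (h' : Γ'.arcs = ArcSystem.single _ g)
    (hloop : ∀ i, (Γ.loop i).map segData = (Γ'.loop i).map segData) : Γ = Γ' := by
  obtain ⟨deg, arcs, loop⟩ := Γ
  obtain ⟨deg', arcs', loop'⟩ := Γ'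
  obtain rfl : deg = deg' := funext hdeg
  change arcs = ArcSystem.single (HalfEdge deg ⊕ _) g at h
  change arcs' = ArcSystem.single (HalfEdge deg ⊕ _) g at h'
  obtain rfl : loop = loop' := funext fun i => segData_injective.list_map (hloop i)
  rw [h, h']

theorem nondegenerate_of_single {Γ : LoopedDiagram p m n} {g : ℕ}
    (h : Γ.arcs = ArcSystem.single _ g) : Γ.Nondegenerate := by
  rintro ⟨v, t⟩ ht ⟨hx, -⟩
  have := hx (Sum.inl ⟨v, 0⟩) (by rw [h]; trivial)
  simp only [Sum.inl.injEq, Sigma.mk.injEq, heq_eq_eq, true_and] at this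
  exact ht this.symm

theorem gen_of_single {Γ : LoopedDiagram p m n} {g : ℕ} (h : Γ.arcs = ArcSystem.single _ g) :
    Γ.gen = Finsupp.single Γ 1 := by
  rw [gen, if_pos (nondegenerate_of_single h)]

theorem isPositive_of_single {n₁ m₁ n₂ m₂ : ℕ} {Γ : LoopedDiagram (n₂ + 1) (m₁ + m₂) n₁} {g : ℕ}
    (h : Γ.arcs = ArcSystem.single _ g) : Γ.IsPositive := by
  refine ⟨by rw [h]; rfl, fun x => Or.inl ⟨⟨0, 0⟩, by rw [h]; trivial⟩⟩

theorem gen_mem {n₁ m₁ n₂ m₂ : ℕ} {Γ : LoopedDiagram n₂ (m₁ + m₂) n₁} (h : Γ.IsLooped)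
    (h' : Γ.IsPositive) : Γ.gen ∈ lDPlus n₁ m₁ n₂ m₂ := by
  unfold gen
  split_ifs with hn
  · exact Submodule.subset_span ⟨Γ, h, hn, h', rfl⟩
  · exact zero_mem _

theorem isLoop_nil (Γ : LoopedDiagram p m n) (a : HalfEdge Γ.deg ⊕ Fin (n + m)) :
    Γ.IsLoop a [] :=
  ⟨fun _ h => absurd h (Option.not_mem_none _), fun _ h => absurd h (Option.not_mem_none _),
    List.isChain_nil⟩

theorem nonconst_mem {n₁ m₁ n₂ m₂ : ℕ} {Γ : LoopedDiagram n₂ (m₁ + m₂) n₁} (h : Γ.IsLooped)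
    (h' : Γ.IsPositive) : Γ.nonconst ∈ lDPlus n₁ m₁ n₂ m₂ := by
  refine Submodule.sum_mem _ fun T _ => Submodule.smul_mem _ _ (gen_mem (fun i => ?_) h')
  change Γ.IsLoop _ ((Γ.makeConst T).loop i)
  by_cases hi : i ∈ T
  · rw [show (Γ.makeConst T).loop i = [] from if_pos hi]
    exact isLoop_nil Γ _
  · rw [show (Γ.makeConst T).loop i = Γ.loop i from if_neg hi]
    exact h i

theorem muProd_mem : muProd ∈ lDPlus 2 0 1 0 := by
  refine nonconst_mem (fun i => ?_) (isPositive_of_single rfl)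
  refine ⟨fun _ _ => trivial, fun _ _ => trivial, ?_⟩
  fin_cases i <;> exact List.isChain_singleton _

theorem deltaCoprod_mem : deltaCoprod ∈ lDPlus 1 0 2 0 := by
  refine gen_mem (fun i => ?_) (isPositive_of_single rfl)
  refine ⟨fun _ _ => trivial, fun _ _ => trivial, ?_⟩
  fin_cases i
  refine List.isChain_cons_cons.2 ⟨⟨trivial, fun h => Bool.noConfusion (congrArg Prod.snd h : true = false)⟩, List.isChain_singleton _⟩

theorem threeDiagram_isLooped : threeDiagram.IsLooped := by
  intro i
  refine ⟨fun _ _ => trivial, fun _ _ => trivial, ?_⟩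
  fin_cases i
  exact List.isChain_cons_cons.2 ⟨⟨trivial, fun h => Bool.noConfusion (congrArg Prod.snd h : true = false)⟩,
    List.isChain_cons_cons.2 ⟨⟨trivial, fun h => Bool.noConfusion (congrArg Prod.snd h : true = false)⟩, List.isChain_singleton _⟩⟩

theorem unitDiagram_rel (x y : HalfEdge unitDiagram.deg ⊕ Fin (1 + (0 + 0))) :
    unitDiagram.arcs.rel x y ↔
      (x = Sum.inl ⟨0, (0 : Fin 3)⟩ ↔ y = Sum.inl ⟨0, (0 : Fin 3)⟩) :=
  ⟨fun h => iff_of_eq h, fun h => propext h⟩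

theorem unitDiagram_isLooped : unitDiagram.IsLooped := by
  intro i
  fin_cases i
  refine ⟨fun s hs => ?_, fun s hs => ?_, List.isChain_singleton _⟩
  · obtain rfl : (⟨0, (1 : Fin 3)⟩, true) = s := Option.some.inj hs
    exact (unitDiagram_rel _ _).2 (iff_of_false (by decide) (by decide))
  · obtain rfl : (⟨0, (1 : Fin 3)⟩, true) = s := Option.some.inj hs
    exact (unitDiagram_rel _ _).2 (iff_of_false (by decide) (by decide))

theorem unitDiagram_isPositive : IsPositive (m₁ := 0) (m₂ := 0) unitDiagram := by
  refine ⟨rfl, fun x => Or.inl ?_⟩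
  by_cases hx : x = Sum.inl ⟨0, (0 : Fin 3)⟩
  · exact ⟨_, (unitDiagram_rel _ _).2 (iff_of_true hx rfl)⟩
  · exact ⟨⟨0, (1 : Fin 3)⟩, (unitDiagram_rel _ _).2 (iff_of_false hx (by decide))⟩

theorem boundingElement_mem : boundingElement ∈ lDPlus 1 0 1 0 :=
  sub_mem (nonconst_mem unitDiagram_isLooped unitDiagram_isPositive)
    (nonconst_mem threeDiagram_isLooped (isPositive_of_single rfl))

theorem lDPlus_le_lD (n₁ m₁ n₂ m₂ : ℕ) : lDPlus n₁ m₁ n₂ m₂ ≤ lD n₁ m₁ n₂ m₂ :=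
  Submodule.span_mono fun _ ⟨Γ, h, h', _, e⟩ => ⟨Γ, h, h', e⟩

/-- One white vertex with two half-edges, which together with the leaf form one arc component of
genus one, and the loop `L`. -/
def genusOne (L : List (OrSegment fun _ : Fin 1 => 1)) : LoopedDiagram 1 (0 + 0) 1 where
  deg := fun _ => 1
  arcs := ArcSystem.single _ 1
  loop := ![L]

/-! ### The boundary of the bounding element -/

theorem nonconst_eq (Γ : LoopedDiagram p m 1) : Γ.nonconst = Γ.gen - (Γ.makeConst {0}).gen := by
  have h : (Finset.univ : Finset (Finset (Fin 1))) = {∅, {0}} := by decide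
  have h' : Γ.makeConst ∅ = Γ := by simp [makeConst]
  rw [nonconst, h, Finset.sum_insert (by decide), Finset.sum_singleton, h']
  simp [sub_eq_add_neg]

theorem boundary_eq (Γ : LoopedDiagram 1 m n) (h : Γ.deg 0 ≠ 0) :
    Γ.boundary = ∑ i : Fin (Γ.deg 0 + 1), ((-1 : ℤ) ^ (1 + i.val)) • (Γ.blowUp 0 i h).gen := by
  unfold boundary
  rw [Fin.sum_univ_one]
  refine Finset.sum_congr rfl fun i _ => ?_
  rw [dif_neg h, show Finset.Iio (0 : Fin 1) = ∅ by decide, Finset.sum_empty, add_zero]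

theorem d_gen_of_nondegenerate {Γ : LoopedDiagram p m n} (h : Γ.Nondegenerate) :
    lD.d Γ.gen = Γ.boundary := by
  rw [gen, if_pos h, lD.d, Finsupp.linearCombination_single, one_smul]

theorem blowUp_gen_eq {Γ : LoopedDiagram 1 (0 + 0) 1} (hdeg : Γ.deg 0 = 2) (i : Fin (Γ.deg 0 + 1))
    (hv : Γ.deg 0 ≠ 0) (L : List (OrSegment fun _ : Fin 1 => 1))
    (h : Γ.arcs.join (Sum.inl ⟨0, i⟩) (Sum.inl ⟨0, i + 1⟩) = ArcSystem.single _ 1)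
    (hL : ((Γ.blowUp 0 i hv).loop 0).map segData = L.map segData) :
    (Γ.blowUp 0 i hv).gen = Finsupp.single (genusOne L) 1 := by
  have h1 : (Γ.blowUp 0 i hv).arcs = ArcSystem.single _ 1 := by
    unfold blowUp
    rw [h]
    exact ArcSystem.single_comap _ _ (Sum.inr 0)
  rw [gen_of_single h1]
  congr 1
  refine eq_of_single 1 (fun u => ?_) h1 rfl fun j => ?_
  · obtain rfl : u = 0 := Subsingleton.elim _ _
    simp [blowUp, blowDeg, genusOne, hdeg]
  · obtain rfl : j = 0 := Subsingleton.elim _ _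
    exact hL

/-- The two segments of `genusOne L`. -/
abbrev seg (i : Fin 2) : OrSegment fun _ : Fin 1 => 1 := (⟨0, i⟩, true)

/-- Each blow-up joins two ends of the only component, raising its genus, and drops one of the three
segments of the loop. The three results coincide, and their signs -, +, - add up to -1. -/
theorem boundary_threeDiagram : threeDiagram.boundary =
    -Finsupp.single (genusOne [seg 0, seg 1]) 1 := by
  have h : threeDiagram.deg 0 ≠ 0 := by decide
  have h1 : ∀ i, (threeDiagram.blowUp 0 i h).gen = Finsupp.single (genusOne [seg 0, seg 1]) 1 := by
    intro i
    refine blowUp_gen_eq rfl _ _ _ (ArcSystem.single_join _ _ _) ?_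
    change Fin 3 at i
    fin_cases i <;> rfl
  rw [boundary_eq _ h]
  simp only [h1]
  change ∑ i : Fin 3, _ = _
  rw [Fin.sum_univ_three]
  simp

theorem boundary_threeDiagram_makeConst : (threeDiagram.makeConst {0}).boundary =
    -Finsupp.single (genusOne []) 1 := by
  have h : (threeDiagram.makeConst {0}).deg 0 ≠ 0 := by decide
  have h1 : ∀ i, ((threeDiagram.makeConst {0}).blowUp 0 i h).gen =
      Finsupp.single (genusOne []) 1 := by
    intro i
    exact blowUp_gen_eq rfl _ _ _ (ArcSystem.single_join _ _ _) rfl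
  rw [boundary_eq _ h]
  simp only [h1]
  change ∑ i : Fin 3, _ = _
  rw [Fin.sum_univ_three]
  simp

theorem unitDiagram_join_zero : unitDiagram.arcs.join (Sum.inl ⟨0, (0 : Fin 3)⟩)
    (Sum.inl ⟨0, (1 : Fin 3)⟩) = ArcSystem.single _ 1 := by
  rw [ArcSystem.join_eq_single]
  · congr 1
  · intro x
    rw [unitDiagram_rel, unitDiagram_rel]
    by_cases hx : x = Sum.inl ⟨0, (0 : Fin 3)⟩
    · exact Or.inl (iff_of_true hx rfl)
    · exact Or.inr (iff_of_false hx (by decide))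
  · rw [unitDiagram_rel]
    exact fun h => absurd (h.1 rfl) (by decide)
  · rfl

theorem unitDiagram_join_two : unitDiagram.arcs.join (Sum.inl ⟨0, (2 : Fin 3)⟩)
    (Sum.inl ⟨0, (0 : Fin 3)⟩) = ArcSystem.single _ 1 := by
  rw [ArcSystem.join_eq_single]
  · congr 1
  · intro x
    rw [unitDiagram_rel, unitDiagram_rel]
    by_cases hx : x = Sum.inl ⟨0, (0 : Fin 3)⟩
    · exact Or.inr (iff_of_true hx rfl)
    · exact Or.inl (iff_of_false hx (by decide))
  · rw [unitDiagram_rel]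
    exact fun h => absurd (h.2 rfl) (by decide)
  · rfl

/-- Blowing up next to the start half-edge absorbs the unit and leaves genus one; the segment of the
loop becomes `seg 0` or `seg 1` depending on the side. -/
theorem boundary_unitDiagram_sub : unitDiagram.boundary - (unitDiagram.makeConst {0}).boundary =
    Finsupp.single (genusOne []) 1 + Finsupp.single (genusOne []) 1 -
      Finsupp.single (genusOne [seg 0]) 1 -
      Finsupp.single (genusOne [seg 1]) 1 := by
  have h : unitDiagram.deg 0 ≠ 0 := by decide
  have h' : (unitDiagram.makeConst {0}).deg 0 ≠ 0 := h
  rw [boundary_eq _ h, boundary_eq _ h']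
  change ∑ i : Fin 3, _ - ∑ i : Fin 3, _ = _
  rw [Fin.sum_univ_three, Fin.sum_univ_three]
  have a0 : (unitDiagram.blowUp 0 (0 : Fin 3) h).gen = Finsupp.single (genusOne [seg 0]) 1 :=
    blowUp_gen_eq rfl _ _ _ unitDiagram_join_zero rfl
  have a2 : (unitDiagram.blowUp 0 (2 : Fin 3) h).gen = Finsupp.single (genusOne [seg 1]) 1 :=
    blowUp_gen_eq rfl _ _ _ unitDiagram_join_two rfl
  have b0 : ((unitDiagram.makeConst {0}).blowUp 0 (0 : Fin 3) h').gen =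
      Finsupp.single (genusOne []) 1 :=
    blowUp_gen_eq rfl _ _ _ unitDiagram_join_zero rfl
  have b2 : ((unitDiagram.makeConst {0}).blowUp 0 (2 : Fin 3) h').gen =
      Finsupp.single (genusOne []) 1 :=
    blowUp_gen_eq rfl _ _ _ unitDiagram_join_two rfl
  -- The middle blow-up erases the only segment of the loop, so it agrees with that of the constant
  -- loop and drops out of the difference.
  have c : (unitDiagram.blowUp 0 (1 : Fin 3) h) =
      ((unitDiagram.makeConst {0}).blowUp 0 (1 : Fin 3) h') := by
    have : (unitDiagram.blowUp 0 (1 : Fin 3) h).loop =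
        ((unitDiagram.makeConst {0}).blowUp 0 (1 : Fin 3) h').loop := by
      funext j
      obtain rfl : j = 0 := Subsingleton.elim _ _
      rfl
    exact congrArg (fun l => LoopedDiagram.mk _ (unitDiagram.blowUp 0 (1 : Fin 3) h).arcs l) this
  rw [a0, a2, b0, b2, c]
  simp
  abel

theorem d_boundingElement : lD.d boundingElement =
    Finsupp.single (genusOne [seg 0, seg 1]) 1 - Finsupp.single (genusOne [seg 0]) 1 -
      Finsupp.single (genusOne [seg 1]) 1 + Finsupp.single (genusOne []) 1 := by
  -- The half-edges other than the start lie on the component of genus one. The argument concerns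
  -- only the arcs and so also serves the diagram with constant loop.
  have hu : unitDiagram.Nondegenerate := by
    intro h hh hu
    have h0 : Sum.inl h ≠ (Sum.inl ⟨0, (0 : Fin 3)⟩ :
        HalfEdge unitDiagram.deg ⊕ Fin (1 + (0 + 0))) := by
      intro e
      exact hh (by rw [Sum.inl.inj e]; rfl)
    have h1 : unitDiagram.arcs.genus (Sum.inl h) = 1 := if_neg h0
    rw [hu.2] at h1
    exact absurd h1 (by decide)
  rw [boundingElement, nonconst_eq, nonconst_eq, map_sub, map_sub, map_sub,
    d_gen_of_nondegenerate hu, d_gen_of_nondegenerate (Γ := unitDiagram.makeConst {0}) hu,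
    d_gen_of_nondegenerate (nondegenerate_of_single rfl),
    d_gen_of_nondegenerate (nondegenerate_of_single rfl), boundary_unitDiagram_sub,
    boundary_threeDiagram, boundary_threeDiagram_makeConst]
  abel

/-! ### The composite of the product and the coproduct -/

theorem filter_finRange_eq {N i : ℕ} (hN : N = 2) (hi : i < 2) (P : Fin N → Prop) [DecidablePred P]
    (hP : ∀ r, P r ↔ r.val = i) :
    ((List.finRange N).filter fun r => P r).map Fin.val = [i] := by
  subst hN
  have : List.finRange 2 = [0, 1] := rfl
  rw [this, List.filter_cons, List.filter_cons]
  simp only [hP, decide_eq_true_eq]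
  have : i = 0 ∨ i = 1 := by omega
  rcases this with rfl | rfl <;> simp

/-- No half-edges are attached, so no segment of `y` is subdivided and the vertex `i` of `Δ` is
traced out by the whole loop `i` of `y`. -/
theorem path_deltaDiagram {y : LoopedDiagram 1 (0 + 0) 2} (hdeg : ∀ u, y.deg u = 1)
    (hpos : ∀ i, ∀ s ∈ y.loop i, s.2 = true)
    {w : Passage (m₁ := 0) (m₂ := 0) (m₃ := 0) y deltaDiagram} (hw : ∀ u, w.deg u = 1)
    (π : Position w) (i : Fin 2) :
    (π.path i 0).map segData = (y.loop i).map segData := by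
  have h1 : ∀ u r, r < 2 → π.segOf u r = r := by
    intro u r hr
    have hlt : ∀ t, (π (Sum.inr ⟨u, t⟩)).2.val = 0 := by
      intro t
      have := (π (Sum.inr ⟨u, t⟩)).2.isLt
      have := hw (π (Sum.inr ⟨u, t⟩)).1
      omega
    unfold Position.segOf
    simp only [hlt]
    rcases Nat.eq_zero_or_pos r with rfl | h
    · simp
    · simp [h, hdeg]
      omega
  have h2 : ∀ q r, π.passed i q r = 0 := by
    intro q r
    exact Finset.card_eq_zero.2 (Finset.eq_empty_of_isEmpty (α := Fin 0) _)
  unfold Position.path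
  rw [List.map_flatMap]
  have h3 : ∀ q : Fin (y.loop i).length, List.map segData
      (let s := (y.loop i).get q
      let l := (List.finRange (w.deg s.1.1 + 1)).filter fun r =>
        π.segOf s.1.1 r.val = s.1.2.val ∧ π.passed i q r.val = 0
      if s.2 then l.map fun r => ((⟨s.1.1, r⟩, true) : OrSegment w.deg)
        else l.reverse.map fun r => (⟨s.1.1, r⟩, false)) = [segData ((y.loop i).get q)] := by
    intro q
    have hp : ((y.loop i).get q).2 = true := hpos i _ (List.get_mem _ _)
    generalize (y.loop i).get q = s at hp ⊢
    obtain ⟨⟨u, t⟩, ε⟩ := s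
    obtain rfl : ε = true := hp
    have ht : t.val < 2 := by have := t.isLt; have := hdeg u; omega
    have h4 := filter_finRange_eq (N := w.deg u + 1) (by rw [hw]) ht
      (fun r => π.segOf u r.val = t.val ∧ π.passed i q r.val = 0)
      (fun r => by
        have : r.val < 2 := by have := r.isLt; have := hw u; omega
        rw [h1 u r this, h2]; simp)
    simp only [if_true, List.map_map]
    have h5 := congrArg (List.map fun r => ((u, r, true) : Fin 1 × ℕ × Bool)) h4
    rw [List.map_map] at h5
    exact h5
  rw [show (fun q => List.map segData _) = fun q => [segData ((y.loop i).get q)] from funext h3,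
    ← List.map_eq_flatMap]
  conv_rhs => rw [← List.map_get_finRange (y.loop i), List.map_map]
  rfl

/-- Two components of genus zero and two connecting edges: genus minus one equals -1 - 1 + 2 = 0. -/
theorem glue_arcs_deltaDiagram {y : LoopedDiagram 1 (0 + 0) 2}
    (hy : y.arcs = ArcSystem.single _ 0)
    {w : Passage (m₁ := 0) (m₂ := 0) (m₃ := 0) y deltaDiagram} (π : Position w) :
    π.glue.arcs = ArcSystem.single _ 1 := by
  have hx : deltaDiagram.arcs = ArcSystem.single _ 0 := rfl
  unfold Position.glue
  rw [hx, hy, ArcSystem.single_eq, ArcSystem.single_eq, ArcSystem.sum_ofLabelGenus,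
    ArcSystem.joinList_ofLabelGenus (fun _ => ()) _ _ _ (fun _ => 1)]
  · rw [ArcSystem.comap_ofLabelGenus, ArcSystem.ofLabelGenus_unit]
    exact fun _ => ⟨Sum.inl ⟨0, 0⟩, rfl⟩
  · rintro (_ | _)
    · exact ⟨Sum.inl (Sum.inr 0), rfl⟩
    · exact ⟨Sum.inr (Sum.inr 0), rfl⟩
  · intro _ _; rfl
  · intro r hr
    have h : r (Sum.inl ()) (Sum.inr ()) := hr _ (List.mem_append_left _
      (List.mem_map_of_mem (List.mem_finRange (0 : Fin 2))))
    rintro (_ | _) (_ | _) _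
    · exact r.refl _
    · exact h
    · exact r.symm h
    · exact r.refl _
  · intro e
    simp [gluedPairs, Function.comp_def, List.map_const']

theorem compose_deltaDiagram (y : LoopedDiagram 1 (0 + 0) 2) (hdeg : ∀ u, y.deg u = 1)
    (hy : y.arcs = ArcSystem.single _ 0) (L : List (OrSegment fun _ : Fin 1 => 1))
    (hpos : ∀ i, ∀ s ∈ y.loop i, s.2 = true)
    (hL : (y.loop 0).map segData ++ (y.loop 1).map segData = L.map segData) :
    compose (m₁ := 0) (m₂ := 0) (m₃ := 0) y deltaDiagram = Finsupp.single (genusOne L) 1 := by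
  classical
  let w : Passage (m₁ := 0) (m₂ := 0) (m₃ := 0) y deltaDiagram := fun i j => j.elim0
  have hx : IsEmpty (FreeHalfEdge deltaDiagram.deg) := ⟨fun e => e.2.elim0⟩
  have hw : ∀ u, w.deg u = 1 := by
    intro u
    unfold Passage.deg
    rw [Finset.card_eq_zero.2 (Finset.eq_empty_of_isEmpty _), hdeg]
  have hsub : ∀ e e' : FreeHalfEdge w.deg, e = e' := by
    rintro ⟨u, t⟩ ⟨u', t'⟩
    obtain rfl : u = u' := Subsingleton.elim _ _
    have := hw u
    rw [show t = t' from Fin.ext (by omega)]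
  have hsub' : ∀ e e' : FreeHalfEdge deltaDiagram.deg ⊕ FreeHalfEdge y.deg, e = e' := by
    rintro (e | ⟨u, t⟩) (e' | ⟨u', t'⟩)
    · exact hx.elim e
    · exact hx.elim e
    · exact hx.elim e'
    obtain rfl : u = u' := Subsingleton.elim _ _
    have := hdeg u
    rw [show t = t' from Fin.ext (by omega)]
  let π : Position w :=
    { toFun := fun _ => ⟨0, ⟨0, by rw [hw]; exact one_pos⟩⟩
      invFun := fun _ => Sum.inr ⟨0, ⟨0, by rw [hdeg]; exact one_pos⟩⟩
      left_inv := fun _ => hsub' _ _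
      right_inv := fun _ => hsub _ _ }
  have hglue : π.glue = genusOne L := by
    refine eq_of_single 1 hw (glue_arcs_deltaDiagram hy π) rfl fun i => ?_
    obtain rfl : i = 0 := Subsingleton.elim _ _
    change ((π.path 0 0 ++ (π.path 1 0 ++ [])).map segData) = _
    rw [List.append_nil, List.map_append, path_deltaDiagram hdeg hpos hw,
      path_deltaDiagram hdeg hpos hw, hL]
    rfl
  unfold compose
  rw [Fintype.sum_eq_single w fun w' h => (h (funext fun i => funext fun j => j.elim0)).elim,
    Fintype.sum_eq_single π fun π' h => (h (Equiv.ext fun e => hsub _ _)).elim, if_pos, hglue,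
    gen_of_single (Γ := genusOne L) rfl, Position.sign, Finset.card_eq_zero.2, pow_zero, one_smul]
  · refine Finset.filter_eq_empty_iff.2 fun q _ h => ?_
    have h1 := h.2
    rw [hsub (π q.2) (π q.1)] at h1
    exact irrefl_of (freeLt w.deg) _ h1
  · refine ⟨fun i a => a.elim0, fun u t => Subsingleton.elim _ _, fun u t t' h => ?_,
      fun e => hx.elim e, fun i a => a.elim0⟩
    have := hdeg u
    have := t.isLt
    have := t'.isLt
    rw [Fin.lt_def] at h
    omega

theorem comp_muProd_deltaCoprod :
    lD.comp (m₁ := 0) (m₂ := 0) (m₃ := 0) muProd deltaCoprod =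
    Finsupp.single (genusOne [seg 0, seg 1]) 1 - Finsupp.single (genusOne [seg 0]) 1 -
      Finsupp.single (genusOne [seg 1]) 1 + Finsupp.single (genusOne []) 1 := by
  have h : (Finset.univ : Finset (Finset (Fin 2))) = {∅, {0}, {1}, {0, 1}} := by decide
  have hc : ∀ y : Chains 1 (0 + 0) 2,
      lD.comp (m₁ := 0) (m₂ := 0) (m₃ := 0) y (Finsupp.single deltaDiagram 1) =
      Finsupp.linearCombination ℤ
        (fun Γ => compose (m₁ := 0) (m₂ := 0) (m₃ := 0) Γ deltaDiagram) y := by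
    intro y
    simp [lD.comp, Finsupp.linearCombination_apply]
  have hm : ∀ T L, (((muDiagram.makeConst T).loop 0).map segData ++
      ((muDiagram.makeConst T).loop 1).map segData = L.map segData) →
      Finsupp.linearCombination ℤ
        (fun Γ => compose (m₁ := 0) (m₂ := 0) (m₃ := 0) Γ deltaDiagram)
        (muDiagram.makeConst T).gen = Finsupp.single (genusOne L) 1 := by
    intro T L hL
    rw [gen_of_single (Γ := muDiagram.makeConst T) rfl, Finsupp.linearCombination_single, one_smul]
    refine compose_deltaDiagram _ (fun _ => rfl) rfl L (fun i s hs => ?_) hL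
    by_cases hi : i ∈ T
    · rw [show (muDiagram.makeConst T).loop i = [] from if_pos hi] at hs
      cases hs
    · rw [show (muDiagram.makeConst T).loop i = muDiagram.loop i from if_neg hi] at hs
      fin_cases i <;> (obtain rfl := List.mem_singleton.1 hs; rfl)
  rw [deltaCoprod, gen_of_single (Γ := deltaDiagram) rfl, hc, muProd, nonconst, map_sum, h,
    Finset.sum_insert (by decide), Finset.sum_insert (by decide), Finset.sum_insert (by decide),
    Finset.sum_singleton]
  simp only [map_smul]
  -- The loops with index in `T` become empty, so only the segments of the other loops remain.
  rw [hm ∅ [seg 0, seg 1] rfl, hm {0} [seg 1] rfl, hm {1} [seg 0] rfl, hm {0, 1} [] rfl]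
  simp
  abel

/-! ### The action of diagrams with one white vertex of degree one -/

/-- The labels of the outputs after splitting the first input through an arc component and moving
the second copy behind the input `i`. -/
def twoLabel {k : ℕ} (i : Fin (k + 1)) : Fin (k + 1 + 1) → Fin (k + 1) :=
  Fin.cases 0 (i.insertNth (α := fun _ => Fin (k + 1)) 0 Fin.succ)

section

variable {k : ℕ} (i : Fin (k + 1))

theorem twoLabel_zero : twoLabel i 0 = 0 := rfl

theorem twoLabel_self : twoLabel i i.succ = 0 := by
  simp [twoLabel]

theorem twoLabel_succAbove (a : Fin k) : twoLabel i (i.succAbove a).succ = a.succ := by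
  simp [twoLabel]

theorem twoLabel_surjective : Function.Surjective (twoLabel i) := by
  intro e
  cases e using Fin.cases with
  | zero => exact ⟨0, rfl⟩
  | succ a => exact ⟨_, twoLabel_succAbove i a⟩

theorem card_twoLabel (e : Fin (k + 1)) :
    (Finset.univ.filter fun j => twoLabel i j = e).card = 1 + if e = 0 then 1 else 0 := by
  have h : ∑ u : Fin (k + 1), (if u = e then 1 else 0) = 1 := by simp
  rw [Fin.sum_univ_succ] at h
  rw [Finset.card_filter, Fin.sum_univ_succ, Fin.sum_univ_succAbove _ i, twoLabel_zero,
    twoLabel_self]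
  simp only [twoLabel_succAbove, eq_comm (a := e)]
  omega

theorem clamp_twoNat_zero : (clamp (twoNat i) : Fin (k + 1 + 1) → Fin (k + 1 + 1)) 0 = 0 := by
  ext; simp [clamp, twoNat]

theorem clamp_twoNat_one :
    (clamp (twoNat i) : Fin (k + 1 + 1) → Fin (k + 1 + 1)) (Fin.succ 0) = i.succ := by
  ext
  have := i.isLt
  simp [clamp, twoNat]
  omega

theorem clamp_twoNat_succ (a : Fin k) :
    (clamp (twoNat i) : Fin (k + 1 + 1) → Fin (k + 1 + 1)) a.succ.succ = (i.succAbove a).succ := by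
  ext
  have := a.isLt
  simp only [clamp, twoNat, Fin.val_succ, Fin.succAbove, Fin.lt_def, Fin.val_castSucc]
  split_ifs <;> simp at * <;> omega

/-- This rewrites `twoMap` as the action of a single cospan, the form in which gluings with a
corolla appear. -/
theorem ofFun_twoNat_compose_split :
    (ofFun (clamp (twoNat i) : Fin (k + 1 + 1) → Fin (k + 1 + 1))).compose (split 1 k 1) =
      Finsupp.single (cospan id (twoLabel i) fun e => if e = 0 then 1 else 0) 1 := by
  refine ofFun_compose_split_of_surjective 1 k _ 1 _ ?_ (twoLabel i) ?_ _ ?_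
  · intro j
    cases j using Fin.cases with
    | zero => exact ⟨0, clamp_twoNat_zero i⟩
    | succ j =>
      rcases Fin.eq_self_or_eq_succAbove i j with rfl | ⟨a, rfl⟩
      · exact ⟨_, clamp_twoNat_one _⟩
      · exact ⟨_, clamp_twoNat_succ _ a⟩
  · intro j
    cases j using Fin.cases with
    | zero => rw [clamp_twoNat_zero]; rfl
    | succ j =>
      cases j using Fin.cases with
      | zero => rw [clamp_twoNat_one, twoLabel_self]; rfl
      | succ a => rw [clamp_twoNat_succ, twoLabel_succAbove]; rfl
  · intro e
    rw [card_twoLabel]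
    split_ifs <;> rfl

end

end LoopedDiagram

namespace CFrPlusFunctor

open LoopedDiagram

variable {R : Type u} [CommRing R] (Φ : CFrPlusFunctor.{u, v} R)

theorem twoMap_eq {k : ℕ} (i : Fin (k + 1)) :
    Φ.twoMap k i = Φ.map ⟨_, cospan_mem id (fun e => if e = 0 then 1 else 0)
      (twoLabel_surjective i)⟩ :=
  Φ.map_single_comp _ _ _ (ofFun_twoNat_compose_split i)

/-- The degree of a glued vertex is known only up to a propositional equality, whence the cast on
the outputs. -/
theorem diagramOp_eq {k r : ℕ} (q : ℤ) {Γ : LoopedDiagram 1 ((k + 1) + 0) 0} (hr : Γ.deg 0 = r)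
    {C : Type} {f : Fin (k + 1) → C} {g : Fin (r + 1) → C} (hg : Function.Surjective g) (γ : C → ℕ)
    (hΓ : Γ.cut = cospan f (g ∘ Fin.cast (congrArg (· + 1) hr)) γ) :
    Φ.diagramOp k q Γ = Φ.incl r q ∘ₗ ((Φ.map ⟨_, cospan_mem f γ hg⟩).f q).hom := by
  subst hr
  have h : Finsupp.single Γ.cut 1 ∈ lDPlus 0 (k + 1) 0 (Γ.deg 0 + 1) := by
    rw [hΓ]; exact cospan_mem f γ hg
  rw [diagramOp, dif_pos h]
  have : Φ.map ⟨_, h⟩ = Φ.map ⟨_, cospan_mem f γ hg⟩ :=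
    congrArg Φ.map (Subtype.ext (congrArg (Finsupp.single · 1) hΓ))
  rw [this]

end CFrPlusFunctor

/-! ### Gluings of `genusOne L` with a corolla -/

namespace LoopedDiagram

section Gluing

variable {k : ℕ} {L : List (OrSegment fun _ : Fin 1 => 1)}
  {w : Passage (m₁ := k + 1) (m₂ := 0) (m₃ := 0) (genusOne L) (corolla k)}

theorem passage_deg (u : Fin 1) : w.deg u = k + 1 := by
  unfold Passage.deg
  rw [Finset.filter_true_of_mem fun e _ => Subsingleton.elim _ _, Finset.card_univ,
    Fintype.card_sigma]
  simp [genusOne, corolla, add_comm 1]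
  exact Fintype.card_fin k

/-- The position of a free half-edge of the corolla. -/
def Position.pos (π : Position w) (a : Fin k) : Fin (k + 1) :=
  Fin.cast (passage_deg _) (π (Sum.inl ⟨0, a⟩)).2

/-- The position of the free half-edge of `genusOne L`. -/
def Position.pivot (π : Position w) : Fin (k + 1) :=
  Fin.cast (passage_deg _) (π (Sum.inr ⟨0, (0 : Fin 1)⟩)).2

theorem freeLt_iff {deg : Fin 1 → ℕ} (e e' : FreeHalfEdge deg) :
    freeLt deg e e' ↔ e.2.val < e'.2.val := by
  obtain ⟨u, a⟩ := e
  obtain ⟨u', a'⟩ := e'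
  obtain rfl : u = u' := Subsingleton.elim _ _
  simp [freeLt, Sigma.lex_iff]

theorem FreeHalfEdge.ext_val {deg : Fin 1 → ℕ} {e e' : FreeHalfEdge deg}
    (h : e.2.val = e'.2.val) : e = e' := by
  obtain ⟨u, a⟩ := e
  obtain ⟨u', a'⟩ := e'
  obtain rfl : u = u' := Subsingleton.elim _ _
  rw [show a = a' from Fin.ext h]

theorem Position.cases_free (e : FreeHalfEdge (corolla k).deg ⊕ FreeHalfEdge (genusOne L).deg) :
    (∃ a : Fin k, e = Sum.inl ⟨0, a⟩) ∨ e = Sum.inr ⟨0, (0 : Fin 1)⟩ := by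
  rcases e with ⟨u, a⟩ | ⟨u, t⟩
  · obtain rfl : u = 0 := Subsingleton.elim _ _
    exact Or.inl ⟨a, rfl⟩
  · exact Or.inr (congrArg Sum.inr (FreeHalfEdge.ext_val (Nat.lt_one_iff.1 t.isLt)))

theorem Position.ext_pos {π π' : Position w} (h : ∀ a, π.pos a = π'.pos a)
    (h' : π.pivot = π'.pivot) : π = π' := by
  refine Equiv.ext fun e => FreeHalfEdge.ext_val ?_
  rcases Position.cases_free e with ⟨a, rfl⟩ | rfl
  · exact congrArg Fin.val (h a)
  · exact congrArg Fin.val h'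

theorem Position.segOf_eq (π : Position w) (u : Fin 1) (r : ℕ) :
    π.segOf u r = if π.pivot.val < r then 1 else 0 := by
  obtain rfl : u = 0 := Subsingleton.elim _ _
  unfold Position.segOf
  change (Finset.univ.filter fun t : Fin 1 => (π (Sum.inr ⟨0, t⟩)).2.val < r).card = _
  rw [Finset.card_filter, Fin.sum_univ_one]
  rfl

theorem Position.range_pos (π : Position w) : Set.range π.pos = {π.pivot}ᶜ := by
  ext r
  simp only [Set.mem_range, Set.mem_compl_iff, Set.mem_singleton_iff]
  constructor
  · rintro ⟨a, rfl⟩ h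
    have : π (Sum.inl ⟨0, a⟩) = π (Sum.inr ⟨0, (0 : Fin 1)⟩) :=
      FreeHalfEdge.ext_val (congrArg Fin.val h)
    exact Sum.inl_ne_inr (π.injective this)
  · intro h
    obtain ⟨e, he⟩ := π.surjective ⟨0, Fin.cast (passage_deg 0).symm r⟩
    have hv : (π e).2.val = r.val := by rw [he]; rfl
    rcases Position.cases_free e with ⟨a, rfl⟩ | rfl
    · exact ⟨a, Fin.ext hv⟩
    · exact (h (Fin.ext hv.symm)).elim

/-- The oriented segment of `genusOne L` along which a half-edge of the corolla is attached. -/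
abbrev Passage.segment (w : Passage (m₁ := k + 1) (m₂ := 0) (m₃ := 0) (genusOne L) (corolla k))
    (a : Fin k) : OrSegment fun _ : Fin 1 => 1 :=
  L.get (w 0 a)

/-- Along positive segments in increasing order the half-edges of the corolla keep their order. A
strictly increasing map whose range omits exactly the pivot is `succAbove`. -/
theorem pos_eq_of_isGluing (hpos : ∀ s ∈ L, s.2 = true)
    (hL : L.Pairwise fun s t => s.1.2 < t.1.2) {π : Position w} (h : IsGluing w π) :
    π.pos = π.pivot.succAbove := by
  refine (StrictMono.range_inj ?_ (Fin.strictMono_succAbove _)).1 ?_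
  · intro a b hab
    have h1 := (h.2.2.2.1 ⟨0, a⟩).2
    have h2 := (h.2.2.2.1 ⟨0, b⟩).2
    rw [Position.segOf_eq] at h1 h2
    change _ = (w.segment a).1.2.val at h1
    change _ = (w.segment b).1.2.val at h2
    change (if π.pivot.val < (π.pos a).val then 1 else 0) = _ at h1
    change (if π.pivot.val < (π.pos b).val then 1 else 0) = _ at h2
    rcases (h.1 0 hab.le).lt_or_eq with hw | hw
    · have h3 := List.pairwise_iff_get.1 hL _ _ hw
      change (w.segment a).1.2.val < (w.segment b).1.2.val at h3
      rw [Fin.lt_def]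
      split_ifs at h1 h2 <;> omega
    · have h3 := h.2.2.2.2 0 a b hab hw
      have hs : (w.seg ⟨0, a⟩).2 = true := hpos _ (List.get_mem _ _)
      rw [if_pos hs] at h3
      exact h3
  · rw [π.range_pos, Fin.range_succAbove]

theorem segment_of_isGluing (hpos : ∀ s ∈ L, s.2 = true)
    (hL : L.Pairwise fun s t => s.1.2 < t.1.2) {π : Position w} (h : IsGluing w π) (a : Fin k) :
    (w.segment a).1.2.val = if a.val < π.pivot.val then 0 else 1 := by
  have h1 := (h.2.2.2.1 ⟨0, a⟩).2
  rw [Position.segOf_eq] at h1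
  change (if π.pivot.val < (π.pos a).val then 1 else 0) = (w.segment a).1.2.val at h1
  rw [← h1, pos_eq_of_isGluing hpos hL h, Fin.succAbove]
  simp only [Fin.lt_def, Fin.val_castSucc]
  split_ifs <;> simp at * <;> omega

theorem card_filter_le (k i : ℕ) :
    (Finset.univ.filter fun a : Fin k => i ≤ a.val).card = k - i := by
  rw [Finset.card_filter, Fin.sum_univ_eq_sum_range (fun a => if i ≤ a then 1 else 0),
    ← Finset.card_filter, ← Nat.card_Ico i k]
  congr 1
  ext a
  simp [and_comm]

/-- The half-edges of the corolla come first and stay in order, so the inversions are the half-edges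
that end up behind the pivot. Their number `k - pivot` has the parity of `k + pivot`. -/
theorem sign_of_isGluing (hpos : ∀ s ∈ L, s.2 = true)
    (hL : L.Pairwise fun s t => s.1.2 < t.1.2) {π : Position w} (h : IsGluing w π) :
    π.sign = (-1) ^ (k + π.pivot.val) := by
  classical
  have hP := pos_eq_of_isGluing hpos hL h
  have h1 : (π.sign : ℤ) = (-1) ^ (k - π.pivot.val) := by
    unfold Position.sign
    rw [← card_filter_le]
    congr 1
    symm
    refine Finset.card_bij (fun a _ => (Sum.inl ⟨0, a⟩, Sum.inr ⟨0, (0 : Fin 1)⟩)) ?_ ?_ ?_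
    · intro a ha
      have ha' : π.pivot.val ≤ a.val := (Finset.mem_filter.1 ha).2
      refine Finset.mem_filter.2 ⟨Finset.mem_univ _, Sum.Lex.sep _ _, (freeLt_iff _ _).2 ?_⟩
      change π.pivot.val < (π.pos a).val
      rw [hP, Fin.succAbove_of_le_castSucc _ _ ha', Fin.val_succ]
      omega
    · intro a _ b _ hab
      exact eq_of_heq (Sigma.mk.inj (Sum.inl.inj (Prod.mk.inj hab).1)).2
    · rintro ⟨e, e'⟩ he
      obtain ⟨-, h2, h3⟩ := Finset.mem_filter.1 he
      rw [freeLt_iff] at h3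
      rcases Position.cases_free e with ⟨a, rfl⟩ | rfl <;>
        rcases Position.cases_free e' with ⟨b, rfl⟩ | rfl
      · change (π.pos b).val < (π.pos a).val at h3
        have h4 := (freeLt_iff _ _).1 (Sum.lex_inl_inl.1 h2)
        rw [hP] at h3
        exact (lt_asymm h3 (Fin.strictMono_succAbove _ h4)).elim
      · change π.pivot.val < (π.pos a).val at h3
        refine ⟨a, Finset.mem_filter.2 ⟨Finset.mem_univ _, ?_⟩, rfl⟩
        by_contra h4
        rw [hP, Fin.succAbove_of_castSucc_lt _ _ (not_le.1 h4)] at h3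
        exact h4 h3.le
      · exact (Sum.lex_inr_inl h2).elim
      · exact (lt_irrefl _ h3).elim
  have h2 := π.pivot.isLt
  rw [h1, show k + π.pivot.val = (k - π.pivot.val) + 2 * π.pivot.val by omega, pow_add, pow_mul]
  simp

/-- The label of an end of the corolla. -/
def corollaLabel (k : ℕ) : HalfEdge (corolla k).deg ⊕ Fin (0 + ((k + 1) + 0)) → Fin (k + 1) :=
  Sum.elim (fun h => h.2) (Fin.addCases (fun i => i.elim0) (Fin.addCases id (fun i => i.elim0)))

theorem corollaLabel_input (e : Fin (k + 1)) :
    corollaLabel k (Sum.inr (Fin.natAdd 0 (Fin.castAdd 0 e))) = e := by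
  change Fin.addCases (motive := fun _ => Fin (k + 1)) (fun i => i.elim0)
    (Fin.addCases (motive := fun _ => Fin (k + 1)) id (fun i => i.elim0))
    (Fin.natAdd 0 (Fin.castAdd 0 e)) = e
  rw [Fin.addCases_right, Fin.addCases_left, id]

theorem gen_corolla (k : ℕ) : (corolla k).gen = Finsupp.single (corolla k) 1 := by
  rw [gen, if_pos]
  rintro h - ⟨h1, -⟩
  have h2 := h1 (Sum.inr (Fin.natAdd 0 (Fin.castAdd 0 h.2)))
    (show corollaLabel k (Sum.inl h) = _ from (corollaLabel_input _).symm)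
  exact Sum.inr_ne_inl h2

/-- The label of an end of a gluing of `genusOne L` and a corolla. -/
def Position.label (π : Position w) :
    HalfEdge w.deg ⊕ Fin (0 + ((k + 1) + 0)) → Fin (k + 1) :=
  Sum.elim (corollaLabel k) (fun _ => 0) ∘ π.endOf

theorem Position.label_input (π : Position w) (e : Fin (k + 1)) :
    π.label (Sum.inr (Fin.natAdd 0 (Fin.castAdd 0 e))) = e := by
  unfold Position.label
  rw [Function.comp]
  refine (congrArg _ (π.endOf_input (c := 0) e)).trans ?_
  exact corollaLabel_input e

/-- A single edge joins the component of the first input to the component of genus one; it creates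
no cycle, so the genus stays one there and zero elsewhere. -/
theorem Position.arcs_glue (π : Position w) :
    π.glue.arcs = ArcSystem.ofLabelGenus π.label fun e => if e = 0 then 1 else 0 := by
  have hx : (corolla k).arcs = ArcSystem.ofLabelGenus (corollaLabel k) (fun _ => 0) := rfl
  have hy : (genusOne L).arcs = ArcSystem.single _ 1 := rfl
  unfold Position.glue
  rw [hx, hy, ArcSystem.single_eq, ArcSystem.sum_ofLabelGenus,
    ArcSystem.joinList_ofLabelGenus (Sum.elim id fun _ => 0) _ _ _
      (fun e : Fin (k + 1) => if e = 0 then 1 else 0)]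
  · rw [ArcSystem.comap_ofLabelGenus]
    · unfold Position.label
      refine congrArg (fun f => ArcSystem.ofLabelGenus f fun e => if e = 0 then 1 else 0) (funext fun z => ?_)
      change Sum.elim id (fun _ => 0) (Sum.map _ _ (π.endOf z)) = _
      rw [Function.comp]
      cases π.endOf z <;> rfl
    · intro z
      have h := π.label_input (Sum.elim (corollaLabel k) (fun _ => 0) z)
      refine ⟨Sum.inr (Fin.natAdd 0 (Fin.castAdd 0 (Sum.elim (corollaLabel k) (fun _ => 0) z))),
        Eq.trans ?_ (h.trans ?_)⟩
      · unfold Position.label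
        rw [Function.comp, Function.comp]
        cases π.endOf (Sum.inr (Fin.natAdd 0 (Fin.castAdd 0 _))) <;> rfl
      · cases z <;> rfl
  · rintro (e | _)
    · exact ⟨Sum.inl (Sum.inr _), congrArg Sum.inl (corollaLabel_input e)⟩
    · exact ⟨Sum.inr (Sum.inr 0), rfl⟩
  · intro e he
    obtain rfl := List.mem_singleton.1 (show e ∈ [_] from he)
    rfl
  · intro r hr
    have h0 : r (Sum.inl 0) (Sum.inr ()) := hr _ (List.mem_singleton.2 rfl)
    rintro (e | _) (e' | _) h
    · obtain rfl : e = e' := h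
      exact r.refl _
    · obtain rfl : e = 0 := h
      exact h0
    · obtain rfl : (0 : Fin (k + 1)) = e' := h
      exact r.symm h0
    · exact r.refl _
  · intro e
    have h1 : ∀ l : List ℤ, l = [if (0 : Fin (k + 1)) = e then 1 else 0] →
      l.sum = if (0 : Fin (k + 1)) = e then 1 else 0 := by rintro _ rfl; simp
    refine Eq.trans ?_ (congrArg (_ + ·) (h1 _ rfl).symm)
    rw [Finset.sum_filter, Fintype.sum_sum_type]
    by_cases he : e = 0
    · subst he; simp
    · simp [he, Ne.symm he]

theorem Position.gen_glue (π : Position w) : π.glue.gen = Finsupp.single π.glue 1 := by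
  rw [gen, if_pos]
  rintro h - ⟨h1, -⟩
  have h2 := h1 (Sum.inr (Fin.natAdd 0 (Fin.castAdd 0 (π.label (Sum.inl h)))))
    (by rw [π.arcs_glue]; exact (π.label_input _).symm)
  exact Sum.inr_ne_inl h2

theorem label_of_isGluing (hpos : ∀ s ∈ L, s.2 = true)
    (hL : L.Pairwise fun s t => s.1.2 < t.1.2) {π : Position w} (h : IsGluing w π)
    (t : Fin (w.deg 0 + 1)) :
    π.label (Sum.inl ⟨0, t⟩) =
      twoLabel π.pivot (Fin.cast (congrArg (· + 1) (passage_deg 0)) t) := by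
  have hP := pos_eq_of_isGluing hpos hL h
  cases t using Fin.cases with
  | zero => rfl
  | succ r =>
    obtain ⟨e, he⟩ := π.surjective ⟨0, r⟩
    have h1 : π.label (Sum.inl ⟨0, r.succ⟩) = Sum.elim (corollaLabel k) (fun _ => 0)
        (Sum.map Sum.inl Sum.inl (Sum.map
          (fun e => (⟨e.1, e.2.succ⟩ : HalfEdge (corolla k).deg))
          (fun e => (⟨e.1, e.2.succ⟩ : HalfEdge (genusOne L).deg))
          (π.symm ⟨0, r⟩))) := rfl
    rw [h1, ← he, Equiv.symm_apply_apply]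
    have h2 : (π e).2.val = r.val := by rw [he]
    rcases Position.cases_free e with ⟨a, rfl⟩ | rfl
    · have : Fin.cast (congrArg (· + 1) (passage_deg 0)) r.succ = (π.pos a).succ :=
        Fin.ext (congrArg (· + 1) h2.symm)
      rw [this, hP, twoLabel_succAbove]
      rfl
    · have : Fin.cast (congrArg (· + 1) (passage_deg 0)) r.succ = π.pivot.succ :=
        Fin.ext (congrArg (· + 1) h2.symm)
      rw [this, twoLabel_self]
      rfl

theorem cut_glue_of_isGluing (hpos : ∀ s ∈ L, s.2 = true)
    (hL : L.Pairwise fun s t => s.1.2 < t.1.2) {π : Position w} (h : IsGluing w π) :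
    cut (k := k + 1) π.glue = cospan id (twoLabel π.pivot ∘
      Fin.cast (congrArg (· + 1) (passage_deg 0))) fun e => if e = 0 then 1 else 0 := by
  let f : Fin (k + 1) → HalfEdge w.deg ⊕ Fin (0 + ((k + 1) + 0)) := fun i =>
    Sum.inr (Fin.natAdd 0 (Fin.castAdd 0 i))
  let g : Fin (w.deg 0 + 1) → HalfEdge w.deg ⊕ Fin (0 + ((k + 1) + 0)) := fun t => Sum.inl ⟨0, t⟩
  refine eq_cospan _ _ _ ((congrArg (fun A => ArcSystem.comap A _) π.arcs_glue).trans
    (ArcSystem.comap_ofLabelGenus _ _ _ ?_)) id Function.injective_id (fun e => ?_) (fun t => ?_)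
    fun _ => rfl
  rotate_left
  · exact (π.label_input e).symm.trans (congrArg π.label (endLabel_input f g e).symm)
  · exact (label_of_isGluing hpos hL h t).symm.trans
      (congrArg π.label (endLabel_output f g t).symm)
  · intro z
    refine ⟨Sum.inr (Fin.natAdd 0 (Fin.castAdd _ (π.label z))), ?_⟩
    exact (congrArg π.label (endLabel_input f g (π.label z))).trans (π.label_input _)

/-- The half-edges before `i` need `seg 0` and those from `i` on need `seg 1`; a gluing with pivot
`i` can be built once L contains the segments needed. -/
theorem exists_isGluing (hpos : ∀ s ∈ L, s.2 = true) (hL : L.Pairwise fun s t => s.1.2 < t.1.2)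
    (i : Fin (k + 1))
    (h : ∀ a : Fin k, ∃ s ∈ L, s.1.2.val = if a.val < i.val then 0 else 1) :
    ∃ (w : Passage (m₁ := k + 1) (m₂ := 0) (m₃ := 0) (genusOne L) (corolla k)) (π : Position w),
      IsGluing w π ∧ π.pivot = i := by
  have h' : ∀ a : Fin k, ∃ n, (L.get n).1.2.val = if a.val < i.val then 0 else 1 := by
    intro a
    obtain ⟨s, hs, hi⟩ := h a
    obtain ⟨n, rfl⟩ := List.get_of_mem hs
    exact ⟨n, hi⟩
  choose v hv using h'
  let w : Passage (m₁ := k + 1) (m₂ := 0) (m₃ := 0) (genusOne L) (corolla k) :=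
    fun u a => Fin.cast (by rw [Subsingleton.elim u 0]; rfl) (v a)
  -- `none` stands for the free half-edge of `genusOne L` and goes to `i`; the half-edges of the
  -- corolla fill the other positions in order.
  let e : Option (Fin k) ≃ FreeHalfEdge w.deg :=
    (finSuccEquiv' i).symm.trans ((finCongr (passage_deg _).symm).trans
      (Equiv.uniqueSigma fun u => Fin (w.deg u)).symm)
  let e' : FreeHalfEdge (corolla k).deg ⊕ FreeHalfEdge (genusOne L).deg ≃ Option (Fin k) :=
    (Equiv.sumCongr (Equiv.uniqueSigma fun _ : Fin 1 => Fin k)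
      ((Equiv.uniqueSigma fun _ : Fin 1 => Fin 1).trans (Equiv.equivPUnit.{1, 1} (Fin 1)))).trans
      (Equiv.optionEquivSumPUnit _).symm
  let π : Position w := e'.trans e
  have hpivot : π.pivot = i := rfl
  refine ⟨w, π, ⟨fun u a b hab => ?_, fun u t => Subsingleton.elim _ _, fun u t t' htt' => ?_,
    fun e => ⟨Subsingleton.elim _ _, ?_⟩, fun u a b hab _ => ?_⟩, hpivot⟩
  · obtain rfl : u = 0 := Subsingleton.elim _ _
    refine not_lt.1 fun hlt => ?_
    have h1 : (L.get (v b)).1.2.val < (L.get (v a)).1.2.val := List.pairwise_iff_get.1 hL _ _ hlt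
    have h2 : a.val ≤ b.val := hab
    have h3 := hv a
    have h4 := hv b
    split_ifs at h3 h4 <;> omega
  · have h1 := t.isLt
    have h2 := t'.isLt
    change t.val < 1 at h1
    change t'.val < 1 at h2
    rw [Fin.lt_def] at htt'
    omega
  · obtain ⟨u, a⟩ := e
    obtain rfl : u = 0 := Subsingleton.elim _ _
    change Fin k at a
    rw [Position.segOf_eq]
    change (if i.val < (i.succAbove a).val then 1 else 0) = (L.get (v a)).1.2.val
    rw [hv, Fin.succAbove]
    simp only [Fin.lt_def, Fin.val_castSucc]
    split_ifs <;> simp at * <;> omega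
  · obtain rfl : u = 0 := Subsingleton.elim _ _
    have hs : (w.seg ⟨0, a⟩).2 = true := hpos _ (List.get_mem _ _)
    rw [if_pos hs]
    exact Fin.strictMono_succAbove i hab

/-- The pivot determines the segment of each half-edge, and since segments do not repeat in L, also
its place in the loop; the positions are then forced. -/
theorem eq_of_isGluing (hpos : ∀ s ∈ L, s.2 = true) (hL : L.Pairwise fun s t => s.1.2 < t.1.2)
    (p p' : Σ w : Passage (m₁ := k + 1) (m₂ := 0) (m₃ := 0) (genusOne L) (corolla k), Position w)
    (h : IsGluing p.1 p.2) (h' : IsGluing p'.1 p'.2) (hp : p.2.pivot = p'.2.pivot) : p = p' := by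
  obtain ⟨w, π⟩ := p
  obtain ⟨w', π'⟩ := p'
  change π.pivot = π'.pivot at hp
  have hw : w = w' := by
    funext u a
    obtain rfl : u = 0 := Subsingleton.elim _ _
    have h1 := segment_of_isGluing hpos hL h a
    rw [hp, ← segment_of_isGluing hpos hL h' a] at h1
    change (w.segment a).1.2.val = (w'.segment a).1.2.val at h1
    rcases lt_trichotomy (w 0 a) (w' 0 a) with hlt | heq | hlt
    · have : (w.segment a).1.2.val < (w'.segment a).1.2.val :=
        List.pairwise_iff_get.1 hL _ _ hlt
      omega
    · exact heq
    · have : (w'.segment a).1.2.val < (w.segment a).1.2.val :=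
        List.pairwise_iff_get.1 hL _ _ hlt
      omega
  subst hw
  rw [Position.ext_pos (fun a => ?_) hp]
  rw [pos_eq_of_isGluing hpos hL h, pos_eq_of_isGluing hpos hL h', hp]

end Gluing

end LoopedDiagram

/-! ### The product of the coproduct as a Hochschild operation -/

namespace CFrPlusFunctor

open LoopedDiagram

variable {R : Type u} [CommRing R] (Φ : CFrPlusFunctor.{u, v} R)

/-- The operation on the summand `(k, q)` is additive in the diagrams. -/
noncomputable def operationHom (k : ℕ) (q : ℤ) (x : (Φ.obj (k + 1)).X q) :
    Chains 1 (0 + 0) 1 →ₗ[ℤ] Φ.HochschildChains :=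
  Finsupp.linearCombination ℤ fun Γ =>
    Finsupp.linearCombination ℤ (fun Γ' => Φ.diagramOp k q Γ' x)
      (compose (m₁ := k + 1) (m₂ := 0) (m₃ := 0) Γ (corolla k))

theorem operation_incl (G : Chains 1 (0 + 0) 1) (k : ℕ) (q : ℤ) (x : (Φ.obj (k + 1)).X q) :
    Φ.operation G (Φ.incl k q x) = Φ.operationHom k q x G := by
  have h : ∀ c : Chains 1 ((k + 1) + 0) 0, (c.sum fun Γ c => c • Φ.diagramOp k q Γ) x =
      Finsupp.linearCombination ℤ (fun Γ' => Φ.diagramOp k q Γ' x) c := by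
    intro c
    rw [Finsupp.linearCombination_apply, Finsupp.sum, Finsupp.sum, LinearMap.sum_apply]
    rfl
  have h2 : lD.comp (m₁ := k + 1) (m₂ := 0) (m₃ := 0) G (Finsupp.single (corolla k) 1) =
      Finsupp.linearCombination ℤ
        (fun Γ => compose (m₁ := k + 1) (m₂ := 0) (m₃ := 0) Γ (corolla k)) G := by
    simp [lD.comp, Finsupp.linearCombination_apply]
  rw [operation, DirectSum.toModule_lof, h, gen_corolla, h2, operationHom]
  exact Finsupp.apply_linearCombination ℤ _ _ _

/-- Gluings correspond bijectively to their pivots, and `S` is the set of pivots which L allows. -/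
theorem operationHom_genusOne {L : List (OrSegment fun _ : Fin 1 => 1)}
    (hpos : ∀ s ∈ L, s.2 = true) (hL : L.Pairwise fun s t => s.1.2 < t.1.2) (k : ℕ) (q : ℤ)
    (x : (Φ.obj (k + 1)).X q) (S : Finset (Fin (k + 1)))
    (hS : ∀ i, i ∈ S ↔ ∀ a : Fin k, ∃ s ∈ L, s.1.2.val = if a.val < i.val then 0 else 1) :
    Φ.operationHom k q x (Finsupp.single (genusOne L) 1) =
      Φ.incl (k + 1) q (Φ.evalHom q x (∑ i ∈ S, ((-1 : ℤ) ^ (k + i.val)) • Φ.twoMap k i)) := by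
  classical
  rw [operationHom, Finsupp.linearCombination_single, one_smul, compose, Finset.sum_sigma',
    Finset.univ_sigma_univ, ← Finset.sum_filter, map_sum, map_sum, map_sum]
  refine Finset.sum_bij (fun p _ => p.2.pivot) ?_ ?_ ?_ ?_
  · rintro p hp
    rw [hS]
    exact fun a => ⟨_, List.get_mem _ _, segment_of_isGluing hpos hL (Finset.mem_filter.1 hp).2 a⟩
  · intro p hp p' hp' h
    exact eq_of_isGluing hpos hL p p' (Finset.mem_filter.1 hp).2 (Finset.mem_filter.1 hp').2 h
  · intro i hi
    obtain ⟨w, π, h, rfl⟩ := exists_isGluing hpos hL i ((hS i).1 hi)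
    exact ⟨⟨w, π⟩, Finset.mem_filter.2 ⟨Finset.mem_univ _, h⟩, rfl⟩
  · rintro ⟨w, π⟩ hp
    have h : IsGluing w π := (Finset.mem_filter.1 hp).2
    change Finsupp.linearCombination ℤ _ (π.sign • π.glue.gen) = _
    rw [π.gen_glue, sign_of_isGluing hpos hL h, map_zsmul, map_zsmul, map_zsmul,
      Finsupp.linearCombination_single, one_smul,
      Φ.diagramOp_eq q (passage_deg 0) (twoLabel_surjective π.pivot) _
        (cut_glue_of_isGluing hpos hL h), ← Φ.twoMap_eq]
    rfl

/-- With both segments every pivot is allowed. With `seg 0` alone the pivot must come last, with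
`seg 1` alone first, and with no segment there may be no half-edges to attach, so `k = 0`. -/
theorem operationHom_comp (k : ℕ) (q : ℤ) (x : (Φ.obj (k + 1)).X q) :
    Φ.operationHom k q x (lD.comp (m₁ := 0) (m₂ := 0) (m₃ := 0) muProd deltaCoprod) =
      Φ.incl (k + 1) q (Φ.evalHom q x (Φ.muDeltaMap k)) := by
  rw [comp_muProd_deltaCoprod, map_add, map_sub, map_sub,
    Φ.operationHom_genusOne (L := [seg 0, seg 1]) (by simp) (by simp) k q x Finset.univ,
    Φ.operationHom_genusOne (L := [seg 0]) (by simp) (by simp) k q x {Fin.last k},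
    Φ.operationHom_genusOne (L := [seg 1]) (by simp) (by simp) k q x {0},
    Φ.operationHom_genusOne (L := []) (by simp) (by simp) k q x (if k = 0 then {0} else ∅),
    ← map_sub, ← map_sub, ← map_sub, ← map_sub, ← map_add, ← map_add]
  · congr 2
    have hk : ((-1 : ℤ) ^ (k + k)) = 1 := by rw [← two_mul, pow_mul]; simp
    rw [muDeltaMap, Fin.sum_univ_eq_sum_range (fun i => ((-1 : ℤ) ^ (k + i)) • Φ.twoMap k i),
      Finset.sum_singleton, Finset.sum_singleton, Fin.val_last, hk, one_smul]
    congr 1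
    split_ifs with h
    · subst h; simp
    · simp
  · intro i
    split_ifs with h
    · subst h
      simp
      omega
    · simp
      exact ⟨0, by omega⟩
  · intro i
    simp only [List.mem_singleton, exists_eq_left, Finset.mem_singleton]
    constructor
    · rintro rfl a
      exact (if_neg (Nat.not_lt_zero _)).symm
    · intro h
      by_contra hi
      have hi' : 0 < i.val := Nat.pos_of_ne_zero fun e => hi (Fin.ext e)
      have := h ⟨0, by have := i.isLt; omega⟩
      rw [if_pos hi'] at this
      exact one_ne_zero this
  · intro i
    simp only [List.mem_singleton, exists_eq_left, Finset.mem_singleton]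
    constructor
    · rintro rfl a
      exact (if_pos a.isLt).symm
    · intro h
      by_contra hi
      have hi' : i.val < k := lt_of_le_of_ne (Nat.lt_succ_iff.1 i.isLt) fun e => hi (Fin.ext e)
      have := h ⟨i.val, hi'⟩
      rw [if_neg (lt_irrefl _)] at this
      exact zero_ne_one this
  · intro i
    simp only [Finset.mem_univ, true_iff]
    intro a
    split_ifs
    · exact ⟨seg 0, by simp, rfl⟩
    · exact ⟨seg 1, by simp, rfl⟩

theorem operation_comp :
    Φ.operation (lD.comp (m₁ := 0) (m₂ := 0) (m₃ := 0) muProd deltaCoprod) = Φ.muDeltaOp := by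
  refine DirectSum.linearMap_ext _ fun ⟨k, q⟩ => LinearMap.ext fun x => ?_
  change Φ.operation _ (Φ.incl k q x) = Φ.muDeltaOp (Φ.incl k q x)
  rw [operation_incl, operationHom_comp, muDeltaOp_incl]
  rfl

end CFrPlusFunctor

theorem mainTheorem9 :
    muProd ∈ lDPlus 2 0 1 0 ∧ deltaCoprod ∈ lDPlus 1 0 2 0 ∧
    boundingElement ∈ lD 1 0 1 0 ∧ boundingElement ∈ lDPlus 1 0 1 0 ∧
    lD.comp (m₁ := 0) (m₂ := 0) (m₃ := 0) muProd deltaCoprod = lD.d boundingElement ∧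
    ∀ {R : Type u} [CommRing R] (Φ : CFrPlusFunctor.{u, v} R),
      Φ.ActsOnHomologyBy
        (Φ.operation (lD.comp (m₁ := 0) (m₂ := 0) (m₃ := 0) muProd deltaCoprod)) 0 := by
  refine ⟨LoopedDiagram.muProd_mem, LoopedDiagram.deltaCoprod_mem,
    LoopedDiagram.lDPlus_le_lD _ _ _ _ LoopedDiagram.boundingElement_mem,
    LoopedDiagram.boundingElement_mem,
    LoopedDiagram.comp_muProd_deltaCoprod.trans LoopedDiagram.d_boundingElement.symm, fun Φ => ?_⟩
  rw [Φ.operation_comp]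
  exact Φ.actsOnHomologyBy_muDeltaOp
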